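/- **Theorem (Framed Alexander).** An *oriented framed link* in $\mathbb{R}^3$ is a smooth embedding of finitely many disjoint oriented circles into $\mathbb{R}^3$ together with a smooth vector field along it that is nowhere tangent to it (the field spans a thin ribbon along each component; the other edge of the ribbon is the longitude). Two oriented framed links are *isotopic* if, up to a bijection between their components, they are the two ends of a smooth family of oriented framed links parametrized by $[0,1]$. A *geometric framed braid on $n$ ribbons* consists of $n$ pairwise disjoint smooth strands in $\mathbb{R}^2\times[0,1]$, each of which meets every plane $\mathbb{R}^2\times\{t\}$ in exactly one point, joining the midpoints of the intervals $[i,i+\tfrac12]\times\{0\}\times\{0\}$ to the midpoints of the intervals $[j,j+\tfrac12]\times\{0\}\times\{1\}$ ($i,j=1,\dots,n$) according to some permutation, together with a smooth nowhere zero horizontal vector field along each strand that equals $(1,0,0)$ at both ends (so the ribbons make full twists only); strands and fields are required to extend smoothly by constants beyond $t=0$ and $t=1$. The strands are oriented by increasing $t$. Its *standard closure* is the oriented framed link obtained by bending $\mathbb{R}^2\times[0,1]$ half way around an axis, by $(x,y,t)\mapsto(e^{x}\cos\pi t,\;e^{x}\sin\pi t,\;-y)$, and joining, for $j=1,\dots,n$,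 the image of the $j$-th interval at level $1$ to the image of the $j$-th interval at level $0$ through the remaining half turn by $n$ untwisted and unlinked ribbons lying flat in the plane $\{z=0\}$ along concentric half circles. Then every oriented framed link in $\mathbb{R}^3$ is isotopic to the standard closure of a geometric framed braid on $n$ ribbons, for some $n\ge 0$. -/

import Mathlib

open scoped ContDiff

/-- Three-dimensional Euclidean space. -/
abbrev Space : Type := EuclideanSpace ℝ (Fin 3)

/-- An oriented framed link in `ℝ³` with components indexed by `ι`: a smooth embedding of a disjoint
union of circles `ℝ / ℤ` (each written as a `1`-periodic map on `ℝ`, its direction giving the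
orientation), with a smooth framing vector field along it that is nowhere tangent to it.
The vector field spans a thin ribbon `curve i t + u • frame i t` (`0 ≤ u ≤ ε`) whose other edge is
the longitude of the component. -/
structure FramedLink (ι : Type*) where
  /-- the core curves -/
  curve : ι → ℝ → Space
  /-- the framing vector fields -/
  frame : ι → ℝ → Space
  contDiff_curve : ∀ i, ContDiff ℝ ∞ (curve i)
  contDiff_frame : ∀ i, ContDiff ℝ ∞ (frame i)
  periodic_curve : ∀ i, Function.Periodic (curve i) 1
  periodic_frame : ∀ i, Function.Periodic (frame i) 1
  embedded : ∀ i j s t, curve i s = curve j t → i = j ∧ ∃ k : ℤ, t = s + k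
  /-- the core is immersed and the framing is nowhere tangent to it -/
  nowhere_tangent : ∀ i t, LinearIndependent ℝ ![deriv (curve i) t, frame i t]

/-- Isotopy of oriented framed links: up to a bijection between the components, the two links are
the ends of a smooth family `H s`, `0 ≤ s ≤ 1`, of framed links. -/
def FramedLink.Isotopic {ι κ : Type*} (L : FramedLink ι) (M : FramedLink κ) : Prop :=
  ∃ (e : ι ≃ κ) (H : ℝ → FramedLink ι),
    (∀ i, ContDiffOn ℝ ∞ (fun p : ℝ × ℝ => (H p.1).curve i p.2) (Set.Icc 0 1 ×ˢ Set.univ)) ∧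
    (∀ i, ContDiffOn ℝ ∞ (fun p : ℝ × ℝ => (H p.1).frame i p.2) (Set.Icc 0 1 ×ˢ Set.univ)) ∧
    (∀ i, (H 0).curve i = L.curve i ∧ (H 0).frame i = L.frame i) ∧
    (∀ i, (H 1).curve i = M.curve (e i) ∧ (H 1).frame i = M.frame (e i))

/-- The horizontal position of the core of the `i`-th endpoint interval `[i, i + 1/2] × {0}`,
`i = 1, …, n` (the index `i : Fin n` starts at `0`). -/
noncomputable def braidEndpoint {n : ℕ} (i : Fin n) : ℝ × ℝ := ((i : ℝ) + 1 + 1 / 4, 0)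

/-- A geometric framed braid on `n` ribbons. The core of the `i`-th ribbon meets the plane at height
`t ∈ [0, 1]` exactly in the point `(strand i t, t)`, and there the ribbon points in the horizontal
direction `frame i t`. The ribbons start and end flat, in the direction `(1, 0)` of the endpoint
intervals (so they make full twists only). They are oriented by increasing `t`, and the
parametrizations are extended to all `t : ℝ` by constants, smoothly. -/
structure FramedBraid (n : ℕ) where
  /-- the `i`-th ribbon ends at the `perm i`-th endpoint interval -/
  perm : Equiv.Perm (Fin n)
  strand : Fin n → ℝ → ℝ × ℝ
  frame : Fin n → ℝ → ℝ × ℝ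
  contDiff_strand : ∀ i, ContDiff ℝ ∞ (strand i)
  contDiff_frame : ∀ i, ContDiff ℝ ∞ (frame i)
  strand_of_nonpos : ∀ i t, t ≤ 0 → strand i t = braidEndpoint i
  strand_of_one_le : ∀ i t, 1 ≤ t → strand i t = braidEndpoint (perm i)
  frame_of_nonpos : ∀ i t, t ≤ 0 → frame i t = (1, 0)
  frame_of_one_le : ∀ i t, 1 ≤ t → frame i t = (1, 0)
  disjoint : ∀ i j t, strand i t = strand j t → i = j
  frame_ne_zero : ∀ i t, frame i t ≠ 0

/-- The diffeomorphism `ℝ² × ℝ / ℤ → ℝ³ ∖ (axis)`, orientation preserving for the standard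
orientations, that bends `ℝ² × [0, 1]` once around the third axis. It sends a point `p` at level `s`
to the point at angle `2 π s`, distance `exp p.1` from the axis, and third coordinate `-p.2`. -/
noncomputable def bend (p : ℝ × ℝ) (s : ℝ) : Space :=
  !₂[Real.exp p.1 * Real.cos (2 * Real.pi * s), Real.exp p.1 * Real.sin (2 * Real.pi * s), -p.2]

/-- The image of the horizontal tangent vector `v` at `(p, s)` under the derivative of `bend`. -/
noncomputable def bendVec (p v : ℝ × ℝ) (s : ℝ) : Space :=
  !₂[Real.exp p.1 * v.1 * Real.cos (2 * Real.pi * s),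
    Real.exp p.1 * v.1 * Real.sin (2 * Real.pi * s), -v.2]

theorem hasDerivAt_space_iff {f : ℝ → Space} {f' : Space} {t : ℝ} :
    HasDerivAt f f' t ↔ ∀ i, HasDerivAt (fun u => f u i) (f' i) t := by
  simp only [hasDerivAt_iff_hasFDerivAt, ← hasFDerivWithinAt_univ]
  rw [hasFDerivWithinAt_euclidean]
  refine forall_congr' fun i => ?_
  have : (PiLp.proj 2 (fun _ : Fin 3 => ℝ) i ∘L ContinuousLinearMap.toSpanSingleton ℝ f') =
      ContinuousLinearMap.toSpanSingleton ℝ (f' i) := by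
    ext; simp
  rw [this]

/-- `bendVec` is indeed the horizontal derivative of `bend`. -/
theorem hasDerivAt_bend (p v : ℝ × ℝ) (s : ℝ) :
    HasDerivAt (fun u : ℝ => bend (p + u • v) s) (bendVec p v s) 0 := by
  rw [hasDerivAt_space_iff]
  have h1 : HasDerivAt (fun u : ℝ => p.1 + u * v.1) v.1 0 := by
    simpa using ((hasDerivAt_id (0 : ℝ)).mul_const v.1).const_add p.1
  have h2 : HasDerivAt (fun u : ℝ => p.2 + u * v.2) v.2 0 := by
    simpa using ((hasDerivAt_id (0 : ℝ)).mul_const v.2).const_add p.2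
  have he : HasDerivAt (fun u : ℝ => Real.exp (p.1 + u * v.1)) (Real.exp p.1 * v.1) 0 := by
    simpa using h1.exp
  intro i
  fin_cases i
  · simpa [bend, bendVec] using he.mul_const (Real.cos (2 * Real.pi * s))
  · simpa [bend, bendVec] using he.mul_const (Real.sin (2 * Real.pi * s))
  · exact h2.neg

theorem bend_inj {p q : ℝ × ℝ} {s t : ℝ} (h : bend p s = bend q t) :
    p = q ∧ ∃ m : ℤ, t = s + m := by
  have h0 : Real.exp p.1 * Real.cos (2 * Real.pi * s) =
      Real.exp q.1 * Real.cos (2 * Real.pi * t) := by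
    simpa [bend] using congrArg (fun x : Space => x 0) h
  have h1 : Real.exp p.1 * Real.sin (2 * Real.pi * s) =
      Real.exp q.1 * Real.sin (2 * Real.pi * t) := by
    simpa [bend] using congrArg (fun x : Space => x 1) h
  have h2 : p.2 = q.2 := by
    simpa [bend] using congrArg (fun x : Space => x 2) h
  have hp := Real.exp_pos p.1
  have hq := Real.exp_pos q.1
  have hsq : Real.exp p.1 ^ 2 = Real.exp q.1 ^ 2 := by
    have e1 := Real.sin_sq_add_cos_sq (2 * Real.pi * s)
    have e2 := Real.sin_sq_add_cos_sq (2 * Real.pi * t)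
    calc Real.exp p.1 ^ 2 = (Real.exp p.1 * Real.cos (2 * Real.pi * s)) ^ 2 +
          (Real.exp p.1 * Real.sin (2 * Real.pi * s)) ^ 2 := by linear_combination -Real.exp p.1 ^ 2 * e1
      _ = (Real.exp q.1 * Real.cos (2 * Real.pi * t)) ^ 2 +
          (Real.exp q.1 * Real.sin (2 * Real.pi * t)) ^ 2 := by rw [h0, h1]
      _ = Real.exp q.1 ^ 2 := by linear_combination Real.exp q.1 ^ 2 * e2
  have he : Real.exp p.1 = Real.exp q.1 := (pow_left_inj₀ hp.le hq.le two_ne_zero).1 hsq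
  refine ⟨Prod.ext (Real.exp_injective he) h2, ?_⟩
  rw [he] at h0 h1
  have hc := mul_left_cancel₀ hq.ne' h0
  have hs := mul_left_cancel₀ hq.ne' h1
  have ha : ((2 * Real.pi * s : ℝ) : Real.Angle) = ((2 * Real.pi * t : ℝ) : Real.Angle) :=
    Real.Angle.cos_sin_inj hc hs
  obtain ⟨k, hk⟩ := Real.Angle.angle_eq_iff_two_pi_dvd_sub.1 ha
  refine ⟨-k, ?_⟩
  have hpi : (2 * Real.pi) ≠ 0 := by positivity
  apply mul_left_cancel₀ hpi
  push_cast
  linear_combination -hk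

theorem bend_add_int (p : ℝ × ℝ) (s : ℝ) (m : ℤ) : bend p (s + m) = bend p s := by
  have h : 2 * Real.pi * (s + m) = 2 * Real.pi * s + m * (2 * Real.pi) := by ring
  simp only [bend, h, Real.cos_add_int_mul_two_pi, Real.sin_add_int_mul_two_pi]

theorem bendVec_add_int (p v : ℝ × ℝ) (s : ℝ) (m : ℤ) : bendVec p v (s + m) = bendVec p v s := by
  have h : 2 * Real.pi * (s + m) = 2 * Real.pi * s + m * (2 * Real.pi) := by ring
  simp only [bendVec, h, Real.cos_add_int_mul_two_pi, Real.sin_add_int_mul_two_pi]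

theorem contDiff_bend {f : ℝ → ℝ × ℝ} {g : ℝ → ℝ} (hf : ContDiff ℝ ∞ f) (hg : ContDiff ℝ ∞ g) :
    ContDiff ℝ ∞ (fun t => bend (f t) (g t)) := by
  rw [contDiff_euclidean]
  intro i
  fin_cases i <;> simp only [bend] <;> simp <;> fun_prop

theorem contDiff_bendVec {f v : ℝ → ℝ × ℝ} {g : ℝ → ℝ} (hf : ContDiff ℝ ∞ f)
    (hv : ContDiff ℝ ∞ v) (hg : ContDiff ℝ ∞ g) :
    ContDiff ℝ ∞ (fun t => bendVec (f t) (v t) (g t)) := by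
  rw [contDiff_euclidean]
  intro i
  fin_cases i <;> simp only [bendVec] <;> simp <;> fun_prop

/-- A curve that winds around the axis with positive angular speed is immersed, and the image of a
nonzero horizontal vector is not tangent to it. -/
theorem linearIndependent_bend {f : ℝ → ℝ × ℝ} {c : ℝ} (hc : c ≠ 0) (hf : ContDiff ℝ ∞ f)
    {v : ℝ × ℝ} (hv : v ≠ 0) (t : ℝ) :
    LinearIndependent ℝ
      ![deriv (fun t => bend (f t) (c * t)) t, bendVec (f t) v (c * t)] := by
  have hd : DifferentiableAt ℝ f t := hf.contDiffAt.differentiableAt (by simp)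
  obtain ⟨x, hx⟩ : ∃ x, HasDerivAt (fun t => Real.exp (f t).1) x t :=
    ⟨_, (hd.fst.hasDerivAt).exp⟩
  have ha : HasDerivAt (fun t : ℝ => 2 * Real.pi * (c * t)) (2 * Real.pi * c) t := by
    simpa [mul_assoc] using (hasDerivAt_id t).const_mul (2 * Real.pi * c)
  have hD := (((contDiff_bend hf (contDiff_const.mul contDiff_id)).contDiffAt (x := t)).differentiableAt
    (by simp)).hasDerivAt (f := fun t => bend (f t) (c * t))
  set D := deriv (fun t => bend (f t) (c * t)) t with hDdef
  have h0 : D 0 = x * Real.cos (2 * Real.pi * (c * t)) +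
      Real.exp (f t).1 * (-Real.sin (2 * Real.pi * (c * t)) * (2 * Real.pi * c)) := by
    have := (hasDerivAt_space_iff.1 hD) 0
    exact this.unique (hx.mul ha.cos)
  have h1 : D 1 = x * Real.sin (2 * Real.pi * (c * t)) +
      Real.exp (f t).1 * (Real.cos (2 * Real.pi * (c * t)) * (2 * Real.pi * c)) := by
    have := (hasDerivAt_space_iff.1 hD) 1
    exact this.unique (hx.mul ha.sin)
  rw [LinearIndependent.pair_iff]
  intro a b hab
  have e0 := congrArg (fun w : Space => w 0) hab
  have e1 := congrArg (fun w : Space => w 1) hab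
  have e2 := congrArg (fun w : Space => w 2) hab
  simp [bendVec, h0, h1] at e0 e1 e2
  have hE := Real.exp_pos (f t).1
  have key := Real.sin_sq_add_cos_sq (2 * Real.pi * (c * t))
  set C := Real.cos (2 * Real.pi * (c * t))
  set S := Real.sin (2 * Real.pi * (c * t))
  have hA : a * (Real.exp (f t).1 * (2 * Real.pi * c)) = 0 := by
    linear_combination C * e1 - S * e0 - a * (Real.exp (f t).1 * (2 * Real.pi * c)) * key
  have hne : Real.exp (f t).1 * (2 * Real.pi * c) ≠ 0 :=
    mul_ne_zero hE.ne' (mul_ne_zero (by positivity) hc)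
  have ha0 : a = 0 := (mul_eq_zero.1 hA).resolve_right hne
  subst ha0
  refine ⟨rfl, ?_⟩
  by_contra hb
  apply hv
  have hB : b * (Real.exp (f t).1 * v.1) = 0 := by
    linear_combination C * e0 + S * e1 - b * (Real.exp (f t).1 * v.1) * key
  have hv1 : v.1 = 0 := by
    have := (mul_eq_zero.1 hB).resolve_left hb
    exact (mul_eq_zero.1 this).resolve_left hE.ne'
  have hv2 : v.2 = 0 := by
    simpa [hb] using e2
  exact Prod.ext hv1 hv2

namespace FramedBraid

variable {n : ℕ} (b : FramedBraid n)

/-- Start in the `i`-th strand and follow the closed braid: during the first half of each time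
interval `[k, k + 1]` one runs through the strand reached after `k` turns, during the second half
one stays at its end, that is, runs through an untwisted closing ribbon. -/
noncomputable def closedStrand (i : Fin n) (s : ℝ) : ℝ × ℝ :=
  b.strand ((b.perm ^ ⌊s⌋) i) (2 * Int.fract s)

/-- The framing along `closedStrand`. -/
noncomputable def closedFrame (i : Fin n) (s : ℝ) : ℝ × ℝ :=
  b.frame ((b.perm ^ ⌊s⌋) i) (2 * Int.fract s)

theorem closed_eq (i : Fin n) (k : ℤ) (s : ℝ) (h1 : k - 1 / 2 < s) (h2 : s < k + 1) :
    b.closedStrand i s = b.strand ((b.perm ^ k) i) (2 * (s - k)) ∧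
    b.closedFrame i s = b.frame ((b.perm ^ k) i) (2 * (s - k)) := by
  rcases le_or_gt (k : ℝ) s with h | h
  · have hk : ⌊s⌋ = k := Int.floor_eq_iff.2 ⟨h, h2⟩
    simp [closedStrand, closedFrame, Int.fract, hk]
  · have hk : ⌊s⌋ = k - 1 := Int.floor_eq_iff.2 ⟨by push_cast; linarith, by push_cast; linarith⟩
    have hp : (b.perm ^ k) i = b.perm ((b.perm ^ (k - 1)) i) := by
      rw [← Equiv.Perm.mul_apply, ← zpow_one_add]; congr 2; ring
    have e1 : 1 ≤ 2 * (s - ((k - 1 : ℤ) : ℝ)) := by push_cast; linarith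
    have e2 : 2 * (s - (k : ℝ)) ≤ 0 := by linarith
    simp only [closedStrand, closedFrame, Int.fract, hk]
    rw [b.strand_of_one_le _ _ e1, b.strand_of_nonpos _ _ e2, b.frame_of_one_le _ _ e1,
      b.frame_of_nonpos _ _ e2, hp]
    exact ⟨rfl, rfl⟩

theorem contDiff_closed (i : Fin n) :
    ContDiff ℝ ∞ (b.closedStrand i) ∧ ContDiff ℝ ∞ (b.closedFrame i) := by
  have key : ∀ s : ℝ, ∀ᶠ u in nhds s, ((⌊s⌋ : ℤ) : ℝ) - 1 / 2 < u ∧ u < (⌊s⌋ : ℤ) + 1 := by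
    intro s
    exact Ioo_mem_nhds (by linarith [Int.floor_le s]) (Int.lt_floor_add_one s)
  have hlin : ∀ k : ℤ, ContDiff ℝ ∞ (fun s : ℝ => 2 * (s - k)) := fun k => by fun_prop
  constructor
  · refine contDiff_iff_contDiffAt.2 fun s => ?_
    refine (((b.contDiff_strand ((b.perm ^ ⌊s⌋) i)).comp (hlin ⌊s⌋)).contDiffAt).congr_of_eventuallyEq ?_
    filter_upwards [key s] with u hu
    exact (b.closed_eq i ⌊s⌋ u hu.1 hu.2).1
  · refine contDiff_iff_contDiffAt.2 fun s => ?_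
    refine (((b.contDiff_frame ((b.perm ^ ⌊s⌋) i)).comp (hlin ⌊s⌋)).contDiffAt).congr_of_eventuallyEq ?_
    filter_upwards [key s] with u hu
    exact (b.closed_eq i ⌊s⌋ u hu.1 hu.2).2

/-- The components of the closure: the cycles (fixed points included) of the permutation. -/
abbrev Component : Type := Quotient (Equiv.Perm.SameCycle.setoid b.perm)

/-- The number of ribbons that make up a component. -/
noncomputable def turns (c : b.Component) : ℕ := Function.minimalPeriod b.perm c.out

theorem turns_pos (c : b.Component) : 0 < b.turns c :=
  Function.minimalPeriod_pos_of_mem_periodicPts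
    (Function.Injective.mem_periodicPts b.perm.injective c.out)

theorem perm_zpow_eq_iff (c : b.Component) (m : ℤ) :
    (b.perm ^ m) c.out = c.out ↔ (b.turns c : ℤ) ∣ m := by
  simpa [turns] using MulAction.zpow_smul_eq_iff_minimalPeriod_dvd (a := b.perm) (b := c.out) (n := m)

theorem closed_add_turns (c : b.Component) (s : ℝ) :
    b.closedStrand c.out (s + b.turns c) = b.closedStrand c.out s ∧
    b.closedFrame c.out (s + b.turns c) = b.closedFrame c.out s := by
  have h : (b.perm ^ (b.turns c : ℤ)) c.out = c.out := (b.perm_zpow_eq_iff c _).2 dvd_rfl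
  have h' : (b.perm ^ (⌊s⌋ + (b.turns c : ℤ))) c.out = (b.perm ^ ⌊s⌋) c.out := by
    rw [zpow_add, Equiv.Perm.mul_apply, h]
  simp only [closedStrand, closedFrame, Int.floor_add_natCast, Int.fract_add_natCast, h', and_self]

/-- The standard closure of a framed braid, an oriented framed link. The space `ℝ² × [0, 1]` of the
braid is bent into the angles `[0, π]` around the third axis, and the corresponding endpoint
intervals are connected, through the angles `[π, 2 π]`, by untwisted unlinked ribbons, which lie flat
in the horizontal coordinate plane along concentric half circles. A component that consists of
`ℓ` ribbons winds `ℓ` times around the axis. -/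
noncomputable def closure : FramedLink b.Component where
  curve c t := bend (b.closedStrand c.out (b.turns c * t)) (b.turns c * t)
  frame c t := bendVec (b.closedStrand c.out (b.turns c * t))
    (b.closedFrame c.out (b.turns c * t)) (b.turns c * t)
  contDiff_curve c := contDiff_bend
    ((b.contDiff_closed c.out).1.comp (contDiff_const.mul contDiff_id))
    (contDiff_const.mul contDiff_id)
  contDiff_frame c := contDiff_bendVec
    ((b.contDiff_closed c.out).1.comp (contDiff_const.mul contDiff_id))
    ((b.contDiff_closed c.out).2.comp (contDiff_const.mul contDiff_id))
    (contDiff_const.mul contDiff_id)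
  periodic_curve c t := by
    have h := bend_add_int (b.closedStrand c.out (b.turns c * t)) (b.turns c * t) (b.turns c)
    simp only [mul_add, mul_one, (b.closed_add_turns c _).1]
    simpa using h
  periodic_frame c t := by
    have h := bendVec_add_int (b.closedStrand c.out (b.turns c * t))
      (b.closedFrame c.out (b.turns c * t)) (b.turns c * t) (b.turns c)
    simp only [mul_add, mul_one, (b.closed_add_turns c _).1, (b.closed_add_turns c _).2]
    simpa using h
  embedded c d s t h := by
    obtain ⟨hp, m, hm⟩ := bend_inj h
    rw [hm] at hp
    simp only [closedStrand, Int.floor_add_intCast, Int.fract_add_intCast] at hp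
    have h1 := b.disjoint _ _ _ hp
    rw [zpow_add, Equiv.Perm.mul_apply] at h1
    have h2 : c.out = (b.perm ^ m) d.out := (b.perm ^ ⌊(b.turns c : ℝ) * s⌋).injective h1
    have hcd : c = d := by
      rw [← Quotient.out_eq c, ← Quotient.out_eq d]
      refine Quotient.sound (?_ : b.perm.SameCycle c.out d.out)
      exact Equiv.Perm.SameCycle.symm ⟨m, h2.symm⟩
    subst hcd
    obtain ⟨k, hk⟩ := (b.perm_zpow_eq_iff c m).1 h2.symm
    refine ⟨rfl, k, ?_⟩
    have hpos : (b.turns c : ℝ) ≠ 0 := Nat.cast_ne_zero.2 (b.turns_pos c).ne'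
    apply mul_left_cancel₀ hpos
    rw [hm, hk]
    push_cast
    ring
  nowhere_tangent c t := linearIndependent_bend (Nat.cast_ne_zero.2 (b.turns_pos c).ne')
    ((b.contDiff_closed c.out).1.comp (contDiff_const.mul contDiff_id)) (b.frame_ne_zero _ _) t

end FramedBraid

/-! ### Simple families of closed curves, and bisectors of two directions -/

open Set Filter Topology

/-! The proof is Alexander's trick, carried out on polygons and transferred to smooth curves by
mollification. Let a curve be called positive if `xyDet` of its position and velocity is positive,
so that it winds strictly counterclockwise around the third axis. A positive curve avoids the axis
and its angle is strictly increasing; parametrized by the angle it is a closed braid. The heart of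
the matter is therefore to make a link positive (`FramedLink.exists_winding_pos`).

The link is replaced by a fine inscribed polygon, moved slightly by a generic affine map (`tilt`) so
that no edge is coplanar with the axis. Closeness is measured by `LipClose`, which makes sense for
polygons, passes to mollifications and to straight lines of curves, and forces curves to be simple
and immersed (`FramedLink.exists_lipClose`). Hence the link is isotopic to all sufficiently fine
smoothings of the polygon (`FramedLink.exists_polygon`).

A negative edge is cut into short parts, and each part is replaced by the other two sides of a thin
triangle whose apex lies just across the axis; these two sides are positive. A thin triangle over a
short part near `p` is close to a segment from `p` to a point of the axis. The plane through `p` and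
the axis meets the rest of the link in a countable set, so almost every height on the axis gives a
segment missing the rest (`exists_window`); compactness of the edge yields finitely many parts
(`exists_windows`), and distinct heights make the triangles disjoint up to common vertices
(`eventually_tri_inter`). The straight line homotopy from the edge to the sawtooth stays in the
triangles and consists of simple curves (`exists_replace_edge`).

Such a homotopy of simple polygons induces, for all small scales, a homotopy of simple immersed
mollified curves (`eventually_simple_mol_line`), and a framing can be carried along it
(`FramedLink.exists_isotopic_of_line`). Induction on the number of negative edges removes them all;
mollifying a positive polygon at a small scale gives a positive smooth link
(`eventually_xyDet_mol_pos`).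

For a positive link the framing is made horizontal by subtracting tangent vectors, and a smooth
complex logarithm provides cylindrical coordinates (`FramedLink.exists_isotopicBent`). The closed
braid is then normalized by isotopies among closed braids: shears of the plane put the points over
the integers at the standard endpoints, a homotopy of logarithms makes the framing standard there,
and a change of time compresses the braiding into half of each turn. Cutting at the integers gives
the braid, and its closure is the link up to a shift of the parameters
(`FramedLink.IsotopicBent.exists_closure`). -/

/-- A family of closed curves is simple if it is injective modulo integer translations. -/
def SimpleLoops {ι : Type*} (γ : ι → ℝ → Space) : Prop :=
  ∀ i j s t, γ i s = γ j t → i = j ∧ ∃ k : ℤ, t = s + k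

theorem FramedLink.simpleLoops {ι : Type*} (L : FramedLink ι) : SimpleLoops L.curve := L.embedded

theorem contDiff_of_contDiffOn_family {E : Type*} [NormedAddCommGroup E] [NormedSpace ℝ E]
    {C : ℝ → ℝ → E}
    (hC : ContDiffOn ℝ ∞ (fun p : ℝ × ℝ => C p.1 p.2) (Icc 0 1 ×ˢ univ)) {s : ℝ}
    (hs : s ∈ Icc (0 : ℝ) 1) : ContDiff ℝ ∞ (C s) := by
  have : ContDiffOn ℝ ∞ (fun t : ℝ => (fun p : ℝ × ℝ => C p.1 p.2) (s, t)) univ :=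
    hC.comp (contDiff_const.prodMk contDiff_id).contDiffOn (fun t _ => ⟨hs, mem_univ _⟩)
  exact contDiffOn_univ.1 this

/-- The bisector of the angle between two vectors that do not point in opposite directions. -/
theorem inner_bisector_pos {a b : Space} (ha : a ≠ 0) (hb : b ≠ 0) (h : ‖b‖ • a + ‖a‖ • b ≠ 0) :
    0 < inner ℝ (‖b‖ • a + ‖a‖ • b) a ∧ 0 < inner ℝ (‖b‖ • a + ‖a‖ • b) b := by
  have ha' : 0 < ‖a‖ := norm_pos_iff.2 ha
  have hb' : 0 < ‖b‖ := norm_pos_iff.2 hb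
  have key : 0 < ‖a‖ * ‖b‖ + inner ℝ a b := by
    have hle : -(‖a‖ * ‖b‖) ≤ inner ℝ a b := (abs_le.1 (abs_real_inner_le_norm _ _)).1
    rcases hle.lt_or_eq with h1 | h1
    · linarith
    · exfalso
      have := (inner_eq_norm_mul_iff_real (x := a) (y := -b)).1 (by
        rw [inner_neg_right, norm_neg, ← h1, neg_neg])
      apply h
      rw [norm_neg, smul_neg] at this
      rw [this, neg_add_cancel]
  have e1 : inner ℝ (‖b‖ • a + ‖a‖ • b) a = ‖a‖ * (‖a‖ * ‖b‖ + inner ℝ a b) := by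
    simp only [inner_add_left, real_inner_smul_left, real_inner_self_eq_norm_sq]
    rw [real_inner_comm]; ring
  have e2 : inner ℝ (‖b‖ • a + ‖a‖ • b) b = ‖b‖ * (‖a‖ * ‖b‖ + inner ℝ a b) := by
    simp only [inner_add_left, real_inner_smul_left, real_inner_self_eq_norm_sq]
    ring
  rw [e1, e2]
  exact ⟨mul_pos ha' key, mul_pos hb' key⟩

/-! ### Isotopies: concatenation, transport of framings, reparametrization -/

section Family

variable {ι κ : Type*}

/-- A smooth family of framed links that starts at a framed link `L` is an isotopy. -/
theorem FramedLink.exists_isotopic_of_family (L : FramedLink ι) (C F : ι → ℝ → ℝ → Space)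
    (hC : ∀ i, ContDiffOn ℝ ∞ (fun p : ℝ × ℝ => C i p.1 p.2) (Icc 0 1 ×ˢ univ))
    (hF : ∀ i, ContDiffOn ℝ ∞ (fun p : ℝ × ℝ => F i p.1 p.2) (Icc 0 1 ×ˢ univ))
    (pC : ∀ i, ∀ s ∈ Icc (0 : ℝ) 1, Function.Periodic (C i s) 1)
    (pF : ∀ i, ∀ s ∈ Icc (0 : ℝ) 1, Function.Periodic (F i s) 1)
    (emb : ∀ s ∈ Icc (0 : ℝ) 1, SimpleLoops (fun i => C i s))
    (ind : ∀ s ∈ Icc (0 : ℝ) 1, ∀ i t, LinearIndependent ℝ ![deriv (C i s) t, F i s t])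
    (hC0 : ∀ i, C i 0 = L.curve i) (hF0 : ∀ i, F i 0 = L.frame i) :
    ∃ M : FramedLink ι, (∀ i, M.curve i = C i 1) ∧ (∀ i, M.frame i = F i 1) ∧ L.Isotopic M := by
  classical
  let K : (s : ℝ) → s ∈ Icc (0 : ℝ) 1 → FramedLink ι := fun s hs =>
    { curve := fun i => C i s
      frame := fun i => F i s
      contDiff_curve := fun i => contDiff_of_contDiffOn_family (hC i) hs
      contDiff_frame := fun i => contDiff_of_contDiffOn_family (hF i) hs
      periodic_curve := fun i => pC i s hs
      periodic_frame := fun i => pF i s hs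
      embedded := emb s hs
      nowhere_tangent := ind s hs }
  let H : ℝ → FramedLink ι := fun s => if h : s ∈ Icc (0 : ℝ) 1 then K s h else L
  have hHC : ∀ s (_ : s ∈ Icc (0 : ℝ) 1) i, (H s).curve i = C i s := by
    intro s hs i
    simp only [H, dif_pos hs, K]
  have hHF : ∀ s (_ : s ∈ Icc (0 : ℝ) 1) i, (H s).frame i = F i s := by
    intro s hs i
    simp only [H, dif_pos hs, K]
  have m0 : (0 : ℝ) ∈ Icc (0 : ℝ) 1 := by simp
  have m1 : (1 : ℝ) ∈ Icc (0 : ℝ) 1 := by simp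
  refine ⟨K 1 m1, fun _ => rfl, fun _ => rfl, Equiv.refl ι, H, fun i => ?_, fun i => ?_, fun i => ?_,
    fun i => ?_⟩
  · exact (hC i).congr fun p hp => by rw [hHC p.1 hp.1]
  · exact (hF i).congr fun p hp => by rw [hHF p.1 hp.1]
  · exact ⟨(hHC 0 m0 i).trans (hC0 i), (hHF 0 m0 i).trans (hF0 i)⟩
  · exact ⟨(hHC 1 m1 i), (hHF 1 m1 i)⟩

theorem FramedLink.Isotopic.congr_right {L : FramedLink ι} {M : FramedLink κ} {κ' : Type*}
    {N : FramedLink κ'} (h : L.Isotopic M) (e : κ ≃ κ') (hc : ∀ i, M.curve i = N.curve (e i))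
    (hf : ∀ i, M.frame i = N.frame (e i)) : L.Isotopic N := by
  obtain ⟨e', H, h1, h2, h3, h4⟩ := h
  exact ⟨e'.trans e, H, h1, h2, h3, fun i => ⟨(h4 i).1.trans (hc _), (h4 i).2.trans (hf _)⟩⟩

/-- A family of curves over `[0, 1]`, slowed down at the ends, followed by another one. -/
noncomputable def glueParam (s : ℝ) : ℝ := Real.smoothTransition (3 * s - 1)

theorem contDiff_glueParam : ContDiff ℝ ∞ glueParam :=
  Real.smoothTransition.contDiff.comp (by fun_prop)

theorem glueParam_mem (s : ℝ) : glueParam s ∈ Icc (0 : ℝ) 1 :=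
  ⟨Real.smoothTransition.nonneg _, Real.smoothTransition.le_one _⟩

theorem glueParam_of_le {s : ℝ} (h : s ≤ 1 / 3) : glueParam s = 0 :=
  Real.smoothTransition.zero_of_nonpos (by linarith)

theorem glueParam_of_ge {s : ℝ} (h : 2 / 3 ≤ s) : glueParam s = 1 :=
  Real.smoothTransition.one_of_one_le (by linarith)

/-- Both pieces are at rest near the junction: for `1/3 ≤ s ≤ 2/3` both formulas give the common
curve `A 1 = B 0`, so smoothness can be checked locally. Since `glueParam` takes values in `[0, 1]`,
smoothness of `A` and `B` over that interval suffices. -/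
theorem contDiffOn_glue {E : Type*} [NormedAddCommGroup E] [NormedSpace ℝ E] {A B : ℝ → ℝ → E}
    (hA : ContDiffOn ℝ ∞ (fun p : ℝ × ℝ => A p.1 p.2) (Icc 0 1 ×ˢ univ))
    (hB : ContDiffOn ℝ ∞ (fun p : ℝ × ℝ => B p.1 p.2) (Icc 0 1 ×ˢ univ)) (hAB : A 1 = B 0)
    {G : ℝ → ℝ → E} (h1 : ∀ s, s ≤ 1 / 2 → G s = A (glueParam (2 * s)))
    (h2 : ∀ s, 1 / 2 < s → G s = B (glueParam (2 * s - 1))) :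
    ContDiff ℝ ∞ (fun p : ℝ × ℝ => G p.1 p.2) := by
  have cA : ContDiff ℝ ∞ (fun p : ℝ × ℝ => A (glueParam (2 * p.1)) p.2) := by
    rw [← contDiffOn_univ]
    refine hA.comp (g := fun p : ℝ × ℝ => A p.1 p.2)
      (f := fun p : ℝ × ℝ => (glueParam (2 * p.1), p.2)) (ContDiff.contDiffOn ?_)
      (fun p _ => ⟨glueParam_mem _, mem_univ _⟩)
    exact (contDiff_glueParam.comp (by fun_prop)).prodMk contDiff_snd
  have cB : ContDiff ℝ ∞ (fun p : ℝ × ℝ => B (glueParam (2 * p.1 - 1)) p.2) := by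
    rw [← contDiffOn_univ]
    refine hB.comp (g := fun p : ℝ × ℝ => B p.1 p.2)
      (f := fun p : ℝ × ℝ => (glueParam (2 * p.1 - 1), p.2)) (ContDiff.contDiffOn ?_)
      (fun p _ => ⟨glueParam_mem _, mem_univ _⟩)
    exact (contDiff_glueParam.comp (by fun_prop)).prodMk contDiff_snd
  refine contDiff_iff_contDiffAt.2 fun p => ?_
  rcases lt_or_ge p.1 (2 / 3) with hp | hp
  · refine cA.contDiffAt.congr_of_eventuallyEq ?_
    filter_upwards [continuous_fst.continuousAt (Iio_mem_nhds hp)] with x (hx : x.1 < 2 / 3)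
    rcases le_or_gt x.1 (1 / 2) with h | h
    · rw [h1 _ h]
    · rw [h2 _ h, glueParam_of_le (s := 2 * x.1 - 1) (by linarith),
        glueParam_of_ge (s := 2 * x.1) (by linarith), hAB]
  · refine cB.contDiffAt.congr_of_eventuallyEq ?_
    have : (1 / 2 : ℝ) < p.1 := by linarith
    filter_upwards [continuous_fst.continuousAt (Ioi_mem_nhds this)] with x hx
    rw [h2 _ hx]

theorem FramedLink.Isotopic.trans {L : FramedLink ι} {M : FramedLink κ} {μ : Type*}
    {N : FramedLink μ} (hLM : L.Isotopic M) (hMN : M.Isotopic N) : L.Isotopic N := by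
  obtain ⟨e, A, hA1, hA2, hA3, hA4⟩ := hLM
  obtain ⟨e', B, hB1, hB2, hB3, hB4⟩ := hMN
  let B' : ℝ → FramedLink ι := fun s =>
    { curve := fun i => (B s).curve (e i)
      frame := fun i => (B s).frame (e i)
      contDiff_curve := fun i => (B s).contDiff_curve _
      contDiff_frame := fun i => (B s).contDiff_frame _
      periodic_curve := fun i => (B s).periodic_curve _
      periodic_frame := fun i => (B s).periodic_frame _
      embedded := fun i j u v h => by
        obtain ⟨h1, h2⟩ := (B s).embedded _ _ _ _ h
        exact ⟨e.injective h1, h2⟩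
      nowhere_tangent := fun i t => (B s).nowhere_tangent _ _ }
  let G : ℝ → FramedLink ι := fun s =>
    if s ≤ 1 / 2 then A (glueParam (2 * s)) else B' (glueParam (2 * s - 1))
  have g1 : ∀ s, s ≤ 1 / 2 → G s = A (glueParam (2 * s)) := fun s hs => if_pos hs
  have g2 : ∀ s, 1 / 2 < s → G s = B' (glueParam (2 * s - 1)) := fun s hs => if_neg hs.not_ge
  refine ⟨e.trans e', G, fun i => ?_, fun i => ?_, fun i => ?_, fun i => ?_⟩
  · refine (contDiffOn_glue (A := fun s => (A s).curve i)
      (B := fun s => (B s).curve (e i)) (hA1 i) (hB1 (e i)) ((hA4 i).1.trans (hB3 (e i)).1.symm)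
      (G := fun s => (G s).curve i) ?_ ?_).contDiffOn
    · intro s hs; rw [g1 s hs]
    · intro s hs; rw [g2 s hs]
  · refine (contDiffOn_glue (A := fun s => (A s).frame i)
      (B := fun s => (B s).frame (e i)) (hA2 i) (hB2 (e i)) ((hA4 i).2.trans (hB3 (e i)).2.symm)
      (G := fun s => (G s).frame i) ?_ ?_).contDiffOn
    · intro s hs; rw [g1 s hs]
    · intro s hs; rw [g2 s hs]
  · rw [g1 0 (by norm_num), glueParam_of_le (by norm_num)]
    exact hA3 i
  · rw [g2 1 (by norm_num), glueParam_of_ge (by norm_num)]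
    exact hB4 (e i)

theorem contDiff_combo {E : Type*} [NormedAddCommGroup E] [NormedSpace ℝ E] {f g : ℝ → E}
    (hf : ContDiff ℝ ∞ f) (hg : ContDiff ℝ ∞ g) :
    ContDiff ℝ ∞ (fun p : ℝ × ℝ => f p.2 + p.1 • (g p.2 - f p.2)) := by
  have h1 : ContDiff ℝ ∞ (fun p : ℝ × ℝ => f p.2) := hf.comp contDiff_snd
  have h2 : ContDiff ℝ ∞ (fun p : ℝ × ℝ => g p.2) := hg.comp contDiff_snd
  exact h1.add (contDiff_fst.smul (h2.sub h1))

/-- A framing can be carried along the straight line isotopy of the core. -/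
theorem FramedLink.exists_isotopic_of_line (L : FramedLink ι) (C : ι → ℝ → Space)
    (hC : ∀ i, ContDiff ℝ ∞ (C i)) (pC : ∀ i, Function.Periodic (C i) 1)
    (emb : ∀ s ∈ Icc (0 : ℝ) 1, SimpleLoops (fun i t => L.curve i t + s • (C i t - L.curve i t)))
    (imm : ∀ s ∈ Icc (0 : ℝ) 1, ∀ i t,
      deriv (L.curve i) t + s • (deriv (C i) t - deriv (L.curve i) t) ≠ 0) :
    ∃ M : FramedLink ι, (∀ i, M.curve i = C i) ∧ L.Isotopic M := by
  set T0 : ι → ℝ → Space := fun i t => deriv (L.curve i) t with hT0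
  set T1 : ι → ℝ → Space := fun i t => deriv (C i) t with hT1
  have cT0 : ∀ i, ContDiff ℝ ∞ (T0 i) := fun i =>
    (contDiff_infty_iff_deriv.1 (L.contDiff_curve i)).2
  have cT1 : ∀ i, ContDiff ℝ ∞ (T1 i) := fun i =>
    (contDiff_infty_iff_deriv.1 (hC i)).2
  have pT0 : ∀ i, Function.Periodic (T0 i) 1 := fun i t => by
    have := congrArg (fun f => deriv f t) (funext (L.periodic_curve i))
    simpa [deriv_comp_add_const] using this
  have pT1 : ∀ i, Function.Periodic (T1 i) 1 := fun i t => by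
    have := congrArg (fun f => deriv f t) (funext (pC i))
    simpa [deriv_comp_add_const] using this
  have n0 : ∀ i t, T0 i t ≠ 0 := fun i t => by simpa using imm 0 (by simp) i t
  have n1 : ∀ i t, T1 i t ≠ 0 := fun i t => by simpa using imm 1 (by simp) i t
  -- the bisector, up to a positive factor
  set w : ι → ℝ → Space := fun i t => ‖T1 i t‖ • T0 i t + ‖T0 i t‖ • T1 i t with hw
  have cw : ∀ i, ContDiff ℝ ∞ (w i) := fun i =>
    (((cT1 i).norm ℝ (n1 i)).smul (cT0 i)).add (((cT0 i).norm ℝ (n0 i)).smul (cT1 i))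
  have wne : ∀ i t, w i t ≠ 0 := by
    intro i t hx
    have a0 : 0 < ‖T0 i t‖ := norm_pos_iff.2 (n0 i t)
    have a1 : 0 < ‖T1 i t‖ := norm_pos_iff.2 (n1 i t)
    -- With this weight the convex combination of the two tangents is a positive multiple of `w`;
    -- thus `w = 0` would contradict immersedness of an intermediate curve.
    refine imm (‖T0 i t‖ / (‖T0 i t‖ + ‖T1 i t‖)) ⟨by positivity, ?_⟩ i t ?_
    · rw [div_le_one (by positivity)]; linarith
    · change T0 i t + (‖T0 i t‖ / (‖T0 i t‖ + ‖T1 i t‖)) • (T1 i t - T0 i t) = 0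
      have hs : (‖T0 i t‖ + ‖T1 i t‖) •
          (T0 i t + (‖T0 i t‖ / (‖T0 i t‖ + ‖T1 i t‖)) • (T1 i t - T0 i t)) = 0 := by
        calc _ = w i t := by
              rw [smul_add, smul_smul, mul_div_cancel₀ _ (by positivity), hw]; module
          _ = 0 := hx
      exact (smul_eq_zero.1 hs).resolve_left (by positivity)
  have wT0 : ∀ i t, 0 < inner ℝ (w i t) (T0 i t) := fun i t =>
    (inner_bisector_pos (n0 i t) (n1 i t) (wne i t)).1
  have wT1 : ∀ i t, 0 < inner ℝ (w i t) (T1 i t) := fun i t =>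
    (inner_bisector_pos (n0 i t) (n1 i t) (wne i t)).2
  -- With `φ(x) = ⟨w, x⟩ / ⟨w, T0⟩`, the linear map `x ↦ x + s φ(x) (T1 - T0)` sends `T0` to the
  -- tangent at time `s`. It multiplies the pairing with `w` by a positive factor, because `w` pairs
  -- positively with `T0` and `T1`, so it is injective. The frame at time `s` is the image of the
  -- old frame under this map.
  set φ : ι → ℝ → ℝ := fun i t => inner ℝ (w i t) (L.frame i t) / inner ℝ (w i t) (T0 i t) with hφ
  have cφ : ∀ i, ContDiff ℝ ∞ (φ i) := fun i =>
    ((cw i).inner ℝ (L.contDiff_frame i)).div ((cw i).inner ℝ (cT0 i)) (fun t => (wT0 i t).ne')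
  have hd : ∀ (s : ℝ) i t, HasDerivAt (fun t : ℝ => L.curve i t + s • (C i t - L.curve i t))
      (T0 i t + s • (T1 i t - T0 i t)) t := by
    intro s i t
    have d0 : HasDerivAt (L.curve i) (T0 i t) t :=
      ((L.contDiff_curve i).differentiable (by simp) t).hasDerivAt
    have d1 : HasDerivAt (C i) (T1 i t) t := ((hC i).differentiable (by simp) t).hasDerivAt
    exact d0.add ((d1.sub d0).const_smul s)
  obtain ⟨M, hM1, -, hM3⟩ := L.exists_isotopic_of_family
    (fun i s t => L.curve i t + s • (C i t - L.curve i t))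
    (fun i s t => L.frame i t + (s * φ i t) • (T1 i t - T0 i t))
    (fun i => (contDiff_combo (L.contDiff_curve i) (hC i)).contDiffOn)
    (fun i => by
      have h1 : ContDiff ℝ ∞ (fun p : ℝ × ℝ => L.frame i p.2) :=
        (L.contDiff_frame i).comp contDiff_snd
      have h2 : ContDiff ℝ ∞ (fun p : ℝ × ℝ => φ i p.2) := (cφ i).comp contDiff_snd
      have h3 : ContDiff ℝ ∞ (fun p : ℝ × ℝ => T1 i p.2 - T0 i p.2) :=
        ((cT1 i).sub (cT0 i)).comp contDiff_snd
      exact (h1.add ((contDiff_fst.mul h2).smul h3)).contDiffOn)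
    (fun i s _ t => by simp only [L.periodic_curve i t, pC i t])
    (fun i s _ t => by
      simp only [hφ, hw, L.periodic_frame i t, pT0 i t, pT1 i t])
    emb
    (fun s hs i t => by
      rw [(hd s i t).deriv, LinearIndependent.pair_iff]
      intro a b hab
      have hpos : 0 < (1 - s) * inner ℝ (w i t) (T0 i t) + s * inner ℝ (w i t) (T1 i t) := by
        rcases hs.1.eq_or_lt with h | h
        · rw [← h]; simpa using wT0 i t
        · have := mul_pos h (wT1 i t)
          have := mul_nonneg (sub_nonneg.2 hs.2) (wT0 i t).le
          linarith
      set x : Space := a • T0 i t + b • L.frame i t with hx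
      set f : ℝ := inner ℝ (w i t) x / inner ℝ (w i t) (T0 i t) with hf
      have hfx : f = a + b * φ i t := by
        rw [hf, hx, inner_add_right, real_inner_smul_right, real_inner_smul_right, hφ]
        field_simp [(wT0 i t).ne']
      have e1 : x + (s * f) • (T1 i t - T0 i t) = 0 := by
        rw [← hab, hfx, hx]
        module
      have e2 : f * ((1 - s) * inner ℝ (w i t) (T0 i t) + s * inner ℝ (w i t) (T1 i t)) = 0 := by
        have h3 := congrArg (fun y => inner ℝ (w i t) y) e1
        simp only [inner_add_right, real_inner_smul_right, inner_sub_right, inner_zero_right] at h3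
        have h4 : inner ℝ (w i t) x = f * inner ℝ (w i t) (T0 i t) := by
          rw [hf, div_mul_cancel₀ _ (wT0 i t).ne']
        linear_combination h3 - h4
      have hf0 : f = 0 := (mul_eq_zero.1 e2).resolve_right hpos.ne'
      rw [hf0] at e1
      have hx0 : x = 0 := by simpa using e1
      exact (LinearIndependent.pair_iff.1 (L.nowhere_tangent i t)) a b hx0)
    (fun i => by simp) (fun i => by simp)
  refine ⟨M, fun i => ?_, hM3⟩
  rw [hM1]
  simp

/-- Orientation preserving changes of the parametrization are isotopies. -/
theorem FramedLink.exists_isotopic_reparam (L : FramedLink ι) (ρ : ι → ℝ → ℝ)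
    (hρ : ∀ i, ContDiff ℝ ∞ (ρ i)) (pρ : ∀ i t, ρ i (t + 1) = ρ i t + 1)
    (dρ : ∀ i t, 0 < deriv (ρ i) t) :
    ∃ M : FramedLink ι, (∀ i, M.curve i = fun t => L.curve i (ρ i t)) ∧
      (∀ i, M.frame i = fun t => L.frame i (ρ i t)) ∧ L.Isotopic M := by
  -- Increasing maps that commute with the unit translation form a convex set, so the straight line
  -- to the identity stays among them.
  set R : ι → ℝ → ℝ → ℝ := fun i s t => t + s * (ρ i t - t) with hR
  have cR : ∀ i, ContDiff ℝ ∞ (fun p : ℝ × ℝ => R i p.1 p.2) := fun i =>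
    contDiff_combo (f := fun t => t) contDiff_id (hρ i)
  have dR : ∀ i s t, HasDerivAt (R i s) (1 + s * (deriv (ρ i) t - 1)) t := fun i s t =>
    (hasDerivAt_id t).add ((((hρ i).differentiable (by simp) t).hasDerivAt.sub
      (hasDerivAt_id t)).const_mul s)
  have posR : ∀ i, ∀ s ∈ Icc (0 : ℝ) 1, ∀ t, 0 < 1 + s * (deriv (ρ i) t - 1) := by
    intro i s hs t
    rcases hs.1.eq_or_lt with h | h
    · rw [← h]; simp
    · have := mul_pos h (dρ i t)
      have := hs.2
      linarith
  have addR : ∀ i s t, R i s (t + 1) = R i s t + 1 := fun i s t => by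
    simp only [hR, pρ]; ring
  have addRint : ∀ i s t (k : ℤ), R i s (t + k) = R i s t + k := by
    intro i s t k
    have hp : Function.Periodic (fun t => R i s t - t) 1 := fun t => by
      simp only [addR]; ring
    have := hp.int_mul k t
    simp only [mul_one] at this
    linarith
  have monoR : ∀ i, ∀ s ∈ Icc (0 : ℝ) 1, StrictMono (R i s) := fun i s hs =>
    strictMono_of_deriv_pos fun t => by rw [(dR i s t).deriv]; exact posR i s hs t
  obtain ⟨M, h1, h2, h3⟩ := L.exists_isotopic_of_family
    (fun i s t => L.curve i (R i s t)) (fun i s t => L.frame i (R i s t))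
    (fun i => ((L.contDiff_curve i).comp (cR i)).contDiffOn)
    (fun i => ((L.contDiff_frame i).comp (cR i)).contDiffOn)
    (fun i s _ t => by simp only [addR, L.periodic_curve i _])
    (fun i s _ t => by simp only [addR, L.periodic_frame i _])
    (fun s hs i j t u h => by
      obtain ⟨rfl, k, hk⟩ := L.embedded _ _ _ _ h
      rw [← addRint] at hk
      exact ⟨rfl, k, (monoR i s hs).injective hk⟩)
    (fun s hs i t => by
      have hd : HasDerivAt (fun t => L.curve i (R i s t))
          ((1 + s * (deriv (ρ i) t - 1)) • deriv (L.curve i) (R i s t)) t :=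
        HasDerivAt.scomp t (((L.contDiff_curve i).differentiable (by simp) _).hasDerivAt) (dR i s t)
      rw [hd.deriv, LinearIndependent.pair_iff]
      intro a b hab
      have := (LinearIndependent.pair_iff.1 (L.nowhere_tangent i (R i s t)))
        (a * (1 + s * (deriv (ρ i) t - 1))) b (by rw [← hab, smul_smul])
      exact ⟨(mul_eq_zero.1 this.1).resolve_right (posR i s hs t).ne', this.2⟩)
    (fun i => by simp [hR]) (fun i => by simp [hR])
  refine ⟨M, fun i => ?_, fun i => ?_, h3⟩
  · rw [h1]; simp [hR]
  · rw [h2]; simp [hR]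

end Family

/-! ### Mollification of curves -/

section Averages

open MeasureTheory

/-- A smooth bump function of integral one that is supported in `[-1, 1]`. -/
noncomputable def kernelBump : ContDiffBump (0 : ℝ) := ⟨1 / 2, 1, by norm_num, by norm_num⟩

noncomputable def molKernel : ℝ → ℝ := kernelBump.normed volume

theorem molKernel_nonneg (a : ℝ) : 0 ≤ molKernel a := kernelBump.nonneg_normed a

theorem continuous_molKernel : Continuous molKernel := kernelBump.continuous_normed

theorem contDiff_molKernel : ContDiff ℝ ∞ molKernel := kernelBump.contDiff_normed

theorem hasCompactSupport_molKernel : HasCompactSupport molKernel :=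
  kernelBump.hasCompactSupport_normed

theorem integral_molKernel : ∫ a, molKernel a = 1 := kernelBump.integral_normed

theorem molKernel_eq_zero {a : ℝ} (h : 1 < |a|) : molKernel a = 0 := by
  by_contra hne
  have : a ∈ Function.support molKernel := hne
  rw [molKernel, kernelBump.support_normed_eq] at this
  have h1 : |a| < 1 := by simpa [kernelBump] using this
  linarith

/-- The average of a function with respect to `molKernel`. -/
noncomputable def avg (g : ℝ → Space) : Space := ∫ a, molKernel a • g a

variable {g h : ℝ → Space}

theorem integrable_avg {E : Type*} [NormedAddCommGroup E] [NormedSpace ℝ E] {g : ℝ → E}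
    (hg : Continuous g) : Integrable (fun a => molKernel a • g a) :=
  (continuous_molKernel.smul hg).integrable_of_hasCompactSupport
    hasCompactSupport_molKernel.smul_right

theorem avg_sub (hg : Continuous g) (hh : Continuous h) :
    avg (fun a => g a - h a) = avg g - avg h := by
  simp only [avg, smul_sub]
  exact integral_sub (integrable_avg hg) (integrable_avg hh)

theorem avg_add (hg : Continuous g) (hh : Continuous h) :
    avg (fun a => g a + h a) = avg g + avg h := by
  simp only [avg, smul_add]
  exact integral_add (integrable_avg hg) (integrable_avg hh)

theorem avg_smul (c : ℝ) (g : ℝ → Space) : avg (fun a => c • g a) = c • avg g := by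
  simp only [avg, smul_comm _ c]
  exact integral_smul c _

theorem avg_const (x : Space) : avg (fun _ => x) = x := by
  simp only [avg]
  rw [integral_smul_const, integral_molKernel, one_smul]

/-- The kernel is a probability density supported in `[-1, 1]`, so an average stays in every closed
half space that contains the averaged values. This is how linear monotonicity survives
mollification. -/
theorem le_apply_avg (l : Space →L[ℝ] ℝ) (hg : Continuous g) {c : ℝ}
    (hc : ∀ a, |a| ≤ 1 → c ≤ l (g a)) : c ≤ l (avg g) := by
  rw [avg, ← l.integral_comp_comm (integrable_avg hg)]
  have hl : Continuous fun a => l (g a) := l.continuous.comp hg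
  calc c = ∫ a, molKernel a • c := by rw [integral_smul_const, integral_molKernel, one_smul]
    _ ≤ ∫ a, molKernel a • l (g a) := by
      refine integral_mono (integrable_avg continuous_const) (integrable_avg hl) fun a => ?_
      rcases le_or_gt |a| 1 with h1 | h1
      · exact mul_le_mul_of_nonneg_left (hc a h1) (molKernel_nonneg a)
      · simp [molKernel_eq_zero h1]
    _ = ∫ a, l (molKernel a • g a) := by simp

theorem norm_avg_le (hg : Continuous g) {r : ℝ} (hr : ∀ a, |a| ≤ 1 → ‖g a‖ ≤ r) :
    ‖avg g‖ ≤ r := by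
  have hl : Continuous fun a => ‖g a‖ := hg.norm
  calc ‖avg g‖ ≤ ∫ a, ‖molKernel a • g a‖ := norm_integral_le_integral_norm _
    _ = ∫ a, molKernel a • ‖g a‖ := by
      simp [norm_smul, abs_of_nonneg (molKernel_nonneg _)]
    _ ≤ ∫ a, molKernel a • r := by
      refine integral_mono (integrable_avg hl) (integrable_avg continuous_const) fun a => ?_
      rcases le_or_gt |a| 1 with h1 | h1
      · exact mul_le_mul_of_nonneg_left (hr a h1) (molKernel_nonneg a)
      · simp [molKernel_eq_zero h1]
    _ = r := by rw [integral_smul_const, integral_molKernel, one_smul]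

/-- Mollification of a curve at scale `ε`. -/
noncomputable def mol (ε : ℝ) (f : ℝ → Space) (t : ℝ) : Space := avg fun a => f (t - ε * a)

theorem mol_periodic {f : ℝ → Space} (hf : Function.Periodic f 1) (ε : ℝ) :
    Function.Periodic (mol ε f) 1 := fun t => by
  simp only [mol]
  congr 1
  funext a
  rw [show t + 1 - ε * a = t - ε * a + 1 by ring, hf]

theorem mol_line {f g : ℝ → Space} (hf : Continuous f) (hg : Continuous g) (ε s t : ℝ) :
    mol ε (fun u => f u + s • (g u - f u)) t = mol ε f t + s • (mol ε g t - mol ε f t) := by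
  have hf' : Continuous fun a => f (t - ε * a) := by fun_prop
  have hg' : Continuous fun a => g (t - ε * a) := by fun_prop
  simp only [mol]
  rw [← avg_sub hg' hf', ← avg_smul, ← avg_add hf' (by fun_prop)]

/-- The substitution `x = ε a` turns the average into a convolution with a smooth compactly
supported kernel. -/
theorem contDiff_mol {f : ℝ → Space} (hf : Continuous f) {ε : ℝ} (hε : 0 < ε) :
    ContDiff ℝ ∞ (mol ε f) := by
  have hk : HasCompactSupport fun x : ℝ => molKernel (ε⁻¹ * x) :=
    hasCompactSupport_molKernel.comp_homeomorph (Homeomorph.mulLeft₀ ε⁻¹ (inv_ne_zero hε.ne'))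
  have hs : ContDiff ℝ ∞ fun x : ℝ => molKernel (ε⁻¹ * x) :=
    contDiff_molKernel.comp (by fun_prop)
  have hconv := hk.contDiff_convolution_left (ContinuousLinearMap.lsmul ℝ ℝ) hs
    (hf.locallyIntegrable (μ := volume))
  have : mol ε f = fun t => ε⁻¹ • (convolution (fun x : ℝ => molKernel (ε⁻¹ * x)) f
      (ContinuousLinearMap.lsmul ℝ ℝ) volume t) := by
    funext t
    simp only [mol, avg, convolution, ContinuousLinearMap.lsmul_apply]
    have := Measure.integral_comp_mul_left (fun x => molKernel (ε⁻¹ * x) • f (t - x)) ε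
    simp only [inv_mul_cancel_left₀ hε.ne'] at this
    rw [this, abs_of_pos (inv_pos.2 hε)]
  rw [this]
  exact hconv.const_smul _

/-- The scale has no sign restriction: `mol` is also meaningful at `ε = 0`, where it returns the
curve. Such estimates hold on a full neighbourhood of `ε = 0`, as the compactness arguments below
require. -/
theorem norm_mol_sub_le {f : ℝ → Space} (hf : Continuous f) {ε t r : ℝ} {x : Space}
    (h : ∀ a, |a| ≤ 1 → ‖f (t - ε * a) - x‖ ≤ r) : ‖mol ε f t - x‖ ≤ r := by
  have hf' : Continuous fun a => f (t - ε * a) := by fun_prop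
  rw [mol, ← avg_const x, ← avg_sub hf' continuous_const]
  exact norm_avg_le (hf'.sub continuous_const) h

theorem le_apply_mol_sub (l : Space →L[ℝ] ℝ) {f : ℝ → Space} (hf : Continuous f) {ε u v c : ℝ}
    (h : ∀ a, |a| ≤ 1 → c ≤ l (f (v - ε * a)) - l (f (u - ε * a))) :
    c ≤ l (mol ε f v) - l (mol ε f u) := by
  have h1 : Continuous fun a => f (v - ε * a) := by fun_prop
  have h2 : Continuous fun a => f (u - ε * a) := by fun_prop
  rw [← map_sub, mol, mol, ← avg_sub h1 h2]
  exact le_apply_avg l (h1.sub h2) fun a ha => (h a ha).trans_eq (map_sub l _ _).symm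

end Averages

/-! ### Piecewise affine curves -/

section PiecewiseAffine

/-- On the `δ`-neighbourhood of `t` the curve `f` is affine on both sides of `t`, with slopes
`vl` and `vr`. -/
def AffineNear (f : ℝ → Space) (t δ : ℝ) (vl vr : Space) : Prop :=
  ∀ u, |u - t| < δ →
    (t ≤ u → f u = f t + (u - t) • vr) ∧ (u ≤ t → f u = f t + (u - t) • vl)

/-- Piecewise affine curves. -/
def PiecewiseAffine (f : ℝ → Space) : Prop :=
  ∀ t, ∃ δ > 0, ∃ vl vr, AffineNear f t δ vl vr

theorem AffineNear.mono {f : ℝ → Space} {t δ δ' : ℝ} {vl vr : Space}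
    (h : AffineNear f t δ vl vr) (hδ : δ' ≤ δ) : AffineNear f t δ' vl vr :=
  fun u hu => h u (hu.trans_le hδ)

theorem AffineNear.line {f g : ℝ → Space} {t δ : ℝ} {vl vr wl wr : Space}
    (hf : AffineNear f t δ vl vr) (hg : AffineNear g t δ wl wr) (s : ℝ) :
    AffineNear (fun u => f u + s • (g u - f u)) t δ (vl + s • (wl - vl)) (vr + s • (wr - vr)) := by
  intro u hu
  refine ⟨fun h => ?_, fun h => ?_⟩
  · simp only [(hf u hu).1 h, (hg u hu).1 h]; module
  · simp only [(hf u hu).2 h, (hg u hu).2 h]; module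

theorem AffineNear.mono_apply {f : ℝ → Space} {t δ : ℝ} {vl vr : Space}
    (h : AffineNear f t δ vl vr) (l : Space →L[ℝ] ℝ) {κ : ℝ} (hl : κ ≤ l vl) (hr : κ ≤ l vr)
    {u v : ℝ} (hu : |u - t| < δ) (hv : |v - t| < δ) (huv : u ≤ v) :
    κ * (v - u) ≤ l (f v) - l (f u) := by
  rcases le_total t u with h1 | h1
  · rw [(h u hu).1 h1, (h v hv).1 (h1.trans huv)]
    simp only [map_add, map_smul, smul_eq_mul]
    nlinarith [mul_le_mul_of_nonneg_right hr (sub_nonneg.2 huv)]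
  rcases le_total t v with h2 | h2
  · rw [(h u hu).2 h1, (h v hv).1 h2]
    simp only [map_add, map_smul, smul_eq_mul]
    nlinarith [mul_le_mul_of_nonneg_right hr (sub_nonneg.2 h2),
      mul_le_mul_of_nonneg_right hl (sub_nonneg.2 h1)]
  · rw [(h u hu).2 h1, (h v hv).2 h2]
    simp only [map_add, map_smul, smul_eq_mul]
    nlinarith [mul_le_mul_of_nonneg_right hl (sub_nonneg.2 huv)]

theorem PiecewiseAffine.continuous {f : ℝ → Space} (hf : PiecewiseAffine f) : Continuous f := by
  refine continuous_iff_continuousAt.2 fun t => ?_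
  obtain ⟨δ, hδ, vl, vr, h⟩ := hf t
  have hb : Tendsto (fun u => |u - t| * (‖vl‖ + ‖vr‖)) (𝓝 t) (𝓝 0) := by
    have : Continuous fun u : ℝ => |u - t| * (‖vl‖ + ‖vr‖) := by fun_prop
    simpa using this.tendsto t
  rw [ContinuousAt, tendsto_iff_norm_sub_tendsto_zero]
  refine squeeze_zero' (Eventually.of_forall fun _ => norm_nonneg _) ?_ hb
  filter_upwards [Metric.ball_mem_nhds t hδ] with u hu
  rw [Metric.mem_ball, Real.dist_eq] at hu
  rcases le_total t u with h1 | h1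
  · rw [(h u hu).1 h1, add_sub_cancel_left, norm_smul, Real.norm_eq_abs]
    exact mul_le_mul_of_nonneg_left (by linarith [norm_nonneg vl]) (abs_nonneg _)
  · rw [(h u hu).2 h1, add_sub_cancel_left, norm_smul, Real.norm_eq_abs]
    exact mul_le_mul_of_nonneg_left (by linarith [norm_nonneg vr]) (abs_nonneg _)

/-- An injective piecewise affine curve does not turn back. -/
theorem AffineNear.exists_direction {f : ℝ → Space} {t δ : ℝ} {vl vr : Space}
    (h : AffineNear f t δ vl vr) (hδ : 0 < δ)
    (inj : ∀ u v, |u - t| < δ → |v - t| < δ → f u = f v → u = v) :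
    ∃ w : Space, 0 < inner ℝ w vl ∧ 0 < inner ℝ w vr := by
  have h2 : |δ / 2| < δ := by rw [abs_of_pos (by positivity)]; linarith
  have hl : vl ≠ 0 := by
    rintro rfl
    have := inj (t - δ / 2) t (by simpa using h2) (by simpa using hδ) (by
      rw [(h (t - δ / 2) (by simpa using h2)).2 (by linarith)]; simp)
    linarith
  have hr : vr ≠ 0 := by
    rintro rfl
    have := inj (t + δ / 2) t (by simpa using h2) (by simpa using hδ) (by
      rw [(h (t + δ / 2) (by simpa using h2)).1 (by linarith)]; simp)
    linarith
  have hl' := norm_pos_iff.2 hl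
  have hr' := norm_pos_iff.2 hr
  refine ⟨_, inner_bisector_pos hl hr fun h0 => ?_⟩
  -- If the slopes pointed in opposite directions, going `x ‖vl‖` to the right and `x ‖vr‖` to the
  -- left of `t` would lead to the same point; this `x` keeps both within `δ`.
  set x : ℝ := δ / (2 * (‖vl‖ + ‖vr‖)) with hx
  have hxp : 0 < x := by positivity
  have hxs : x * (‖vl‖ + ‖vr‖) = δ / 2 := by rw [hx]; field_simp
  have b1 : |t + x * ‖vl‖ - t| < δ := by
    rw [add_sub_cancel_left, abs_of_pos (by positivity)]; nlinarith
  have b2 : |t - x * ‖vr‖ - t| < δ := by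
    rw [sub_sub_cancel_left, abs_neg, abs_of_pos (by positivity)]; nlinarith
  have := inj _ _ b1 b2 (by
    rw [(h _ b1).1 (by nlinarith), (h _ b2).2 (by nlinarith)]
    have : vl = (‖vr‖)⁻¹ • (-(‖vl‖ • vr)) := by
      rw [← eq_neg_of_add_eq_zero_left h0, smul_smul, inv_mul_cancel₀ hr'.ne', one_smul]
    have e : (‖vr‖) • vl = -(‖vl‖ • vr) := eq_neg_of_add_eq_zero_left h0
    have e2 : (t - x * ‖vr‖ - t) • vl = (-x) • ((‖vr‖) • vl) := by rw [smul_smul]; congr 1; ring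
    rw [e2, e]; module)
  nlinarith

theorem SimpleLoops.eq_of_near {ι : Type*} {γ : ι → ℝ → Space} (h : SimpleLoops γ) {i : ι}
    {u v : ℝ} (huv : |u - v| < 1) (e : γ i u = γ i v) : u = v := by
  obtain ⟨-, k, hk⟩ := h _ _ _ _ e
  have : |(k : ℝ)| < 1 := by rw [hk] at huv; simpa using huv
  have hk0 : k = 0 := by
    have h1 := abs_lt.1 this
    have h2 : (-1 : ℤ) < k := by exact_mod_cast h1.1
    have h3 : k < 1 := by exact_mod_cast h1.2
    omega
  simp [hk, hk0]

end PiecewiseAffine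

/-! ### Straight line homotopies of simple polygons survive mollification -/

section Line

variable {ι : Type*} {γ₀ γ₁ : ι → ℝ → Space}

/-- Along a straight line homotopy of simple piecewise affine curves, every point has a
neighbourhood in which a fixed linear functional increases along all mollified curves. -/
theorem exists_increasing_functional (a₀ : ∀ i, PiecewiseAffine (γ₀ i))
    (a₁ : ∀ i, PiecewiseAffine (γ₁ i)) {s₀ : ℝ}
    (hs : SimpleLoops fun i t => γ₀ i t + s₀ • (γ₁ i t - γ₀ i t)) (i : ι) (t₀ : ℝ) :
    ∃ l : Space →L[ℝ] ℝ, ∃ κ > 0, ∃ δ > 0, ∀ s ε u v, |s - s₀| < δ → |ε| < δ → |u - t₀| < δ →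
      |v - t₀| < δ → u ≤ v →
      κ * (v - u) ≤ l (mol ε (fun t => γ₀ i t + s • (γ₁ i t - γ₀ i t)) v) -
        l (mol ε (fun t => γ₀ i t + s • (γ₁ i t - γ₀ i t)) u) := by
  obtain ⟨δ₀, hδ₀, vl, vr, h₀⟩ := a₀ i t₀
  obtain ⟨δ₁, hδ₁, wl, wr, h₁⟩ := a₁ i t₀
  -- The bound `1 / 2` makes parameters in the window differ by less than one period, where
  -- `SimpleLoops` amounts to injectivity.
  set δ := min (min δ₀ δ₁) (1 / 2) with hδ
  have hδp : 0 < δ := by positivity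
  have H := fun s : ℝ => (h₀.mono (δ' := δ) ((min_le_left _ _).trans (min_le_left _ _))).line
    (h₁.mono (δ' := δ) ((min_le_left _ _).trans (min_le_right _ _))) s
  obtain ⟨w, hwl, hwr⟩ := (H s₀).exists_direction hδp fun u v hu hv huv =>
    hs.eq_of_near (i := i) (by
      have : δ ≤ 1 / 2 := min_le_right _ _
      rw [abs_lt] at *; constructor <;> linarith) huv
  set cl := inner ℝ w (vl + s₀ • (wl - vl))
  set cr := inner ℝ w (vr + s₀ • (wr - vr))
  set κ := min cl cr / 2 with hκ
  have hκp : 0 < κ := by have : 0 < min cl cr := lt_min hwl hwr; positivity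
  have ev : ∀ᶠ s in 𝓝 s₀, κ < inner ℝ w (vl + s • (wl - vl)) ∧ κ < inner ℝ w (vr + s • (wr - vr)) := by
    have c1 : Continuous fun s : ℝ => (inner ℝ w (vl + s • (wl - vl)) : ℝ) := by fun_prop
    have c2 : Continuous fun s : ℝ => (inner ℝ w (vr + s • (wr - vr)) : ℝ) := by fun_prop
    have l1 : κ < cl := by
      have := min_le_left cl cr
      have : 0 < min cl cr := lt_min hwl hwr
      rw [hκ]; linarith
    have l2 : κ < cr := by
      have := min_le_right cl cr
      have : 0 < min cl cr := lt_min hwl hwr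
      rw [hκ]; linarith
    exact (c1.continuousAt.eventually (lt_mem_nhds l1)).and
      (c2.continuousAt.eventually (lt_mem_nhds l2))
  obtain ⟨η, hη, hev⟩ := Metric.eventually_nhds_iff.1 ev
  refine ⟨innerSL ℝ w, κ, hκp, min (δ / 2) η, by positivity, ?_⟩
  intro s ε u v h1 h2 h3 h4 huv
  have hs' := hev (y := s) (by rw [Real.dist_eq]; exact h1.trans_le (min_le_right _ _))
  have c₀ := (a₀ i).continuous
  have c₁ := (a₁ i).continuous
  refine le_apply_mol_sub _ (by fun_prop) fun a ha => ?_
  have hεa : |ε * a| < δ / 2 := by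
    rw [abs_mul]
    calc |ε| * |a| ≤ |ε| * 1 := mul_le_mul_of_nonneg_left ha (abs_nonneg _)
      _ < δ / 2 := by rw [mul_one]; exact h2.trans_le (min_le_left _ _)
  have h3' := h3.trans_le (min_le_left (δ / 2) η)
  have h4' := h4.trans_le (min_le_left (δ / 2) η)
  have := (H s).mono_apply (innerSL ℝ w) (κ := κ) (by simpa using hs'.1.le)
    (by simpa using hs'.2.le) (u := u - ε * a) (v := v - ε * a)
    (by rw [abs_lt] at *; constructor <;> linarith)
    (by rw [abs_lt] at *; constructor <;> linarith) (by linarith)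
  simpa using this

theorem le_apply_deriv {C : ℝ → Space} {C' : Space} {t κ ρ : ℝ} (l : Space →L[ℝ] ℝ) (hρ : 0 < ρ)
    (hC : HasDerivAt C C' t) (h : ∀ u, t < u → u < t + ρ → κ * (u - t) ≤ l (C u) - l (C t)) :
    κ ≤ l C' := by
  have hd : HasDerivAt (fun u => l (C u)) (l C') t := l.hasFDerivAt.comp_hasDerivAt t hC
  have ht := (hasDerivAt_iff_tendsto_slope.1 hd).mono_left
    (nhdsWithin_mono t (fun u (hu : t < u) => hu.ne') : 𝓝[>] t ≤ 𝓝[≠] t)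
  refine ge_of_tendsto ht ?_
  filter_upwards [Ioo_mem_nhdsGT (show t < t + ρ by linarith)] with u hu
  rw [slope_def_field, le_div_iff₀ (by linarith [hu.1])]
  exact h u hu.1 hu.2

/-- The mollifications of the two ends of a straight line homotopy of simple piecewise affine
curves are connected by a straight line homotopy of simple immersed smooth curves. -/
theorem eventually_simple_mol_line [Finite ι] (p₀ : ∀ i, Function.Periodic (γ₀ i) 1)
    (p₁ : ∀ i, Function.Periodic (γ₁ i) 1) (a₀ : ∀ i, PiecewiseAffine (γ₀ i))
    (a₁ : ∀ i, PiecewiseAffine (γ₁ i))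
    (hs : ∀ s ∈ Icc (0 : ℝ) 1, SimpleLoops fun i t => γ₀ i t + s • (γ₁ i t - γ₀ i t)) :
    ∀ᶠ ε in 𝓝[>] (0 : ℝ), ∀ s ∈ Icc (0 : ℝ) 1,
      SimpleLoops (fun i t => mol ε (γ₀ i) t + s • (mol ε (γ₁ i) t - mol ε (γ₀ i) t)) ∧
      ∀ i t, deriv (mol ε (γ₀ i)) t + s • (deriv (mol ε (γ₁ i)) t - deriv (mol ε (γ₀ i)) t) ≠ 0 := by
  have c₀ := fun i => (a₀ i).continuous
  have c₁ := fun i => (a₁ i).continuous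
  set Γ : ι → ℝ → ℝ → Space := fun i s t => γ₀ i t + s • (γ₁ i t - γ₀ i t) with hΓ
  have cΓ : ∀ i, Continuous fun p : ℝ × ℝ => Γ i p.1 p.2 := fun i => by
    simp only [hΓ]; fun_prop
  have cΓ' : ∀ i s, Continuous (Γ i s) := fun i s => by
    simp only [hΓ]; fun_prop
  have pΓ : ∀ i s, Function.Periodic (Γ i s) 1 := fun i s t => by
    simp only [hΓ, p₀ i t, p₁ i t]
  have mΓ : ∀ ε i s t, mol ε (γ₀ i) t + s • (mol ε (γ₁ i) t - mol ε (γ₀ i) t) = mol ε (Γ i s) t :=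
    fun ε i s t => (mol_line (c₀ i) (c₁ i) ε s t).symm
  have near : ∀ i s₀ t₀ r, 0 < r → ∃ δ > 0, ∀ ε s t, |ε| < δ → |s - s₀| < δ → |t - t₀| < δ →
      ‖mol ε (Γ i s) t - Γ i s₀ t₀‖ ≤ r := by
    intro i s₀ t₀ r hr
    obtain ⟨δ, hδ, h⟩ := Metric.continuousAt_iff.1 ((cΓ i).continuousAt (x := (s₀, t₀))) r hr
    refine ⟨δ / 2, by positivity, fun ε s t h1 h2 h3 => ?_⟩
    refine norm_mol_sub_le (cΓ' i s) fun a ha => ?_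
    have hεa : |ε * a| < δ / 2 := by
      rw [abs_mul]
      calc |ε| * |a| ≤ |ε| * 1 := mul_le_mul_of_nonneg_left ha (abs_nonneg _)
        _ < δ / 2 := by rwa [mul_one]
    rw [← dist_eq_norm]
    refine (h (x := (s, t - ε * a)) ?_).le
    rw [Prod.dist_eq, max_lt_iff, Real.dist_eq, Real.dist_eq]
    constructor
    · simp only; linarith
    · simp only; rw [abs_lt] at *; constructor <;> linarith
  have E1 : ∀ i j, ∀ᶠ ε in 𝓝 (0 : ℝ), ∀ y ∈ (Icc (0 : ℝ) 1 ×ˢ Icc (0 : ℝ) 1 ×ˢ Icc (0 : ℝ) 1),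
      mol ε (Γ i y.1) y.2.1 = mol ε (Γ j y.1) y.2.2 → i = j ∧ ∃ k : ℤ, y.2.2 = y.2.1 + k := by
    intro i j
    refine IsCompact.eventually_forall_of_forall_eventually
      (isCompact_Icc.prod (isCompact_Icc.prod isCompact_Icc)) ?_
    rintro ⟨s₀, t₀, u₀⟩ ⟨hs₀, -, -⟩
    -- If the images agree, `u₀` is `t₀` shifted by `k` periods, and the functional increasing near
    -- `t₀` forces `t = u - k` whenever mollified points coincide. If they differ, the mollified
    -- points stay apart by continuity.
    by_cases hne : Γ i s₀ t₀ = Γ j s₀ u₀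
    · obtain ⟨rfl, k, rfl⟩ := hs s₀ hs₀ _ _ _ _ hne
      obtain ⟨l, κ, hκ, δ, hδ, h⟩ := exists_increasing_functional a₀ a₁ (hs s₀ hs₀) i t₀
      refine Metric.eventually_nhds_iff.2 ⟨δ, hδ, ?_⟩
      rintro ⟨ε, s, t, u⟩ hd he
      simp only [Prod.dist_eq, max_lt_iff, Real.dist_eq, sub_zero] at hd he
      obtain ⟨h1, h2, h3, h4⟩ := hd
      refine ⟨rfl, k, ?_⟩
      have he' : mol ε (Γ i s) (u - k) = mol ε (Γ i s) t := by
        rw [he]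
        simpa using ((mol_periodic (pΓ i s) ε).sub_int_mul_eq k (x := u))
      have h4' : |u - k - t₀| < δ := by rwa [show u - k - t₀ = u - (t₀ + k) by ring]
      rcases le_total t (u - k) with hle | hle
      · have := h s ε _ _ h2 h1 h3 h4' hle
        rw [show (fun t => γ₀ i t + s • (γ₁ i t - γ₀ i t)) = Γ i s from rfl, he', sub_self] at this
        have : u - k - t ≤ 0 := by
          by_contra hc; push Not at hc; nlinarith [mul_pos hκ hc]
        linarith
      · have := h s ε _ _ h2 h1 h4' h3 hle
        rw [show (fun t => γ₀ i t + s • (γ₁ i t - γ₀ i t)) = Γ i s from rfl, he', sub_self] at this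
        have : t - (u - k) ≤ 0 := by
          by_contra hc; push Not at hc; nlinarith [mul_pos hκ hc]
        linarith
    · have hr : 0 < ‖Γ i s₀ t₀ - Γ j s₀ u₀‖ / 3 := by
        have := norm_pos_iff.2 (sub_ne_zero.2 hne); positivity
      obtain ⟨δ₁, hδ₁, h₁⟩ := near i s₀ t₀ _ hr
      obtain ⟨δ₂, hδ₂, h₂⟩ := near j s₀ u₀ _ hr
      refine Metric.eventually_nhds_iff.2 ⟨min δ₁ δ₂, by positivity, ?_⟩
      rintro ⟨ε, s, t, u⟩ hd he
      have hd1 := hd.trans_le (min_le_left _ _)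
      have hd2 := hd.trans_le (min_le_right _ _)
      simp only [Prod.dist_eq, max_lt_iff, Real.dist_eq, sub_zero] at hd1 hd2 he
      exfalso
      have e1 := h₁ ε s t hd1.1 hd1.2.1 hd1.2.2.1
      have e2 := h₂ ε s u hd2.1 hd2.2.1 hd2.2.2.2
      rw [he] at e1
      have := norm_sub_le_norm_sub_add_norm_sub (Γ i s₀ t₀) (mol ε (Γ j s) u) (Γ j s₀ u₀)
      rw [norm_sub_rev] at e1
      linarith
  have E2 : ∀ i, ∀ᶠ ε in 𝓝 (0 : ℝ), ∀ y ∈ (Icc (0 : ℝ) 1 ×ˢ Icc (0 : ℝ) 1),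
      0 < ε → deriv (mol ε (Γ i y.1)) y.2 ≠ 0 := by
    intro i
    refine IsCompact.eventually_forall_of_forall_eventually (isCompact_Icc.prod isCompact_Icc) ?_
    rintro ⟨s₀, t₀⟩ ⟨hs₀, -⟩
    obtain ⟨l, κ, hκ, δ, hδ, h⟩ := exists_increasing_functional a₀ a₁ (hs s₀ hs₀) i t₀
    refine Metric.eventually_nhds_iff.2 ⟨δ / 2, by positivity, ?_⟩
    rintro ⟨ε, s, t⟩ hd hε h0
    simp only [Prod.dist_eq, max_lt_iff, Real.dist_eq, sub_zero] at hd hε h0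
    obtain ⟨h1, h2, h3⟩ := hd
    have hD := ((contDiff_mol (cΓ' i s) hε).differentiable (by simp) t).hasDerivAt
    have := le_apply_deriv l (ρ := δ / 2) (κ := κ) (by positivity) hD fun u hu1 hu2 => by
      refine h s ε t u (by linarith) (by linarith) (by linarith) ?_ hu1.le
      rw [abs_lt] at *; constructor <;> linarith
    rw [h0, map_zero] at this
    linarith
  have red : ∀ i s ε (t : ℝ), mol ε (Γ i s) t = mol ε (Γ i s) (Int.fract t) := by
    intro i s ε t
    have := (mol_periodic (pΓ i s) ε).sub_int_mul_eq ⌊t⌋ (x := t)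
    rw [Int.fract]
    simpa using this.symm
  have fr : ∀ t : ℝ, Int.fract t ∈ Icc (0 : ℝ) 1 := fun t =>
    ⟨Int.fract_nonneg t, (Int.fract_lt_one t).le⟩
  have E1' := eventually_nhdsWithin_of_eventually_nhds (s := Ioi 0)
    (eventually_all.2 fun i => eventually_all.2 (E1 i))
  have E2' := eventually_nhdsWithin_of_eventually_nhds (s := Ioi 0) (eventually_all.2 E2)
  filter_upwards [E1', E2', self_mem_nhdsWithin] with ε h1 h2 (hε : 0 < ε) s hs
  refine ⟨fun i j t u he => ?_, fun i t => ?_⟩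
  · simp only [mΓ] at he
    rw [red i, red j] at he
    obtain ⟨hij, k, hk⟩ := h1 i j (s, Int.fract t, Int.fract u) ⟨hs, fr t, fr u⟩ he
    refine ⟨hij, ⌊u⌋ - ⌊t⌋ + k, ?_⟩
    simp only [Int.fract] at hk
    push_cast
    linarith
  · have d0 := ((contDiff_mol (c₀ i) hε).differentiable (by simp) t).hasDerivAt
    have d1 := ((contDiff_mol (c₁ i) hε).differentiable (by simp) t).hasDerivAt
    have hd := d0.add ((d1.sub d0).const_smul s)
    have : mol ε (γ₀ i) + s • (mol ε (γ₁ i) - mol ε (γ₀ i)) = mol ε (Γ i s) :=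
      funext fun t => mΓ ε i s t
    rw [this] at hd
    rw [← hd.deriv]
    have per : deriv (mol ε (Γ i s)) t = deriv (mol ε (Γ i s)) (Int.fract t) := by
      have : (fun x => mol ε (Γ i s) (x - ⌊t⌋)) = mol ε (Γ i s) := funext fun x => by
        simpa using (mol_periodic (pΓ i s) ε).sub_int_mul_eq ⌊t⌋ (x := x)
      have h3 := deriv_comp_sub_const (f := mol ε (Γ i s)) (⌊t⌋ : ℝ) t
      rw [this] at h3
      exact h3
    rw [per]
    exact h2 i (s, Int.fract t) ⟨hs, fr t⟩ hε

end Line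

/-! ### Winding around the axis, and its stability under mollification -/

/-- The determinant of the horizontal parts of two vectors. It is positive for `(p, v)` if the
direction `v` at the point `p` winds positively around the third axis. -/
def xyDet (p q : Space) : ℝ := p 0 * q 1 - p 1 * q 0

/-- `xyDet p` as a linear functional. -/
noncomputable def xyDetL (p : Space) : Space →L[ℝ] ℝ :=
  p 0 • (EuclideanSpace.proj 1 : Space →L[ℝ] ℝ) - p 1 • (EuclideanSpace.proj 0 : Space →L[ℝ] ℝ)

@[simp] theorem xyDetL_apply (p q : Space) : xyDetL p q = xyDet p q := by simp [xyDetL, xyDet]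

theorem xyDet_add_smul (p v : Space) (c : ℝ) : xyDet (p + c • v) v = xyDet p v := by
  simp [xyDet]; ring

theorem continuous_xyDet {X : Type*} [TopologicalSpace X] {f g : X → Space} (hf : Continuous f)
    (hg : Continuous g) : Continuous fun x => xyDet (f x) (g x) := by
  unfold xyDet
  fun_prop

/-- To the right of `t` the curve `f` is affine and winds positively around the third axis. -/
def PosRight (f : ℝ → Space) (t : ℝ) : Prop :=
  ∃ δ > 0, ∃ v, (∀ u, t ≤ u → u < t + δ → f u = f t + (u - t) • v) ∧ 0 < xyDet (f t) v

/-- The one-sided condition at all parameters controls both slopes: the left slope at `t` is the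
right slope at `t - δ / 2`, and moving a point along `v` does not change `xyDet` against `v`. -/
theorem AffineNear.xyDet_pos {f : ℝ → Space} {t δ : ℝ} {vl vr : Space}
    (h : AffineNear f t δ vl vr) (hδ : 0 < δ) (hf : ∀ t, PosRight f t) :
    0 < xyDet (f t) vl ∧ 0 < xyDet (f t) vr := by
  constructor
  · obtain ⟨ρ, hρ, v, hv, hpos⟩ := hf (t - δ / 2)
    set u := t - δ / 2 with hu
    set x := min (ρ / 2) (δ / 2) with hx
    have hx0 : 0 < x := by positivity
    have hx1 : x ≤ ρ / 2 := min_le_left _ _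
    have hx2 : x ≤ δ / 2 := min_le_right _ _
    have e1 := hv (u + x) (by linarith) (by linarith)
    have e2 := (h (u + x) (by rw [abs_lt]; constructor <;> linarith)).2 (by linarith)
    have e3 := (h u (by rw [abs_lt]; constructor <;> linarith)).2 (by linarith)
    have hvv : v = vl := by
      have e4 : x • v = x • vl := by
        have e5 : f u + (u + x - u) • v = f t + (u + x - t) • vl := e1.symm.trans e2
        rw [e3] at e5
        have e6 : (u + x - u) • v = (u + x - t) • vl - (u - t) • vl := by
          rw [eq_sub_iff_add_eq, ← add_right_inj (f t), ← e5]; abel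
        rw [← sub_smul] at e6
        rwa [show u + x - u = x by ring, show u + x - t - (u - t) = x by ring] at e6
      exact smul_right_injective _ hx0.ne' e4
    rw [e3, hvv, xyDet_add_smul] at hpos
    exact hpos
  · obtain ⟨ρ, hρ, v, hv, hpos⟩ := hf t
    set x := min (ρ / 2) (δ / 2) with hx
    have hx0 : 0 < x := by positivity
    have hx1 : x ≤ ρ / 2 := min_le_left _ _
    have hx2 : x ≤ δ / 2 := min_le_right _ _
    have e1 := hv (t + x) (by linarith) (by linarith)
    have e2 := (h (t + x) (by rw [abs_lt]; constructor <;> linarith)).1 (by linarith)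
    have hvv : v = vr := by
      have e5 := e1.symm.trans e2
      rw [add_sub_cancel_left, add_right_inj] at e5
      exact smul_right_injective _ hx0.ne' e5
    rwa [← hvv]

/-- If a piecewise affine link winds positively around the third axis, then so do its
mollifications. -/
theorem eventually_xyDet_mol_pos {ι : Type*} [Finite ι] {γ : ι → ℝ → Space}
    (p : ∀ i, Function.Periodic (γ i) 1) (a : ∀ i, PiecewiseAffine (γ i))
    (pos : ∀ i t, PosRight (γ i) t) :
    ∀ᶠ ε in 𝓝[>] (0 : ℝ), ∀ i t, 0 < xyDet (mol ε (γ i) t) (deriv (mol ε (γ i)) t) := by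
  have c := fun i => (a i).continuous
  have E : ∀ i, ∀ᶠ ε in 𝓝 (0 : ℝ), ∀ t ∈ Icc (0 : ℝ) 1,
      0 < ε → 0 < xyDet (mol ε (γ i) t) (deriv (mol ε (γ i)) t) := by
    intro i
    refine IsCompact.eventually_forall_of_forall_eventually isCompact_Icc fun t₀ _ => ?_
    obtain ⟨δ, hδ, vl, vr, h⟩ := a i t₀
    obtain ⟨hl, hr⟩ := h.xyDet_pos hδ (pos i)
    set κ := min (xyDet (γ i t₀) vl) (xyDet (γ i t₀) vr) / 2 with hκ
    have hm : 0 < min (xyDet (γ i t₀) vl) (xyDet (γ i t₀) vr) := lt_min hl hr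
    have hκp : 0 < κ := by positivity
    have ev : ∀ᶠ q in 𝓝 (γ i t₀), κ < xyDet q vl ∧ κ < xyDet q vr := by
      refine ((continuous_xyDet continuous_id continuous_const).continuousAt.eventually
        (lt_mem_nhds ?_)).and ((continuous_xyDet continuous_id continuous_const).continuousAt.eventually
        (lt_mem_nhds ?_))
      · have := min_le_left (xyDet (γ i t₀) vl) (xyDet (γ i t₀) vr)
        simp only [id]; linarith
      · have := min_le_right (xyDet (γ i t₀) vl) (xyDet (γ i t₀) vr)
        simp only [id]; linarith
    obtain ⟨r, hr0, hev⟩ := Metric.eventually_nhds_iff.1 ev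
    obtain ⟨ρ, hρ, hc⟩ := Metric.continuousAt_iff.1 ((c i).continuousAt (x := t₀)) (r / 2)
      (by positivity)
    refine Metric.eventually_nhds_iff.2 ⟨min (δ / 3) (ρ / 2), by positivity, ?_⟩
    rintro ⟨ε, t⟩ hd hε
    have hd1 := hd.trans_le (min_le_left _ _)
    have hd2 := hd.trans_le (min_le_right _ _)
    simp only [Prod.dist_eq, max_lt_iff, Real.dist_eq, sub_zero] at hd1 hd2 hε
    have hεa : ∀ x : ℝ, |x| ≤ 1 → |ε * x| ≤ ε := fun x hx => by
      rw [abs_mul, abs_of_pos hε]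
      exact mul_le_of_le_one_right hε.le hx
    have hq : ‖mol ε (γ i) t - γ i t₀‖ ≤ r / 2 := by
      refine norm_mol_sub_le (c i) fun x hx => ?_
      rw [← dist_eq_norm]
      refine (hc ?_).le
      rw [Real.dist_eq]
      have := hεa x hx
      have h1 := hd2.1
      have h2 := hd2.2
      rw [abs_lt] at *
      rw [abs_le] at this
      constructor <;> linarith
    obtain ⟨k1, k2⟩ := hev (y := mol ε (γ i) t) (by rw [dist_eq_norm]; linarith)
    have hD := ((contDiff_mol (c i) hε).differentiable (by simp) t).hasDerivAt
    -- The functional is frozen at the mollified point, which is so close to `γ i t₀` that the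
    -- functional still exceeds `κ` on both slopes; hence it increases at rate at least `κ` along
    -- the mollified curve.
    have := le_apply_deriv (xyDetL (mol ε (γ i) t)) (ρ := δ / 3) (κ := κ) (by positivity) hD
      fun u hu1 hu2 => by
        refine le_apply_mol_sub _ (c i) fun x hx => ?_
        have h0 := hεa x hx
        have h1 := hd1.1
        have h2 := hd1.2
        have := h.mono_apply (xyDetL (mol ε (γ i) t)) (κ := κ) (by simpa using k1.le)
          (by simpa using k2.le) (u := t - ε * x) (v := u - ε * x)
          (by rw [abs_lt] at *; rw [abs_le] at h0; constructor <;> linarith)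
          (by rw [abs_lt] at *; rw [abs_le] at h0; constructor <;> linarith) (by linarith)
        rwa [show u - ε * x - (t - ε * x) = u - t by ring] at this
    rw [xyDetL_apply] at this
    linarith
  filter_upwards [eventually_nhdsWithin_of_eventually_nhds (s := Ioi 0) (eventually_all.2 E),
    self_mem_nhdsWithin] with ε h1 (hε : 0 < ε) i t
  have hshift : (fun x => mol ε (γ i) (x - ⌊t⌋)) = mol ε (γ i) := funext fun x => by
    simpa using (mol_periodic (p i) ε).sub_int_mul_eq ⌊t⌋ (x := x)
  have h3 := deriv_comp_sub_const (f := mol ε (γ i)) (⌊t⌋ : ℝ) t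
  rw [hshift] at h3
  have h4 := congrFun hshift t
  rw [h3, ← h4]
  exact h1 i (Int.fract t) ⟨Int.fract_nonneg t, (Int.fract_lt_one t).le⟩ hε

/-! ### Closeness in the Lipschitz sense -/

section LipClose

variable {ι : Type*}

/-- The difference of two families of curves is small in the Lipschitz sense. -/
def LipClose (η : ℝ) (γ C : ι → ℝ → Space) : Prop :=
  (∀ i t, ‖C i t - γ i t‖ ≤ η) ∧
    ∀ i t u, ‖(C i t - γ i t) - (C i u - γ i u)‖ ≤ η * |t - u|

theorem LipClose.mono {η η' : ℝ} {γ C : ι → ℝ → Space} (h : LipClose η γ C) (hη : η ≤ η') :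
    LipClose η' γ C :=
  ⟨fun i t => (h.1 i t).trans hη, fun i t u => (h.2 i t u).trans
    (mul_le_mul_of_nonneg_right hη (abs_nonneg _))⟩

theorem LipClose.line {η : ℝ} {γ C : ι → ℝ → Space} (h : LipClose η γ C) {s : ℝ}
    (hs : s ∈ Icc (0 : ℝ) 1) : LipClose η γ (fun i t => γ i t + s • (C i t - γ i t)) := by
  have key : ∀ x : Space, ‖s • x‖ ≤ ‖x‖ := fun x => by
    rw [norm_smul, Real.norm_eq_abs, abs_of_nonneg hs.1]
    exact mul_le_of_le_one_left (norm_nonneg _) hs.2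
  refine ⟨fun i t => ?_, fun i t u => ?_⟩
  · rw [add_sub_cancel_left]; exact (key _).trans (h.1 i t)
  · rw [add_sub_cancel_left, add_sub_cancel_left, ← smul_sub]; exact (key _).trans (h.2 i t u)

theorem LipClose.trans {η η' : ℝ} {γ C D : ι → ℝ → Space} (h : LipClose η γ C)
    (h' : LipClose η' C D) : LipClose (η + η') γ D := by
  refine ⟨fun i t => ?_, fun i t u => ?_⟩
  · calc ‖D i t - γ i t‖ = ‖(C i t - γ i t) + (D i t - C i t)‖ := by congr 1; abel
      _ ≤ _ := (norm_add_le _ _).trans (add_le_add (h.1 i t) (h'.1 i t))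
  · calc _ = ‖((C i t - γ i t) - (C i u - γ i u)) + ((D i t - C i t) - (D i u - C i u))‖ := by
          congr 1; abel
      _ ≤ _ := (norm_add_le _ _).trans (add_le_add (h.2 i t u) (h'.2 i t u))
      _ = _ := by ring

theorem periodic_deriv {f : ℝ → Space} (hf : Function.Periodic f 1) :
    Function.Periodic (deriv f) 1 := fun t => by
  have := congrArg (fun f => deriv f t) (funext hf)
  simpa [deriv_comp_add_const] using this

theorem periodic_eq_fract {f : ℝ → Space} (hf : Function.Periodic f 1) (t : ℝ) :
    f t = f (Int.fract t) := by
  have := hf.sub_int_mul_eq ⌊t⌋ (x := t)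
  rw [Int.fract]
  simpa using this.symm

/-- Curves that are close enough to a link in the Lipschitz sense are simple and immersed. -/
theorem FramedLink.exists_lipClose [Finite ι] (L : FramedLink ι) :
    ∃ η > 0, ∀ C : ι → ℝ → Space, (∀ i, Function.Periodic (C i) 1) → LipClose η L.curve C →
      SimpleLoops C ∧ ∀ i t C', HasDerivAt (C i) C' t → C' ≠ 0 := by
  have hD : ∀ i t, HasDerivAt (L.curve i) (deriv (L.curve i) t) t := fun i t =>
    ((L.contDiff_curve i).differentiable (by simp) t).hasDerivAt
  have hD0 : ∀ i t, deriv (L.curve i) t ≠ 0 := fun i t =>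
    (L.nowhere_tangent i t).ne_zero 0
  have cD : ∀ i, Continuous (deriv (L.curve i)) := fun i =>
    (contDiff_infty_iff_deriv.1 (L.contDiff_curve i)).2.continuous
  have E1 : ∀ i j, ∀ᶠ η in 𝓝 (0 : ℝ), ∀ y ∈ (Icc (0 : ℝ) 1 ×ˢ Icc (0 : ℝ) 1),
      ∀ C : ι → ℝ → Space, (∀ i, Function.Periodic (C i) 1) → LipClose η L.curve C →
        C i y.1 = C j y.2 → i = j ∧ ∃ k : ℤ, y.2 = y.1 + k := by
    intro i j
    refine IsCompact.eventually_forall_of_forall_eventually (isCompact_Icc.prod isCompact_Icc) ?_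
    rintro ⟨t₀, u₀⟩ -
    by_cases hne : L.curve i t₀ = L.curve j u₀
    · obtain ⟨rfl, k, rfl⟩ := L.embedded _ _ _ _ hne
      -- By strict differentiability, points of the link near `t₀` separate at rate at least `c /
      -- 2`, while the perturbation changes differences at rate at most `η < c / 2`.
      have hst := (L.contDiff_curve i).contDiffAt.hasStrictDerivAt' (hD i t₀) (by simp)
      set c := ‖deriv (L.curve i) t₀‖ with hc
      have hc0 : 0 < c := norm_pos_iff.2 (hD0 i t₀)
      have hb := (hasStrictDerivAt_iff_hasStrictFDerivAt.1 hst).isLittleO.def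
        (c := c / 2) (by positivity)
      obtain ⟨δ, hδ, hb⟩ := Metric.eventually_nhds_iff.1 hb
      refine Metric.eventually_nhds_iff.2 ⟨min δ (c / 2), by positivity, ?_⟩
      rintro ⟨η, t, u⟩ hd C pC hC he
      have hd1 := hd.trans_le (min_le_left _ _)
      have hd2 := hd.trans_le (min_le_right _ _)
      simp only [Prod.dist_eq, max_lt_iff, Real.dist_eq, sub_zero] at hd1 hd2 he
      have hη : η < c / 2 := (abs_lt.1 hd2.1).2
      refine ⟨rfl, k, ?_⟩
      have he' : C i t = C i (u - k) := by
        rw [he]; simpa using ((pC i).sub_int_mul_eq k (x := u)).symm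
      have h1 := hb (y := (t, u - k)) (by
        rw [Prod.dist_eq, max_lt_iff, Real.dist_eq, Real.dist_eq]
        refine ⟨hd1.2.1, ?_⟩
        rw [show u - k - t₀ = u - (t₀ + k) by ring]; exact hd1.2.2)
      have h2 := hC.2 i t (u - k)
      simp only [ContinuousLinearMap.toSpanSingleton_apply, Real.norm_eq_abs] at h1
      rw [he'] at h2
      have h3 : ‖L.curve i t - L.curve i (u - k)‖ ≤ η * |t - (u - k)| := by
        rw [norm_sub_rev]
        calc _ = _ := by congr 1; abel
          _ ≤ _ := h2
      have h4 : |t - (u - k)| * c ≤ ‖L.curve i t - L.curve i (u - k)‖ +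
          ‖L.curve i t - L.curve i (u - k) - (t - (u - k)) • deriv (L.curve i) t₀‖ := by
        rw [hc, ← Real.norm_eq_abs, ← norm_smul]
        calc _ = ‖(L.curve i t - L.curve i (u - k)) -
              (L.curve i t - L.curve i (u - k) - (t - (u - k)) • deriv (L.curve i) t₀)‖ := by
              congr 1; abel
          _ ≤ _ := norm_sub_le _ _
      have h5 : |t - (u - k)| ≤ 0 := by
        by_contra hp
        push Not at hp
        nlinarith [mul_lt_mul_of_pos_right hη hp]
      have := abs_nonpos_iff.1 h5
      linarith
    -- Four errors smaller than `r`, two from continuity and two from the perturbation, cannot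
    -- bridge a distance of `5 r`.
    · set r := ‖L.curve i t₀ - L.curve j u₀‖ / 5 with hr
      have hr0 : 0 < r := by
        have := norm_pos_iff.2 (sub_ne_zero.2 hne); positivity
      obtain ⟨δ₁, hδ₁, h₁⟩ := Metric.continuousAt_iff.1
        ((L.contDiff_curve i).continuous.continuousAt (x := t₀)) r hr0
      obtain ⟨δ₂, hδ₂, h₂⟩ := Metric.continuousAt_iff.1
        ((L.contDiff_curve j).continuous.continuousAt (x := u₀)) r hr0
      refine Metric.eventually_nhds_iff.2 ⟨min r (min δ₁ δ₂), by positivity, ?_⟩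
      rintro ⟨η, t, u⟩ hd C pC hC he
      have hd1 := hd.trans_le (min_le_left _ _)
      have hd2 := (hd.trans_le (min_le_right _ _)).trans_le (min_le_left _ _)
      have hd3 := (hd.trans_le (min_le_right _ _)).trans_le (min_le_right _ _)
      simp only [Prod.dist_eq, max_lt_iff, Real.dist_eq, sub_zero] at hd1 hd2 hd3 he
      exfalso
      have e1 := h₁ (x := t) (by rw [Real.dist_eq]; exact hd2.2.1)
      have e2 := h₂ (x := u) (by rw [Real.dist_eq]; exact hd3.2.2)
      have e3 := hC.1 i t
      have e4 := hC.1 j u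
      have hη := (abs_lt.1 hd1.1).2
      rw [← dist_eq_norm] at e3 e4 hr
      rw [he] at e3
      have t1 := dist_triangle4 (L.curve i t₀) (L.curve i t) (C j u) (L.curve j u)
      have t2 := dist_triangle (L.curve i t₀) (L.curve j u) (L.curve j u₀)
      rw [dist_comm] at e1 e3
      linarith
  have E2 : ∀ i, ∀ᶠ η in 𝓝 (0 : ℝ), ∀ t ∈ Icc (0 : ℝ) 1, η < ‖deriv (L.curve i) t‖ := by
    intro i
    refine IsCompact.eventually_forall_of_forall_eventually isCompact_Icc fun t _ => ?_
    have c1 : Continuous fun z : ℝ × ℝ => ‖deriv (L.curve i) z.2‖ := (cD i).norm.comp continuous_snd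
    exact continuous_fst.continuousAt.eventually_lt c1.continuousAt (norm_pos_iff.2 (hD0 i t))
  have fr : ∀ t : ℝ, Int.fract t ∈ Icc (0 : ℝ) 1 := fun t =>
    ⟨Int.fract_nonneg t, (Int.fract_lt_one t).le⟩
  have ev := eventually_nhdsWithin_of_eventually_nhds (s := Ioi 0)
    ((eventually_all.2 fun i => eventually_all.2 (E1 i)).and (eventually_all.2 E2))
  obtain ⟨η, ⟨h1, h2⟩, hη⟩ := (ev.and self_mem_nhdsWithin).exists
  refine ⟨η, hη, fun C pC hC => ⟨fun i j t u he => ?_, fun i t C' hC' h0 => ?_⟩⟩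
  · rw [periodic_eq_fract (pC i), periodic_eq_fract (pC j)] at he
    obtain ⟨hij, k, hk⟩ := h1 i j (Int.fract t, Int.fract u) ⟨fr t, fr u⟩ C pC hC he
    refine ⟨hij, ⌊u⌋ - ⌊t⌋ + k, ?_⟩
    simp only [Int.fract] at hk
    push_cast
    linarith
  · have hlt := h2 i (Int.fract t) (fr t)
    rw [← periodic_eq_fract (periodic_deriv (L.periodic_curve i))] at hlt
    have hle := (hC'.sub (hD i t)).le_of_lip' (C := η) (le_of_lt hη)
      (Eventually.of_forall fun u => hC.2 i u t)
    rw [h0, zero_sub, norm_neg] at hle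
    linarith

theorem exists_modulus_deriv {f : ℝ → Space} (hf : Function.Periodic f 1) (h : ContDiff ℝ ∞ f)
    {η : ℝ} (hη : 0 < η) :
    ∃ ρ > 0, ∀ x t, |x| ≤ ρ → ‖deriv f (t + x) - deriv f t‖ ≤ η := by
  have cD : Continuous (deriv f) := (contDiff_infty_iff_deriv.1 h).2.continuous
  have E : ∀ᶠ x in 𝓝 (0 : ℝ), ∀ t ∈ Icc (0 : ℝ) 1, ‖deriv f (t + x) - deriv f t‖ < η := by
    refine IsCompact.eventually_forall_of_forall_eventually isCompact_Icc fun t _ => ?_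
    have c1 : Continuous fun z : ℝ × ℝ => ‖deriv f (z.2 + z.1) - deriv f z.2‖ := by fun_prop
    exact c1.continuousAt.eventually_lt continuousAt_const (by simpa using hη)
  obtain ⟨ρ, hρ, hE⟩ := Metric.eventually_nhds_iff.1 E
  refine ⟨ρ / 2, by positivity, fun x t hx => ?_⟩
  have := hE (y := x) (by rw [Real.dist_eq, sub_zero]; linarith) (Int.fract t)
    ⟨Int.fract_nonneg t, (Int.fract_lt_one t).le⟩
  have p := periodic_deriv hf
  have e1 : deriv f (Int.fract t + x) = deriv f (t + x) := by
    have := p.sub_int_mul_eq ⌊t⌋ (x := t + x)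
    rw [← this, Int.fract]; congr 1; ring
  rw [e1, ← periodic_eq_fract p] at this
  exact this.le

/-- A curve that is close enough to a smooth link in the Lipschitz sense stays so after
mollification. -/
theorem FramedLink.eventually_lipClose_mol [Finite ι] (L : FramedLink ι) {P : ι → ℝ → Space} {η η' : ℝ}
    (hη : η < η') (cP : ∀ i, Continuous (P i)) (hP : LipClose η L.curve P) :
    ∀ᶠ ε in 𝓝[>] (0 : ℝ), LipClose η' L.curve (fun i => mol ε (P i)) := by
  have hdf : ∀ i, Differentiable ℝ (L.curve i) := fun i =>
    (L.contDiff_curve i).differentiable (by simp)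
  -- The mollified `P` minus the link is an average of translates of `P` minus the link, which cost
  -- `η`, plus translates of the link minus the link, which cost `η' - η` in Lipschitz constant
  -- (here) and in value (`B`) for small translations.
  have A : ∀ i, ∀ᶠ ε in 𝓝[>] (0 : ℝ), ∀ x : ℝ, |x| ≤ ε → ∀ t u,
      ‖(L.curve i (t - x) - L.curve i t) - (L.curve i (u - x) - L.curve i u)‖ ≤ (η' - η) * |t - u| := by
    intro i
    obtain ⟨ρ, hρ, h⟩ := exists_modulus_deriv (L.periodic_curve i) (L.contDiff_curve i)
      (sub_pos.2 hη)
    filter_upwards [Ioc_mem_nhdsGT hρ] with ε hε x hx t u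
    refine Convex.norm_image_sub_le_of_norm_hasDerivWithin_le (s := univ)
      (f := fun t => L.curve i (t - x) - L.curve i t)
      (f' := fun t => deriv (L.curve i) (t - x) - deriv (L.curve i) t) (fun t _ => ?_)
      (fun t _ => ?_) convex_univ (mem_univ u) (mem_univ t)
    · exact ((HasDerivAt.comp_sub_const t x (hdf i _).hasDerivAt).sub
        (hdf i t).hasDerivAt).hasDerivWithinAt
    · have := h (-x) t (by rw [abs_neg]; exact hx.trans hε.2)
      rwa [← sub_eq_add_neg] at this
  have B : ∀ i, ∀ᶠ ε in 𝓝[>] (0 : ℝ), ∀ x : ℝ, |x| ≤ ε → ∀ t,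
      ‖L.curve i (t - x) - L.curve i t‖ ≤ η' - η := by
    intro i
    have E : ∀ᶠ x in 𝓝 (0 : ℝ), ∀ t ∈ Icc (0 : ℝ) 1, ‖L.curve i (t - x) - L.curve i t‖ < η' - η := by
      refine IsCompact.eventually_forall_of_forall_eventually isCompact_Icc fun t _ => ?_
      have c0 := (L.contDiff_curve i).continuous
      have c1 : Continuous fun z : ℝ × ℝ => ‖L.curve i (z.2 - z.1) - L.curve i z.2‖ := by fun_prop
      exact c1.continuousAt.eventually_lt continuousAt_const (by simpa using hη)
    obtain ⟨ρ, hρ, hE⟩ := Metric.eventually_nhds_iff.1 E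
    filter_upwards [Ioo_mem_nhdsGT hρ] with ε hε x hx t
    have := hE (y := x) (by rw [Real.dist_eq, sub_zero]; linarith [hε.2]) (Int.fract t)
      ⟨Int.fract_nonneg t, (Int.fract_lt_one t).le⟩
    have e1 : L.curve i (Int.fract t - x) = L.curve i (t - x) := by
      have := (L.periodic_curve i).sub_int_mul_eq ⌊t⌋ (x := t - x)
      rw [← this, Int.fract]; congr 1; ring
    rw [e1, ← periodic_eq_fract (L.periodic_curve i)] at this
    exact this.le
  filter_upwards [eventually_all.2 A, eventually_all.2 B, self_mem_nhdsWithin] with ε hA hB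
    (hε : 0 < ε)
  have hεa : ∀ x : ℝ, |x| ≤ 1 → |ε * x| ≤ ε := fun x hx => by
    rw [abs_mul, abs_of_pos hε]
    exact mul_le_of_le_one_right hε.le hx
  refine ⟨fun i t => ?_, fun i t u => ?_⟩
  · refine norm_mol_sub_le (cP i) fun a ha => ?_
    calc _ = ‖(P i (t - ε * a) - L.curve i (t - ε * a)) +
          (L.curve i (t - ε * a) - L.curve i t)‖ := by congr 1; abel
      _ ≤ η + (η' - η) := (norm_add_le _ _).trans (add_le_add (hP.1 _ _) (hB i _ (hεa a ha) t))
      _ = η' := by ring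
  · have cp := cP i
    have h1 : Continuous fun a => P i (t - ε * a) := by fun_prop
    have h2 : Continuous fun a => P i (u - ε * a) := by fun_prop
    have e : (mol ε (P i) t - L.curve i t) - (mol ε (P i) u - L.curve i u) =
        avg fun a => P i (t - ε * a) - P i (u - ε * a) - (L.curve i t - L.curve i u) := by
      rw [avg_sub (g := fun a => P i (t - ε * a) - P i (u - ε * a)) (h1.sub h2) continuous_const,
        avg_const, avg_sub h1 h2]
      simp only [mol]; abel
    rw [e]
    refine norm_avg_le (by fun_prop) fun a ha => ?_
    calc _ = ‖((P i (t - ε * a) - L.curve i (t - ε * a)) -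
            (P i (u - ε * a) - L.curve i (u - ε * a))) +
          ((L.curve i (t - ε * a) - L.curve i t) - (L.curve i (u - ε * a) - L.curve i u))‖ := by
          congr 1; abel
      _ ≤ η * |t - u| + (η' - η) * |t - u| := by
          refine (norm_add_le _ _).trans (add_le_add ?_ (hA i _ (hεa a ha) t u))
          have := hP.2 i (t - ε * a) (u - ε * a)
          rwa [show t - ε * a - (u - ε * a) = t - u by ring] at this
      _ = η' * |t - u| := by ring

end LipClose

/-! ### Inscribed polygons of smooth closed curves -/

section Interpolation

/-- The piecewise affine curve with vertices `q k` at the integers. -/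
noncomputable def pl (q : ℤ → Space) (x : ℝ) : Space :=
  q ⌊x⌋ + Int.fract x • (q (⌊x⌋ + 1) - q ⌊x⌋)

theorem pl_eq (q : ℤ → Space) {x : ℝ} (k : ℤ) (h1 : (k : ℝ) ≤ x) (h2 : x ≤ k + 1) :
    pl q x = q k + (x - k) • (q (k + 1) - q k) := by
  rcases h2.lt_or_eq with h | h
  · have hk : ⌊x⌋ = k := Int.floor_eq_iff.2 ⟨h1, h⟩
    simp [pl, Int.fract, hk]
  · have hk : ⌊x⌋ = k + 1 := Int.floor_eq_iff.2 ⟨by push_cast; linarith, by push_cast; linarith⟩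
    simp [pl, Int.fract, h]

theorem pl_right (q : ℤ → Space) {N : ℝ} (hN : 0 < N) {t u : ℝ} (h1 : t ≤ u)
    (h2 : N * u ≤ ⌊N * t⌋ + 1) :
    pl q (N * u) = pl q (N * t) + (u - t) • (N • (q (⌊N * t⌋ + 1) - q ⌊N * t⌋)) := by
  have h3 := Int.floor_le (N * t)
  have h4 : N * t ≤ N * u := mul_le_mul_of_nonneg_left h1 hN.le
  rw [pl_eq q _ (h3.trans h4) h2, pl_eq q _ h3 (Int.lt_floor_add_one _).le]
  module

theorem pl_left (q : ℤ → Space) {N : ℝ} (hN : 0 < N) {t u : ℝ} (h1 : u ≤ t)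
    (h2 : (⌈N * t⌉ : ℝ) - 1 ≤ N * u) :
    pl q (N * u) = pl q (N * t) + (u - t) • (N • (q ⌈N * t⌉ - q (⌈N * t⌉ - 1))) := by
  have h3 := Int.le_ceil (N * t)
  have h4 : N * u ≤ N * t := mul_le_mul_of_nonneg_left h1 hN.le
  rw [pl_eq q (⌈N * t⌉ - 1) (by push_cast; exact h2) (by push_cast; linarith),
    pl_eq q (⌈N * t⌉ - 1) (by push_cast; exact h2.trans h4) (by push_cast; linarith)]
  rw [sub_add_cancel]
  module

theorem piecewiseAffine_pl (q : ℤ → Space) {N : ℝ} (hN : 0 < N) :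
    PiecewiseAffine fun t => pl q (N * t) := by
  intro t
  have h1 := Int.lt_floor_add_one (N * t)
  have h2 := Int.ceil_lt_add_one (N * t)
  refine ⟨min ((⌊N * t⌋ + 1 - N * t) / N) ((N * t + 1 - ⌈N * t⌉) / N), lt_min (div_pos (by linarith) hN)
    (div_pos (by linarith) hN), _, _, fun u hu => ⟨fun h => pl_right q hN h ?_,
    fun h => pl_left q hN h ?_⟩⟩
  · have := (abs_lt.1 (hu.trans_le (min_le_left _ _))).2
    rw [lt_div_iff₀ hN] at this
    linarith
  · have := (abs_lt.1 (hu.trans_le (min_le_right _ _))).1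
    rw [← neg_div, div_lt_iff₀ hN] at this
    linarith

theorem pl_periodic {q : ℤ → Space} {N : ℕ} (hq : ∀ k, q (k + N) = q k) :
    Function.Periodic (fun t => pl q (N * t)) 1 := by
  intro t
  have e : (N : ℝ) * (t + 1) = N * t + N := by ring
  have h : ∀ k : ℤ, q (k + N + 1) = q (k + 1) := fun k => by rw [← hq (k + 1)]; congr 1; ring
  simp only [pl, e, Int.floor_add_natCast, Int.fract_add_natCast, hq, h]

/-- Affine interpolation of a smooth periodic curve on fine grids is close to the curve in the
Lipschitz sense. -/
theorem exists_interpolation {f : ℝ → Space} (hf : Function.Periodic f 1) (h : ContDiff ℝ ∞ f)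
    {η : ℝ} (hη : 0 < η) :
    ∃ N₀ : ℕ, ∀ N : ℕ, N₀ ≤ N → 0 < N →
      (∀ t, ‖pl (fun k => f (k / N)) (N * t) - f t‖ ≤ η) ∧
      ∀ t u, ‖(pl (fun k => f (k / N)) (N * t) - f t) -
        (pl (fun k => f (k / N)) (N * u) - f u)‖ ≤ η * |t - u| := by
  obtain ⟨ρ, hρ, hm⟩ := exists_modulus_deriv hf h hη
  obtain ⟨N₀, hN₀⟩ := exists_nat_gt (1 / ρ)
  have hd : Differentiable ℝ f := h.differentiable (by simp)
  refine ⟨N₀, fun N hN hN0 => ?_⟩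
  have hN' : (0 : ℝ) < N := by exact_mod_cast hN0
  have hNρ : 1 / (N : ℝ) ≤ ρ := by
    rw [div_le_comm₀ hN' hρ]
    exact hN₀.le.trans (by exact_mod_cast hN)
  set q : ℤ → Space := fun k => f (k / N) with hq
  -- The secant over a grid cell of length `1 / N ≤ ρ` is compared with the derivative at `t` by the
  -- mean value inequality for `x ↦ f x - x • f'(t)`.
  have slope : ∀ t : ℝ, ‖(N : ℝ) • (q (⌊N * t⌋ + 1) - q ⌊N * t⌋) - deriv f t‖ ≤ η := by
    intro t
    set k := ⌊N * t⌋ with hk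
    have h1 := Int.floor_le (N * t)
    have h2 := Int.lt_floor_add_one (N * t)
    rw [← hk] at h1 h2
    have a1 : (k : ℝ) / N ≤ t := by rw [div_le_iff₀ hN']; linarith
    have a2 : t ≤ ((k + 1 : ℤ) : ℝ) / N := by rw [le_div_iff₀ hN']; push_cast; linarith
    have a3 : ((k + 1 : ℤ) : ℝ) / N - (k : ℝ) / N = 1 / N := by push_cast; field_simp; ring
    have key := Convex.norm_image_sub_le_of_norm_hasDerivWithin_le
      (s := Icc ((k : ℝ) / N) (((k + 1 : ℤ) : ℝ) / N))
      (f := fun x => f x - x • deriv f t) (f' := fun x => deriv f x - (1 : ℝ) • deriv f t) (C := η)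
      (x := (k : ℝ) / N) (y := ((k + 1 : ℤ) : ℝ) / N)
      (fun x _ => ((hd x).hasDerivAt.sub ((hasDerivAt_id x).smul_const _)).hasDerivWithinAt)
      (fun x hx => by
        have := hm (x - t) t (by
          rw [abs_le]; constructor <;> linarith [hx.1, hx.2])
        rw [one_smul]
        rwa [add_sub_cancel] at this)
      (convex_Icc _ _) ⟨le_rfl, a1.trans a2⟩ ⟨a1.trans a2, le_rfl⟩
    rw [a3, Real.norm_eq_abs, abs_of_pos (by positivity)] at key
    calc _ = ‖(N : ℝ) • (f (((k + 1 : ℤ) : ℝ) / N) - (((k + 1 : ℤ) : ℝ) / N) • deriv f t -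
          (f ((k : ℝ) / N) - ((k : ℝ) / N) • deriv f t))‖ := by
            have : deriv f t = (N : ℝ) • ((((k + 1 : ℤ) : ℝ) / N - (k : ℝ) / N) • deriv f t) := by
              rw [a3, smul_smul, mul_one_div_cancel hN'.ne', one_smul]
            conv_lhs => rw [this]
            simp only [hq]
            congr 1
            module
      _ = N * ‖_‖ := by rw [norm_smul, Real.norm_eq_abs, abs_of_pos hN']
      _ ≤ N * (η * (1 / N)) := mul_le_mul_of_nonneg_left key hN'.le
      _ = η := by field_simp
  have lip : ∀ t u, t ≤ u → ‖(pl q (N * u) - f u) - (pl q (N * t) - f t)‖ ≤ η * (u - t) := by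
    intro t u htu
    -- The version with right derivatives is used because the interpolation has a corner at each
    -- vertex.
    refine norm_image_sub_le_of_norm_deriv_right_le_segment (f := fun u => pl q (N * u) - f u)
      (f' := fun x => (N : ℝ) • (q (⌊N * x⌋ + 1) - q ⌊N * x⌋) - deriv f x)
      (((piecewiseAffine_pl q hN').continuous.sub h.continuous).continuousOn)
      (fun x _ => ?_) (fun x _ => slope x) u ⟨htu, le_rfl⟩
    refine HasDerivWithinAt.sub ?_ (hd x).hasDerivAt.hasDerivWithinAt
    have hlin : HasDerivAt (fun u : ℝ => pl q (N * x) +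
        (u - x) • ((N : ℝ) • (q (⌊N * x⌋ + 1) - q ⌊N * x⌋)))
        ((N : ℝ) • (q (⌊N * x⌋ + 1) - q ⌊N * x⌋)) x := by
      simpa using (((hasDerivAt_id x).sub_const x).smul_const
        ((N : ℝ) • (q (⌊N * x⌋ + 1) - q ⌊N * x⌋))).const_add (pl q (N * x))
    refine hlin.hasDerivWithinAt.congr_of_eventuallyEq ?_ (by simp)
    have hlt : x < (⌊N * x⌋ + 1) / N := by
      rw [lt_div_iff₀ hN']; linarith [Int.lt_floor_add_one (N * x)]
    filter_upwards [Ico_mem_nhdsGE hlt] with u hu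
    refine pl_right q hN' hu.1 ?_
    have := hu.2.le
    rw [le_div_iff₀ hN'] at this
    linarith
  refine ⟨fun t => ?_, fun t u => ?_⟩
  · set k := ⌊N * t⌋ with hk
    have h1 := Int.floor_le (N * t)
    have h2 := Int.lt_floor_add_one (N * t)
    rw [← hk] at h1 h2
    have a1 : (k : ℝ) / N ≤ t := by rw [div_le_iff₀ hN']; linarith
    have a2 : t ≤ (k : ℝ) / N + 1 := by
      rw [← sub_le_iff_le_add, le_div_iff₀ hN']
      have : (1 : ℝ) ≤ N := by exact_mod_cast hN0
      nlinarith
    -- The difference vanishes at the grid point `k / N`, so the Lipschitz bound over at most one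
    -- unit bounds its value.
    have := lip _ _ a1
    rw [mul_div_cancel₀ _ hN'.ne', pl_eq q k le_rfl (by linarith)] at this
    simp only [sub_self, zero_smul, add_zero] at this
    rw [show q k - f ((k : ℝ) / N) = 0 from sub_self _, sub_zero] at this
    nlinarith
  · rcases le_total t u with htu | htu
    · rw [norm_sub_rev, abs_sub_comm, abs_of_nonneg (sub_nonneg.2 htu)]; exact lip t u htu
    · rw [abs_of_nonneg (sub_nonneg.2 htu)]; exact lip u t htu

end Interpolation

/-! ### Polygons in general position with respect to the axis -/

section GeneralPosition

/-- A perturbation of the identity that puts polygons into general position with respect to the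
third axis. -/
noncomputable def tilt (α : ℝ) (x : Space) : Space :=
  x + ((α * x 2 + α ^ 2) • EuclideanSpace.single 0 1 + α ^ 3 • EuclideanSpace.single 1 1)

theorem tilt_affine (α c : ℝ) (x y : Space) :
    tilt α (x + c • (y - x)) = tilt α x + c • (tilt α y - tilt α x) := by
  simp only [tilt, PiLp.add_apply, PiLp.smul_apply, PiLp.sub_apply, smul_eq_mul]
  module

theorem norm_tilt_sub {α : ℝ} (h0 : 0 ≤ α) (h1 : α ≤ 1) (x : Space) :
    ‖tilt α x - x‖ ≤ α * (‖x‖ + 2) := by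
  have hx : |x 2| ≤ ‖x‖ := by simpa using PiLp.norm_apply_le x 2
  have e0 : ‖(EuclideanSpace.single 0 1 : Space)‖ = 1 := by simp
  have e1 : ‖(EuclideanSpace.single 1 1 : Space)‖ = 1 := by simp
  rw [tilt, add_sub_cancel_left]
  refine (norm_add_le _ _).trans ?_
  rw [norm_smul, norm_smul, e0, e1, mul_one, mul_one, Real.norm_eq_abs, Real.norm_eq_abs,
    abs_of_nonneg (pow_nonneg h0 3)]
  have a1 : |α * x 2 + α ^ 2| ≤ α * ‖x‖ + α ^ 2 := by
    refine (abs_add_le _ _).trans ?_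
    rw [abs_mul, abs_of_nonneg h0, abs_of_nonneg (pow_nonneg h0 2)]
    gcongr
  nlinarith [pow_le_of_le_one h0 h1 two_ne_zero, pow_le_of_le_one h0 h1 three_ne_zero]

theorem norm_tilt_sub_sub {α : ℝ} (h0 : 0 ≤ α) (x y : Space) :
    ‖(tilt α x - x) - (tilt α y - y)‖ ≤ α * ‖x - y‖ := by
  have hx : |(x - y) 2| ≤ ‖x - y‖ := by simpa using PiLp.norm_apply_le (x - y) 2
  have e0 : ‖(EuclideanSpace.single 0 1 : Space)‖ = 1 := by simp
  have : (tilt α x - x) - (tilt α y - y) = (α * (x - y) 2) • EuclideanSpace.single 0 1 := by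
    simp only [tilt, PiLp.sub_apply]; module
  rw [this, norm_smul, e0, mul_one, Real.norm_eq_abs, abs_mul, abs_of_nonneg h0]
  exact mul_le_mul_of_nonneg_left hx h0

/-- As a function of `α` the determinant is a polynomial whose coefficients in degrees 2, 3 and 4
are, up to sign, the coordinates of `q - p`, so it is not the zero polynomial. The powers of `α` in
`tilt` are chosen to spread these coordinates over different degrees. -/
theorem finite_tilt_xyDet {p q : Space} (h : p ≠ q) :
    {α : ℝ | xyDet (tilt α p) (tilt α q) = 0}.Finite := by
  open Polynomial in
  set d := q - p with hd
  set F : Polynomial ℝ := C (p 0 * d 1 - p 1 * d 0) + C (p 2 * d 1 - p 1 * d 2) * X + C (d 1) * X ^ 2 +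
    C (-d 0) * X ^ 3 + C (-d 2) * X ^ 4 with hF
  have hne : F ≠ 0 := by
    intro h0
    apply h
    have c2 := congrArg (fun G => Polynomial.coeff G 2) h0
    have c3 := congrArg (fun G => Polynomial.coeff G 3) h0
    have c4 := congrArg (fun G => Polynomial.coeff G 4) h0
    simp [hF] at c2 c3 c4
    have : d = 0 := by
      ext i
      fin_cases i
      · simpa using c3
      · simpa using c2
      · simpa using c4
    exact (sub_eq_zero.1 this).symm
  refine (Polynomial.finite_setOfPred_isRoot hne).subset fun α hα => ?_
  have hq : q = p + d := by rw [hd]; abel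
  have : xyDet (tilt α p) (tilt α q) = F.eval α := by
    rw [hq, hF]
    simp [xyDet, tilt]
    ring
  change F.eval α = 0
  rw [← this]
  exact hα

/-- Every framed link is isotopic to links that are arbitrarily close to a polygon in general
position with respect to the third axis. -/
theorem FramedLink.exists_polygon {ι : Type*} [Finite ι] (L : FramedLink ι) :
    ∃ (N : ℕ) (q : ι → ℤ → Space), 2 ≤ N ∧ (∀ i k, q i (k + N) = q i k) ∧
      (∀ i k, xyDet (q i k) (q i (k + 1)) ≠ 0) ∧ SimpleLoops (fun i t => pl (q i) (N * t)) ∧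
      ∀ᶠ ε in 𝓝[>] (0 : ℝ), ∃ M : FramedLink ι,
        (∀ i, M.curve i = mol ε fun t => pl (q i) (N * t)) ∧ L.Isotopic M := by
  obtain ⟨η, hη, hL⟩ := L.exists_lipClose
  -- The Lipschitz budget `η` is spent as `η / 4` on the interpolation, `η / 4` on the tilt and the
  -- remaining `η / 2` on the mollification.
  have hint := fun i => exists_interpolation (L.periodic_curve i) (L.contDiff_curve i)
    (η := η / 4) (by positivity)
  choose N₀ hN₀ using hint
  obtain ⟨N₁, hN₁⟩ := Set.Finite.bddAbove (Set.finite_range N₀)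
  set N := max N₁ 2 with hN
  have hN0 : 0 < N := by omega
  have hN' : (0 : ℝ) < N := by exact_mod_cast hN0
  have hNi : ∀ i, N₀ i ≤ N := fun i => (hN₁ ⟨i, rfl⟩).trans (le_max_left _ _)
  set r : ι → ℤ → Space := fun i k => L.curve i (k / N) with hr
  set P : ι → ℝ → Space := fun i t => pl (r i) (N * t) with hP
  have rper : ∀ i k, r i (k + N) = r i k := fun i k => by
    simp only [hr]
    rw [← L.periodic_curve i (k / N)]
    congr 1
    push_cast
    field_simp
  have cP : ∀ i, Continuous (P i) := fun i => (piecewiseAffine_pl (r i) hN').continuous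
  have pP : ∀ i, Function.Periodic (P i) 1 := fun i => pl_periodic (rper i)
  have LP : LipClose (η / 4) L.curve P :=
    ⟨fun i t => (hN₀ i N (hNi i) hN0).1 t, fun i t u => (hN₀ i N (hNi i) hN0).2 t u⟩
  -- bounds for the interpolation
  obtain ⟨K, hK0, hKb, hKl⟩ : ∃ K > 0, (∀ i t, ‖P i t‖ ≤ K) ∧
      ∀ i t u, ‖P i t - P i u‖ ≤ K * |t - u| := by
    have b1 : ∀ i, ∃ K, ∀ t, ‖L.curve i t‖ ≤ K := fun i => by
      obtain ⟨K, hK⟩ := isCompact_Icc.exists_bound_of_continuousOn (s := Icc (0 : ℝ) 1)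
        (L.contDiff_curve i).continuous.continuousOn
      refine ⟨K, fun t => ?_⟩
      rw [periodic_eq_fract (L.periodic_curve i)]
      exact hK _ ⟨Int.fract_nonneg t, (Int.fract_lt_one t).le⟩
    have b2 : ∀ i, ∃ K, ∀ t, ‖deriv (L.curve i) t‖ ≤ K := fun i => by
      obtain ⟨K, hK⟩ := isCompact_Icc.exists_bound_of_continuousOn (s := Icc (0 : ℝ) 1)
        (contDiff_infty_iff_deriv.1 (L.contDiff_curve i)).2.continuous.continuousOn
      refine ⟨K, fun t => ?_⟩
      rw [periodic_eq_fract (periodic_deriv (L.periodic_curve i))]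
      exact hK _ ⟨Int.fract_nonneg t, (Int.fract_lt_one t).le⟩
    choose K₁ hK₁ using b1
    choose K₂ hK₂ using b2
    obtain ⟨B₁, hB₁⟩ := (Set.finite_range K₁).bddAbove
    obtain ⟨B₂, hB₂⟩ := (Set.finite_range K₂).bddAbove
    set K := max (max B₁ B₂) 0 + η with hK
    have k1 : ∀ i, K₁ i ≤ K - η := fun i => by
      rw [hK, add_sub_cancel_right]
      exact (hB₁ ⟨i, rfl⟩).trans ((le_max_left _ _).trans (le_max_left _ _))
    have k2 : ∀ i, K₂ i ≤ K - η := fun i => by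
      rw [hK, add_sub_cancel_right]
      exact (hB₂ ⟨i, rfl⟩).trans ((le_max_right _ _).trans (le_max_left _ _))
    have k3 : 0 < K := by
      have := le_max_right (max B₁ B₂) 0
      linarith
    refine ⟨K, k3, fun i t => ?_, fun i t u => ?_⟩
    · calc ‖P i t‖ = ‖(P i t - L.curve i t) + L.curve i t‖ := by rw [sub_add_cancel]
        _ ≤ η / 4 + K₁ i := (norm_add_le _ _).trans (add_le_add (LP.1 i t) (hK₁ i t))
        _ ≤ K := by linarith [k1 i]
    · have h1 : ‖L.curve i t - L.curve i u‖ ≤ (K - η) * |t - u| :=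
        Convex.norm_image_sub_le_of_norm_deriv_le (s := univ)
          (fun x _ => (L.contDiff_curve i).differentiable (by simp) x)
          (fun x _ => (hK₂ i x).trans (k2 i)) convex_univ (mem_univ u) (mem_univ t)
      calc ‖P i t - P i u‖ = ‖((P i t - L.curve i t) - (P i u - L.curve i u)) +
            (L.curve i t - L.curve i u)‖ := by congr 1; abel
        _ ≤ η / 4 * |t - u| + (K - η) * |t - u| :=
          (norm_add_le _ _).trans (add_le_add (LP.2 i t u) h1)
        _ ≤ K * |t - u| := by nlinarith [abs_nonneg (t - u)]
  have hrne : ∀ i k, r i k ≠ r i (k + 1) := by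
    intro i k he
    have := L.simpleLoops.eq_of_near (i := i) (u := (k : ℝ) / N) (v := ((k + 1 : ℤ) : ℝ) / N) (by
      have : (k : ℝ) / N - ((k + 1 : ℤ) : ℝ) / N = -(1 / N) := by push_cast; field_simp; ring
      rw [this, abs_neg, abs_of_pos (by positivity), div_lt_one hN']
      have : (2 : ℕ) ≤ N := le_max_right _ _
      have : (2 : ℝ) ≤ N := by exact_mod_cast this
      linarith) he
    rw [div_left_inj' hN'.ne'] at this
    push_cast at this
    linarith
  have hbad : (⋃ i, ⋃ k ∈ Finset.Ico (0 : ℤ) N,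
      {α : ℝ | xyDet (tilt α (r i k)) (tilt α (r i (k + 1))) = 0}).Finite :=
    Set.finite_iUnion fun i => Set.Finite.biUnion (Finset.finite_toSet _) fun k _ =>
      finite_tilt_xyDet (hrne i k)
  -- This bound gives `α (K + 2) ≤ η / 4`, which controls the tilt both in value and in Lipschitz
  -- constant. Only finitely many such `α` are bad, because the vertices are periodic.
  have hα0 : 0 < min 1 (η / (4 * (K + 2))) := by positivity
  obtain ⟨α, ⟨hα1, hα2⟩, hα3⟩ := ((Set.Ioo_infinite hα0).sdiff hbad).nonempty
  have hα4 : α ≤ 1 := hα2.le.trans (min_le_left _ _)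
  have hα5 : α * (K + 2) ≤ η / 4 := by
    have := hα2.le.trans (min_le_right _ _)
    rw [le_div_iff₀ (by positivity)] at this
    linarith
  set q : ι → ℤ → Space := fun i k => tilt α (r i k) with hq
  have hqP : ∀ i t, pl (q i) (N * t) = tilt α (P i t) := fun i t => by
    simp only [hP, pl, hq, tilt_affine]
  have LQ' : LipClose (η / 4) P (fun i t => pl (q i) (N * t)) := by
    refine ⟨fun i t => ?_, fun i t u => ?_⟩
    · simp only [hqP]
      refine (norm_tilt_sub hα1.le hα4 _).trans (le_trans ?_ hα5)
      have := hKb i t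
      gcongr
    · simp only [hqP]
      refine (norm_tilt_sub_sub hα1.le _ _).trans ?_
      calc α * ‖P i t - P i u‖ ≤ α * (K * |t - u|) := by have := hKl i t u; gcongr
        _ = (α * K) * |t - u| := by ring
        _ ≤ η / 4 * |t - u| := by
          have : α * K ≤ η / 4 := by nlinarith
          gcongr
  have LQ : LipClose (η / 2) L.curve (fun i t => pl (q i) (N * t)) :=
    (LP.trans LQ').mono (by linarith)
  have qper : ∀ i k, q i (k + N) = q i k := fun i k => by simp only [hq, rper]
  have aQ : ∀ i, PiecewiseAffine fun t => pl (q i) (N * t) := fun i => piecewiseAffine_pl (q i) hN'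
  have pQ : ∀ i, Function.Periodic (fun t => pl (q i) (N * t)) 1 := fun i => pl_periodic (qper i)
  refine ⟨N, q, by omega, qper, fun i k => ?_, (hL _ pQ (LQ.mono (by linarith))).1, ?_⟩
  · have hmod : ∀ k m : ℤ, q i (k + m * N) = q i k := by
      intro k m
      have hp : Function.Periodic (q i) (N : ℤ) := fun k => qper i k
      simpa using hp.int_mul m k
    intro h0
    have hNz : (0 : ℤ) < N := by exact_mod_cast hN0
    have e1 : q i (k % N) = q i k := by
      rw [← hmod (k % N) (k / N), mul_comm, Int.emod_add_mul_ediv]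
    have e2 : q i (k % N + 1) = q i (k + 1) := by
      rw [← hmod (k % N + 1) (k / N)]
      congr 1
      have := Int.emod_add_mul_ediv k N
      linarith
    refine hα3 (mem_iUnion.2 ⟨i, mem_iUnion₂.2 ⟨k % N, ?_, ?_⟩⟩)
    · rw [Finset.mem_Ico]; exact ⟨Int.emod_nonneg _ hNz.ne', Int.emod_lt_of_pos _ hNz⟩
    · change xyDet (q i (k % N)) (q i (k % N + 1)) = 0
      rw [e1, e2]; exact h0
  · filter_upwards [L.eventually_lipClose_mol (η' := η) (by linarith)
      (fun i => (aQ i).continuous) LQ, self_mem_nhdsWithin] with ε hε (hε0 : 0 < ε)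
    have sm := fun i => contDiff_mol (aQ i).continuous hε0
    refine L.exists_isotopic_of_line (fun i => mol ε fun t => pl (q i) (N * t)) sm
      (fun i => mol_periodic (pQ i) ε) (fun s hs => (hL _ (fun i t => ?_) (hε.line hs)).1)
      (fun s hs i t => ?_)
    · simp only [L.periodic_curve i t, mol_periodic (pQ i) ε t]
    · have d0 := ((L.contDiff_curve i).differentiable (by simp) t).hasDerivAt
      have d1 := ((sm i).differentiable (by simp) t).hasDerivAt
      refine (hL _ (fun i t => ?_) (hε.line hs)).2 i t _ (d0.add ((d1.sub d0).const_smul s))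
      simp only [L.periodic_curve i t, mol_periodic (pQ i) ε t]

end GeneralPosition

/-! ### Thin triangles across the axis -/

section Triangles

/-- The (possibly degenerate) closed triangle with the given vertices. -/
def tri (p q r : Space) : Set Space :=
  {x | ∃ α β l : ℝ, 0 ≤ α ∧ 0 ≤ β ∧ 0 ≤ l ∧ α + β + l = 1 ∧ x = α • p + β • q + l • r}

/-- The point at height `h`, across the third axis from `m`, scaled by `ε`. -/
noncomputable def apex (m : Space) (h ε : ℝ) : Space := !₂[-(ε * m 0), -(ε * m 1), h]

/-- Passing to the other side of the axis reverses the sense of winding. This sign is what makes the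
detour through an apex positive when the edge is negative. -/
theorem xyDet_apex (p m : Space) (h ε : ℝ) : xyDet p (apex m h ε) = -(ε * xyDet p m) := by
  simp [xyDet, apex]; ring

theorem apex_xyDet (p m : Space) (h ε : ℝ) : xyDet (apex m h ε) p = -(ε * xyDet m p) := by
  simp [xyDet, apex]; ring

theorem xyDet_self (p : Space) : xyDet p p = 0 := by simp [xyDet]; ring

theorem xyDet_swap (p q : Space) : xyDet p q = -xyDet q p := by simp only [xyDet]; ring

theorem continuous_apex {X : Type*} [TopologicalSpace X] {m : X → Space} {h ε : X → ℝ}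
    (hm : Continuous m) (hh : Continuous h) (hε : Continuous ε) :
    Continuous fun x => apex (m x) (h x) (ε x) := by
  unfold apex
  refine (PiLp.continuous_toLp 2 _).comp (continuous_pi fun i => ?_)
  fin_cases i
  · simp; fun_prop
  · simp; fun_prop
  · simpa using hh

/-- The parametrized line through `P` with direction `d`. -/
noncomputable def edgePt (P d : Space) (τ : ℝ) : Space := P + τ • d

theorem xyDet_edgePt (P d : Space) (σ τ : ℝ) :
    xyDet (edgePt P d σ) (edgePt P d τ) = (τ - σ) * xyDet P d := by
  simp [xyDet, edgePt]; ring

theorem continuous_edgePt (P d : Space) : Continuous (edgePt P d) := by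
  unfold edgePt; fun_prop

variable {P d : Space}

theorem edgePt_sq_pos (hPd : xyDet P d < 0) (τ : ℝ) :
    0 < edgePt P d τ 0 ^ 2 + edgePt P d τ 1 ^ 2 := by
  have h : xyDet (edgePt P d τ) d = xyDet P d := xyDet_add_smul P d τ
  by_contra hc
  have h0 : edgePt P d τ 0 = 0 := by nlinarith [sq_nonneg (edgePt P d τ 0), sq_nonneg (edgePt P d τ 1)]
  have h1 : edgePt P d τ 1 = 0 := by nlinarith [sq_nonneg (edgePt P d τ 0), sq_nonneg (edgePt P d τ 1)]
  rw [xyDet, h0, h1] at h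
  linarith

/-- A triangle whose vertices are close to a segment is close to the segment. -/
theorem exists_mem_segment_of_mem_tri {p q r p₀ r₀ x : Space} {η : ℝ} (hp : ‖p - p₀‖ < η)
    (hq : ‖q - p₀‖ < η) (hr : ‖r - r₀‖ < η) (hx : x ∈ tri p q r) :
    ∃ l ∈ Icc (0 : ℝ) 1, ‖x - (p₀ + l • (r₀ - p₀))‖ ≤ η := by
  obtain ⟨α, β, l, hα, hβ, hl, hs, rfl⟩ := hx
  refine ⟨l, ⟨hl, by linarith⟩, ?_⟩
  have e : α • p + β • q + l • r - (p₀ + l • (r₀ - p₀)) =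
      α • (p - p₀) + β • (q - p₀) + l • (r - r₀) := by
    have : α = 1 - β - l := by linarith
    subst this
    module
  rw [e]
  calc _ ≤ ‖α • (p - p₀)‖ + ‖β • (q - p₀)‖ + ‖l • (r - r₀)‖ := norm_add₃_le
    _ ≤ α * η + β * η + l * η := by
      rw [norm_smul, norm_smul, norm_smul, Real.norm_of_nonneg hα, Real.norm_of_nonneg hβ,
        Real.norm_of_nonneg hl]
      gcongr
    _ = η := by rw [← add_mul, ← add_mul, hs, one_mul]

/-- Near every point of an edge that winds negatively around the axis, there are small triangles
across the axis that meet the rest `K` of the link at most in the ends of the edge. -/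
theorem exists_window (hPd : xyDet P d < 0) {K K' : Set Space} (hK' : IsCompact K')
    {τ₀ : ℝ} (hτ₀ : edgePt P d τ₀ ∉ K')
    (hcount : {x ∈ K' | xyDet (edgePt P d τ₀) x = 0}.Countable)
    (hsub : K ⊆ K' ∨
      (τ₀ = 0 ∧ ∃ w : Space, w 2 ≠ 0 ∧ 0 < inner ℝ w d ∧
        ∀ x ∈ K, x ∉ K' → x ≠ P → inner ℝ w x < inner ℝ w P) ∨
      (τ₀ = 1 ∧ ∃ w : Space, w 2 ≠ 0 ∧ 0 < inner ℝ w d ∧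
        ∀ x ∈ K, x ∉ K' → x ≠ P + d → inner ℝ w (P + d) < inner ℝ w x)) :
    ∃ h₀ : ℝ, ∃ ρ > 0, ∀ τ τ' h ε, 0 ≤ τ → τ < τ' → τ' ≤ 1 → |τ - τ₀| < ρ → |τ' - τ₀| < ρ →
      |h - h₀| < ρ → 0 < ε → ε < ρ →
      ∀ x ∈ K, x ∈ tri (edgePt P d τ) (edgePt P d τ') (apex (edgePt P d ((τ + τ') / 2)) h ε) →
        (τ = 0 ∧ x = P) ∨ (τ' = 1 ∧ x = P + d) := by
  set p₀ := edgePt P d τ₀ with hp₀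
  have hsq := edgePt_sq_pos hPd τ₀
  rw [← hp₀] at hsq
  -- For `x` in the plane through `p₀` and the axis, on a segment from `p₀` to the axis and
  -- different from `p₀`, `H x` is the height at which that segment reaches the axis.
  set H : Space → ℝ := fun x =>
    p₀ 2 + (x 2 - p₀ 2) / (1 - (x 0 * p₀ 0 + x 1 * p₀ 1) / (p₀ 0 ^ 2 + p₀ 1 ^ 2)) with hH
  have hbad : (H '' {x ∈ K' | xyDet p₀ x = 0}).Countable := hcount.image H
  have hdense := hbad.dense_compl ℝ
  -- any height outside the countable set gives a segment to the axis that misses `K'`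
  have hmiss : ∀ h, h ∉ H '' {x ∈ K' | xyDet p₀ x = 0} → ∀ l ∈ Icc (0 : ℝ) 1,
      p₀ + l • (apex p₀ h 0 - p₀) ∉ K' := by
    intro h hh l hl hx
    rcases hl.1.eq_or_lt with h0 | h0
    · rw [← h0, zero_smul, add_zero] at hx
      exact hτ₀ hx
    · apply hh
      refine ⟨_, ⟨hx, ?_⟩, ?_⟩
      · simp [xyDet, apex]; ring
      · have e : 1 - ((p₀ + l • (apex p₀ h 0 - p₀)) 0 * p₀ 0 +
            (p₀ + l • (apex p₀ h 0 - p₀)) 1 * p₀ 1) / (p₀ 0 ^ 2 + p₀ 1 ^ 2) = l := by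
          simp [apex]
          field_simp
          ring
        simp only [hH]
        rw [e]
        simp [apex]
        field_simp
        ring
  have cr : Continuous fun z : (ℝ × ℝ) × (ℝ × ℝ) =>
      apex (edgePt P d ((z.1.1 + z.1.2) / 2)) z.2.1 z.2.2 :=
    continuous_apex ((continuous_edgePt P d).comp (by fun_prop)) (by fun_prop) (by fun_prop)
  have r0 : ∀ h, apex (edgePt P d ((τ₀ + τ₀) / 2)) h 0 = apex p₀ h 0 := fun h => by
    rw [add_self_div_two]
  -- stability of the previous statement
  have hfar : ∀ h₀, h₀ ∉ H '' {x ∈ K' | xyDet p₀ x = 0} → ∃ ρ > 0, ∀ τ τ' h ε, |τ - τ₀| < ρ →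
      |τ' - τ₀| < ρ → |h - h₀| < ρ → |ε| < ρ → ∀ x ∈ K',
      x ∉ tri (edgePt P d τ) (edgePt P d τ') (apex (edgePt P d ((τ + τ') / 2)) h ε) := by
    intro h₀ hh
    -- The segment to which the triangles collapse for `τ = τ' = τ₀`, `ε = 0`. Disjoint thickenings
    -- of it and `K'` take care of all nearby triangles.
    set S : Set Space := (fun l : ℝ => p₀ + l • (apex p₀ h₀ 0 - p₀)) '' Icc 0 1 with hS
    have cS : IsCompact S := isCompact_Icc.image (by fun_prop)
    have hdisj : Disjoint K' S := by
      rw [Set.disjoint_left]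
      rintro _ hx ⟨l, hl, rfl⟩
      exact hmiss h₀ hh l hl hx
    obtain ⟨η, hη, hη'⟩ := hdisj.exists_thickenings hK' cS.isClosed
    obtain ⟨δ₁, hδ₁, h₁⟩ := Metric.continuousAt_iff.1
      ((continuous_edgePt P d).continuousAt (x := τ₀)) (η / 2) (by positivity)
    obtain ⟨δ₂, hδ₂, h₂⟩ := Metric.continuousAt_iff.1
      (cr.continuousAt (x := ((τ₀, τ₀), (h₀, 0)))) (η / 2) (by positivity)
    refine ⟨min δ₁ δ₂, by positivity, fun τ τ' h ε a1 a2 a3 a4 x hx hxt => ?_⟩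
    have b1 := h₁ (x := τ) (by rw [Real.dist_eq]; exact a1.trans_le (min_le_left _ _))
    have b2 := h₁ (x := τ') (by rw [Real.dist_eq]; exact a2.trans_le (min_le_left _ _))
    have b3 := h₂ (x := ((τ, τ'), (h, ε))) (by
      simp only [Prod.dist_eq, max_lt_iff, Real.dist_eq, sub_zero]
      exact ⟨⟨a1.trans_le (min_le_right _ _), a2.trans_le (min_le_right _ _)⟩,
        a3.trans_le (min_le_right _ _), a4.trans_le (min_le_right _ _)⟩)
    simp only [r0] at b3
    rw [dist_eq_norm] at b1 b2 b3
    obtain ⟨l, hl, hle⟩ := exists_mem_segment_of_mem_tri b1 b2 b3 hxt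
    refine (Set.disjoint_left.1 hη') (a := x) ?_ ?_
    · exact Metric.self_subset_thickening hη _ hx
    · rw [Metric.mem_thickening_iff]
      exact ⟨_, ⟨l, hl, rfl⟩, by rw [dist_eq_norm]; linarith⟩
  rcases hsub with hsub | ⟨rfl, w, hw2, hwd, hwK⟩ | ⟨rfl, w, hw2, hwd, hwK⟩
  · obtain ⟨h₀, hh₀⟩ := hdense.nonempty
    obtain ⟨ρ, hρ, hfar⟩ := hfar h₀ hh₀
    refine ⟨h₀, ρ, hρ, fun τ τ' h ε _ _ _ a1 a2 a3 a4 a5 x hx hxt => ?_⟩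
    exact absurd hxt (hfar τ τ' h ε a1 a2 a3 (by rwa [abs_of_pos a4]) x (hsub hx))
  · -- the initial point of the edge
    have hopen : IsOpen {h : ℝ | inner ℝ w P < inner ℝ w (apex p₀ h 0)} :=
      isOpen_lt continuous_const (continuous_const.inner
        (continuous_apex continuous_const continuous_id continuous_const))
    have hne : {h : ℝ | inner ℝ w P < inner ℝ w (apex p₀ h 0)}.Nonempty := by
      -- On the axis the functional `w` equals `h * w 2`, so `w 2 ≠ 0` puts an apex on any desired
      -- side; the condition is open in `h` and thus compatible with avoiding a countable set.
      refine ⟨(inner ℝ w P + 1) / w 2, ?_⟩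
      simp [apex, PiLp.inner_apply, Fin.sum_univ_three]
      rw [div_mul_cancel₀ _ hw2]
      linarith
    obtain ⟨h₀, hU, hh₀⟩ := hdense.exists_mem_open hopen hne
    obtain ⟨ρ₁, hρ₁, hfar⟩ := hfar h₀ hU
    have ev : ∀ᶠ z : (ℝ × ℝ) × (ℝ × ℝ) in 𝓝 (((0 : ℝ), (0 : ℝ)), (h₀, (0 : ℝ))),
        inner ℝ w P < inner ℝ w (apex (edgePt P d ((z.1.1 + z.1.2) / 2)) z.2.1 z.2.2) := by
      refine continuousAt_const.eventually_lt (continuous_const.inner cr).continuousAt ?_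
      simp only [r0]
      exact hh₀
    obtain ⟨ρ₂, hρ₂, hev⟩ := Metric.eventually_nhds_iff.1 ev
    refine ⟨h₀, min ρ₁ ρ₂, by positivity, fun τ τ' h ε a0 aτ _ a1 a2 a3 a4 a5 x hx hxt => ?_⟩
    have hxK : x ∉ K' := fun hxK => hfar τ τ' h ε (a1.trans_le (min_le_left _ _))
      (a2.trans_le (min_le_left _ _)) (a3.trans_le (min_le_left _ _))
      (by rw [abs_of_pos a4]; exact a5.trans_le (min_le_left _ _)) x hxK hxt
    have hr := hev (y := ((τ, τ'), (h, ε))) (by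
      simp only [Prod.dist_eq, max_lt_iff, Real.dist_eq]
      refine ⟨⟨a1.trans_le (min_le_right _ _), a2.trans_le (min_le_right _ _)⟩,
        a3.trans_le (min_le_right _ _), ?_⟩
      rw [sub_zero, abs_of_pos a4]; exact a5.trans_le (min_le_right _ _))
    simp only at hr
    set r := apex (edgePt P d ((τ + τ') / 2)) h ε
    obtain ⟨α, β, l, hα, hβ, hl, hs, hxe⟩ := hxt
    -- All terms after the first are nonnegative, so the triangle lies in the closed half space `⟨w,
    -- ·⟩ ≥ ⟨w, P⟩`, whereas the points of `K` outside `K'` other than `P` lie strictly on the other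
    -- side.
    have hwx : inner ℝ w x = inner ℝ w P + (α * τ + β * τ') * inner ℝ w d +
        l * (inner ℝ w r - inner ℝ w P) := by
      rw [hxe]
      simp only [edgePt, inner_add_right, real_inner_smul_right]
      have : α = 1 - β - l := by linarith
      subst this
      ring
    by_cases hxP : x = P
    · left
      refine ⟨?_, hxP⟩
      rw [hxP] at hwx
      have hτ' : 0 < τ' := a0.trans_lt aτ
      have n1 : 0 ≤ l * (inner ℝ w r - inner ℝ w P) := mul_nonneg hl (by linarith)
      have n2 : 0 ≤ (α * τ + β * τ') * inner ℝ w d := by positivity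
      have z1 : l * (inner ℝ w r - inner ℝ w P) = 0 := by linarith
      have z2 : (α * τ + β * τ') * inner ℝ w d = 0 := by linarith
      have l0 : l = 0 := (mul_eq_zero.1 z1).resolve_right (by linarith)
      have z3 := (mul_eq_zero.1 z2).resolve_right hwd.ne'
      have n3 : 0 ≤ α * τ := by positivity
      have n4 : 0 ≤ β * τ' := by positivity
      have z4 : β * τ' = 0 := by linarith
      have z5 : β = 0 := (mul_eq_zero.1 z4).resolve_right hτ'.ne'
      have z6 : α = 1 := by linarith
      rw [z5, z6] at z3
      linarith
    · exfalso
      have := hwK x hx hxK hxP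
      have hτ' : 0 < τ' := a0.trans_lt aτ
      have n1 : 0 ≤ l * (inner ℝ w r - inner ℝ w P) := mul_nonneg hl (by linarith)
      have n2 : 0 ≤ (α * τ + β * τ') * inner ℝ w d := by positivity
      linarith
  · -- the final point of the edge
    have hopen : IsOpen {h : ℝ | inner ℝ w (apex p₀ h 0) < inner ℝ w (P + d)} :=
      isOpen_lt (continuous_const.inner
        (continuous_apex continuous_const continuous_id continuous_const)) continuous_const
    have hne : {h : ℝ | inner ℝ w (apex p₀ h 0) < inner ℝ w (P + d)}.Nonempty := by
      refine ⟨(inner ℝ w (P + d) - 1) / w 2, ?_⟩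
      simp only [mem_ofPred_eq]
      have : inner ℝ w (apex p₀ ((inner ℝ w (P + d) - 1) / w 2) 0) =
          (inner ℝ w (P + d) - 1) / w 2 * w 2 := by
        simp [apex, PiLp.inner_apply, Fin.sum_univ_three]
      rw [this, div_mul_cancel₀ _ hw2]
      linarith
    obtain ⟨h₀, hU, hh₀⟩ := hdense.exists_mem_open hopen hne
    obtain ⟨ρ₁, hρ₁, hfar⟩ := hfar h₀ hU
    have ev : ∀ᶠ z : (ℝ × ℝ) × (ℝ × ℝ) in 𝓝 (((1 : ℝ), (1 : ℝ)), (h₀, (0 : ℝ))),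
        inner ℝ w (apex (edgePt P d ((z.1.1 + z.1.2) / 2)) z.2.1 z.2.2) < inner ℝ w (P + d) := by
      refine (continuous_const.inner cr).continuousAt.eventually_lt continuousAt_const ?_
      simp only [r0]
      exact hh₀
    obtain ⟨ρ₂, hρ₂, hev⟩ := Metric.eventually_nhds_iff.1 ev
    refine ⟨h₀, min ρ₁ ρ₂, by positivity, fun τ τ' h ε _ aτ a0 a1 a2 a3 a4 a5 x hx hxt => ?_⟩
    have hxK : x ∉ K' := fun hxK => hfar τ τ' h ε (a1.trans_le (min_le_left _ _))
      (a2.trans_le (min_le_left _ _)) (a3.trans_le (min_le_left _ _))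
      (by rw [abs_of_pos a4]; exact a5.trans_le (min_le_left _ _)) x hxK hxt
    have hr := hev (y := ((τ, τ'), (h, ε))) (by
      simp only [Prod.dist_eq, max_lt_iff, Real.dist_eq]
      refine ⟨⟨a1.trans_le (min_le_right _ _), a2.trans_le (min_le_right _ _)⟩,
        a3.trans_le (min_le_right _ _), ?_⟩
      rw [sub_zero, abs_of_pos a4]; exact a5.trans_le (min_le_right _ _))
    simp only at hr
    set r := apex (edgePt P d ((τ + τ') / 2)) h ε
    obtain ⟨α, β, l, hα, hβ, hl, hs, hxe⟩ := hxt
    have hwx : inner ℝ w x = inner ℝ w (P + d) - (α * (1 - τ) + β * (1 - τ')) * inner ℝ w d -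
        l * (inner ℝ w (P + d) - inner ℝ w r) := by
      rw [hxe]
      simp only [edgePt, inner_add_right, real_inner_smul_right]
      have : α = 1 - β - l := by linarith
      subst this
      ring
    have hτ : 0 < 1 - τ := by linarith
    have hτ' : 0 ≤ 1 - τ' := by linarith
    have n1 : 0 ≤ l * (inner ℝ w (P + d) - inner ℝ w r) := mul_nonneg hl (by linarith)
    have n2 : 0 ≤ (α * (1 - τ) + β * (1 - τ')) * inner ℝ w d := by positivity
    by_cases hxP : x = P + d
    · right
      refine ⟨?_, hxP⟩
      rw [hxP] at hwx
      have z1 : l * (inner ℝ w (P + d) - inner ℝ w r) = 0 := by linarith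
      have z2 : (α * (1 - τ) + β * (1 - τ')) * inner ℝ w d = 0 := by linarith
      have l0 : l = 0 := (mul_eq_zero.1 z1).resolve_right (by linarith)
      have z3 := (mul_eq_zero.1 z2).resolve_right hwd.ne'
      have n3 : 0 ≤ α * (1 - τ) := by positivity
      have n4 : 0 ≤ β * (1 - τ') := by positivity
      have z4 : α * (1 - τ) = 0 := by linarith
      have z5 : α = 0 := (mul_eq_zero.1 z4).resolve_right hτ.ne'
      have z6 : β = 1 := by linarith
      rw [z5, z6] at z3
      linarith
    · exfalso
      have := hwK x hx hxK hxP
      linarith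

/-- The triangles over different parts of an edge meet at most in a common vertex, if they are thin
and reach the axis at different heights. -/
theorem eventually_tri_inter (hPd : xyDet P d < 0) {n i j : ℕ} (hn : 0 < n) (hij : i < j) {hi hj : ℝ}
    (hne : hi ≠ hj) :
    ∀ᶠ ε in 𝓝[>] (0 : ℝ), ∀ x,
      x ∈ tri (edgePt P d (i / n)) (edgePt P d ((i + 1) / n))
        (apex (edgePt P d ((i / n + (i + 1) / n) / 2)) hi ε) →
      x ∈ tri (edgePt P d (j / n)) (edgePt P d ((j + 1) / n))
        (apex (edgePt P d ((j / n + (j + 1) / n) / 2)) hj ε) →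
      j = i + 1 ∧ x = edgePt P d (j / n) := by
  have hn' : (0 : ℝ) < n := by exact_mod_cast hn
  set p := edgePt P d (j / n) with hp
  have hsq := edgePt_sq_pos hPd ((j : ℝ) / n)
  rw [← hp] at hsq
  set z := (hi + hj) / 2 with hz
  -- The plane `xyDet p = 0` separates the two parts of the edge, but it contains the axis. The
  -- affine function `ℓ` vanishes at `p` and has opposite signs at the heights `hi` and `hj` of the
  -- axis, so adding a small multiple of it gives a plane through `p` that also separates the apexes
  -- for small `ε`.
  set ℓ : Space → ℝ := fun x => (hi - hj) *
    (x 2 - z - (p 2 - z) * ((x 0 * p 0 + x 1 * p 1) / (p 0 ^ 2 + p 1 ^ 2))) with hℓ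
  have cℓ : Continuous ℓ := by simp only [hℓ]; fun_prop
  have cg : Continuous (xyDet p) := continuous_xyDet continuous_const continuous_id
  have ℓp : ℓ p = 0 := by
    simp only [hℓ]
    rw [show p 0 * p 0 + p 1 * p 1 = p 0 ^ 2 + p 1 ^ 2 by ring, div_self hsq.ne']
    ring
  have ℓA : ∀ m h, ℓ (apex m h 0) = (hi - hj) * (h - z) := fun m h => by
    simp [hℓ, apex]
  have gA : ∀ m h, xyDet p (apex m h 0) = 0 := fun m h => by simp [xyDet_apex]
  have ge : ∀ τ, xyDet p (edgePt P d τ) = (τ - j / n) * xyDet P d := fun τ => xyDet_edgePt _ _ _ _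
  have hc : 0 < (hi - hj) ^ 2 := by have := sub_ne_zero.2 hne; positivity
  have lt1 : (i : ℝ) / n < j / n := by
    have : (i : ℝ) < j := by exact_mod_cast hij
    gcongr
  have lt2 : (j : ℝ) / n < (j + 1) / n := by gcongr; linarith
  -- choice of `μ`
  have evp : ∀ x : Space, 0 < xyDet p x → ∀ᶠ μ in 𝓝[>] (0 : ℝ), 0 < xyDet p x + μ * ℓ x := by
    intro x hx
    refine eventually_nhdsWithin_of_eventually_nhds (continuousAt_const.eventually_lt
      (f := fun _ : ℝ => (0 : ℝ)) (g := fun μ : ℝ => xyDet p x + μ * ℓ x) (by fun_prop) (by simpa))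
  have evn : ∀ x : Space, xyDet p x < 0 → ∀ᶠ μ in 𝓝[>] (0 : ℝ), xyDet p x + μ * ℓ x < 0 := by
    intro x hx
    refine eventually_nhdsWithin_of_eventually_nhds (ContinuousAt.eventually_lt
      (g := fun _ : ℝ => (0 : ℝ)) (f := fun μ : ℝ => xyDet p x + μ * ℓ x) (by fun_prop)
      continuousAt_const (by simpa))
  obtain ⟨μ, ⟨m1, m2, m3⟩, hμ⟩ : ∃ μ, (0 < xyDet p (edgePt P d (i / n)) + μ * ℓ (edgePt P d (i / n)) ∧
      xyDet p (edgePt P d ((j + 1) / n)) + μ * ℓ (edgePt P d ((j + 1) / n)) < 0 ∧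
      (i + 1 < j → 0 < xyDet p (edgePt P d ((i + 1) / n)) + μ * ℓ (edgePt P d ((i + 1) / n)))) ∧
      μ ∈ Ioi (0 : ℝ) := by
    have e1 := evp (edgePt P d (i / n)) (by rw [ge]; nlinarith)
    have e2 := evn (edgePt P d ((j + 1) / n)) (by rw [ge]; nlinarith)
    have e3 : ∀ᶠ μ in 𝓝[>] (0 : ℝ), i + 1 < j →
        0 < xyDet p (edgePt P d ((i + 1) / n)) + μ * ℓ (edgePt P d ((i + 1) / n)) := by
      by_cases h : i + 1 < j
      · have : ((i : ℝ) + 1) / n < j / n := by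
          have : ((i + 1 : ℕ) : ℝ) < j := by exact_mod_cast h
          push_cast at this
          gcongr
        filter_upwards [evp (edgePt P d ((i + 1) / n)) (by rw [ge]; nlinarith)] with μ hμ _ using hμ
      · exact Eventually.of_forall fun _ h' => absurd h' h
    exact ((e1.and (e2.and e3)).and self_mem_nhdsWithin).exists
  have hμ : 0 < μ := hμ
  set f : Space → ℝ := fun x => xyDet p x + μ * ℓ x with hf
  have cf : Continuous f := cg.add (continuous_const.mul cℓ)
  have faff : ∀ (α β l : ℝ) (a b c : Space), α + β + l = 1 →
      f (α • a + β • b + l • c) = α * f a + β * f b + l * f c := by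
    intro α β l a b c hs
    have : α = 1 - β - l := by linarith
    subst this
    simp only [hf, hℓ, xyDet, PiLp.add_apply, PiLp.smul_apply, smul_eq_mul]
    field_simp
    ring
  have capex : ∀ m h, Continuous fun ε => f (apex m h ε) := fun m h =>
    cf.comp (continuous_apex continuous_const continuous_const continuous_id)
  have ei : ∀ᶠ ε in 𝓝[>] (0 : ℝ), 0 < f (apex (edgePt P d ((i / n + (i + 1) / n) / 2)) hi ε) := by
    refine eventually_nhdsWithin_of_eventually_nhds (continuousAt_const.eventually_lt
      (capex _ _).continuousAt ?_)
    simp only [hf, gA, ℓA, hz]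
    nlinarith [mul_pos hμ hc]
  have ej : ∀ᶠ ε in 𝓝[>] (0 : ℝ), f (apex (edgePt P d ((j / n + (j + 1) / n) / 2)) hj ε) < 0 := by
    refine eventually_nhdsWithin_of_eventually_nhds ((capex _ _).continuousAt.eventually_lt
      continuousAt_const ?_)
    simp only [hf, gA, ℓA, hz]
    nlinarith [mul_pos hμ hc]
  have fp : f p = 0 := by simp only [hf, ℓp, xyDet_self]; ring
  filter_upwards [ei, ej] with ε h1 h2 x hx hx'
  obtain ⟨α, β, l, hα, hβ, hl, hs, rfl⟩ := hx
  obtain ⟨α', β', l', hα', hβ', hl', hs', he⟩ := hx'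
  have F := faff α β l (edgePt P d (i / n)) (edgePt P d ((i + 1) / n))
    (apex (edgePt P d ((i / n + (i + 1) / n) / 2)) hi ε) hs
  have F' := faff α' β' l' (edgePt P d (j / n)) (edgePt P d ((j + 1) / n))
    (apex (edgePt P d ((j / n + (j + 1) / n) / 2)) hj ε) hs'
  rw [← he] at F'
  rw [← hp, fp, mul_zero, zero_add] at F'
  have m1' : 0 < f (edgePt P d (i / n)) := m1
  have m2' : f (edgePt P d ((j + 1) / n)) < 0 := m2
  have q1 : 0 ≤ f (edgePt P d ((i + 1) / n)) := by
    rcases (Nat.succ_le_of_lt hij).lt_or_eq with h | h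
    · exact (m3 h).le
    · have : edgePt P d ((i + 1) / n) = p := by
        rw [hp, ← h]; push_cast; rfl
      rw [this, fp]
  have s1 := mul_nonneg hα m1'.le
  have s2 := mul_nonneg hβ q1
  have s3 := mul_nonneg hl h1.le
  have s4 := mul_nonneg hβ' (neg_nonneg.2 m2'.le)
  have s5 := mul_nonneg hl' (neg_nonneg.2 h2.le)
  have z1 : β' * f (edgePt P d ((j + 1) / n)) = 0 := by linarith
  have z2 : l' * f (apex (edgePt P d ((j / n + (j + 1) / n) / 2)) hj ε) = 0 := by linarith
  have z3 : α * f (edgePt P d (i / n)) = 0 := by linarith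
  have z4 : l * f (apex (edgePt P d ((i / n + (i + 1) / n) / 2)) hi ε) = 0 := by linarith
  have z5 : β * f (edgePt P d ((i + 1) / n)) = 0 := by linarith
  have b0 : β' = 0 := (mul_eq_zero.1 z1).resolve_right m2'.ne
  have l0 : l' = 0 := (mul_eq_zero.1 z2).resolve_right h2.ne
  have a0 : α = 0 := (mul_eq_zero.1 z3).resolve_right m1'.ne'
  have l1 : l = 0 := (mul_eq_zero.1 z4).resolve_right h1.ne'
  have b1 : β = 1 := by linarith
  constructor
  · by_contra hji
    have h3 : 0 < f (edgePt P d ((i + 1) / n)) :=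
      m3 (lt_of_le_of_ne (Nat.succ_le_of_lt hij) fun h => hji h.symm)
    rw [b1, one_mul] at z5
    exact h3.ne' z5
  · rw [he, b0, l0, show α' = 1 by linarith]
    simp

end Triangles

/-! ### Subdivision of a negative edge -/

section Step

/-- To the right of `t` the curve `f` is affine and transverse to the half planes bounded by the
third axis. -/
def TransRight (f : ℝ → Space) (t : ℝ) : Prop :=
  ∃ δ > 0, ∃ v, (∀ u, t ≤ u → u < t + δ → f u = f t + (u - t) • v) ∧ xyDet (f t) v ≠ 0

theorem PosRight.transRight {f : ℝ → Space} {t : ℝ} (h : PosRight f t) : TransRight f t := by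
  obtain ⟨δ, hδ, v, h1, h2⟩ := h
  exact ⟨δ, hδ, v, h1, h2.ne'⟩

/-- If both `f t` and the right slope lay in the plane through `p` and the axis, their horizontal
parts would be parallel, contrary to transversality. Hence every parameter of intersection is
isolated from the right, and such sets of reals are countable. -/
theorem countable_xyDet_eq_zero {f : ℝ → Space} (hf : ∀ t, TransRight f t) {p : Space}
    (hp : 0 < p 0 ^ 2 + p 1 ^ 2) : {t | xyDet p (f t) = 0}.Countable := by
  set Z := {t | xyDet p (f t) = 0} with hZ
  have key : Z ⊆ {x ∈ Z | 𝓝[Z ∩ Ioi x] x = ⊥} := by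
    intro t ht
    refine ⟨ht, ?_⟩
    obtain ⟨δ, hδ, v, h1, h2⟩ := hf t
    have hv : xyDet p v ≠ 0 := by
      intro h0
      apply h2
      have e1 : p 0 * f t 1 - p 1 * f t 0 = 0 := ht
      have e2 : p 0 * v 1 - p 1 * v 0 = 0 := h0
      have e3 : (p 0 ^ 2 + p 1 ^ 2) * xyDet (f t) v = 0 := by
        simp only [xyDet]
        linear_combination (p 0 * f t 0 + p 1 * f t 1) * e2 - (p 0 * v 0 + p 1 * v 1) * e1
      exact (mul_eq_zero.1 e3).resolve_left hp.ne'
    rw [← empty_mem_iff_bot, mem_nhdsWithin_iff_exists_mem_nhds_inter]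
    refine ⟨Iio (t + δ), Iio_mem_nhds (by linarith), ?_⟩
    rintro u ⟨hu1, hu2, hu3⟩
    have hu1 : u < t + δ := hu1
    have hu3 : t < u := hu3
    have hu2 : xyDet p (f u) = 0 := hu2
    rw [h1 u hu3.le hu1] at hu2
    have e : xyDet p (f t + (u - t) • v) = xyDet p (f t) + (u - t) * xyDet p v := by
      simp [xyDet]; ring
    rw [e, show xyDet p (f t) = 0 from ht, zero_add] at hu2
    rcases mul_eq_zero.1 hu2 with h | h
    · linarith
    · exact absurd h hv
  exact (countable_setOfPred_isolated_right_within (s := Z)).mono key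

/-- Positivity is an open condition, so a small vertical correction is harmless. The nonzero
vertical component is what `exists_window` needs to place the apex by its height. -/
theorem exists_tilted_direction {w a b : Space} (ha : 0 < inner ℝ w a) (hb : 0 < inner ℝ w b) :
    ∃ w' : Space, w' 2 ≠ 0 ∧ 0 < inner ℝ w' a ∧ 0 < inner ℝ w' b := by
  set e : Space := EuclideanSpace.single 2 1 with he
  have ev : ∀ᶠ η in 𝓝[≠] (0 : ℝ), 0 < inner ℝ (w + η • e) a ∧ 0 < inner ℝ (w + η • e) b := by
    refine eventually_nhdsWithin_of_eventually_nhds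
      ((continuousAt_const.eventually_lt (f := fun _ : ℝ => (0 : ℝ))
        (g := fun η : ℝ => (inner ℝ (w + η • e) a : ℝ)) (Continuous.continuousAt (by fun_prop)) (by simpa)).and
      (continuousAt_const.eventually_lt (f := fun _ : ℝ => (0 : ℝ))
        (g := fun η : ℝ => (inner ℝ (w + η • e) b : ℝ)) (Continuous.continuousAt (by fun_prop)) (by simpa)))
  by_cases h2 : w 2 = 0
  · obtain ⟨η, hη, hη0⟩ := (ev.and self_mem_nhdsWithin).exists
    refine ⟨w + η • e, ?_, hη⟩
    have : (w + η • e) 2 = η := by simp [h2, he]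
    rw [this]
    exact hη0
  · exact ⟨w, h2, ha, hb⟩

/-- Each part of the edge admits an interval of heights, which allows the finitely many chosen
heights to be pairwise different, as required by `eventually_tri_inter`. -/
theorem exists_injOn_near (n : ℕ) (c ρ : ℕ → ℝ) (hρ : ∀ j, 0 < ρ j) :
    ∃ h : ℕ → ℝ, (∀ j, |h j - c j| < ρ j) ∧ ∀ i < n, ∀ j < n, h i = h j → i = j := by
  induction n with
  | zero => exact ⟨c, fun j => by simpa using hρ j, fun i hi => absurd hi (Nat.not_lt_zero i)⟩
  | succ n ih =>
    obtain ⟨h, h1, h2⟩ := ih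
    have hinf : (Ioo (c n - ρ n) (c n + ρ n)).Infinite := Ioo_infinite (by linarith [hρ n])
    obtain ⟨x, ⟨hx1, hx2⟩, hx3⟩ :=
      (hinf.sdiff ((Finset.range n).image h).finite_toSet).nonempty
    have hx3 : ∀ i < n, h i ≠ x := fun i hi he => hx3 (by
      rw [Finset.mem_coe, Finset.mem_image]; exact ⟨i, Finset.mem_range.2 hi, he⟩)
    refine ⟨Function.update h n x, fun j => ?_, fun i hi j hj he => ?_⟩
    · by_cases hj : j = n
      · subst hj
        rw [Function.update_self, abs_lt]; constructor <;> linarith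
      · rw [Function.update_of_ne hj]; exact h1 j
    · by_cases hi' : i = n <;> by_cases hj' : j = n
      · rw [hi', hj']
      · subst hi'
        rw [Function.update_self, Function.update_of_ne hj'] at he
        exact absurd he.symm (hx3 j (by omega))
      · subst hj'
        rw [Function.update_self, Function.update_of_ne hi'] at he
        exact absurd he (hx3 i (by omega))
      · rw [Function.update_of_ne hi', Function.update_of_ne hj'] at he
        exact h2 i (by omega) j (by omega) he

theorem AffineNear.add {f g : ℝ → Space} {t δ : ℝ} {vl vr wl wr : Space}
    (hf : AffineNear f t δ vl vr) (hg : AffineNear g t δ wl wr) :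
    AffineNear (fun u => f u + g u) t δ (vl + wl) (vr + wr) := by
  intro u hu
  refine ⟨fun h => ?_, fun h => ?_⟩
  · simp only [(hf u hu).1 h, (hg u hu).1 h]; module
  · simp only [(hf u hu).2 h, (hg u hu).2 h]; module

variable {ι : Type*} {γ : ι → ℝ → Space} {i₀ : ι} {a b : ℝ} {d : Space}

/-- All edges of the link but the edge of the component `i₀` over the interval `(a, b)`; the
interval may be made larger at both ends. -/
def restOf (γ : ι → ℝ → Space) (i₀ : ι) (lo hi : ℝ) : Set Space :=
  (⋃ i, ⋃ _ : i ≠ i₀, γ i '' Icc 0 1) ∪ γ i₀ '' Icc lo hi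

theorem isCompact_restOf [Finite ι] (hγ : ∀ i, Continuous (γ i)) (lo hi : ℝ) :
    IsCompact (restOf γ i₀ lo hi) := by
  refine IsCompact.union (isCompact_iUnion fun i => ?_) (isCompact_Icc.image (hγ i₀))
  by_cases h : i = i₀
  · simp [h]
  · simpa [h] using isCompact_Icc.image (hγ i)

theorem countable_restOf [Finite ι] (tr : ∀ i t, TransRight (γ i) t) (lo hi : ℝ) {p : Space}
    (hp : 0 < p 0 ^ 2 + p 1 ^ 2) : {x ∈ restOf γ i₀ lo hi | xyDet p x = 0}.Countable := by
  refine (countable_iUnion fun i => (countable_xyDet_eq_zero (tr i) hp).image (γ i)).mono ?_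
  rintro x ⟨hx, hx0⟩
  rcases hx with hx | ⟨t, -, rfl⟩
  · simp only [mem_iUnion] at hx
    obtain ⟨i, -, t, -, rfl⟩ := hx
    exact mem_iUnion.2 ⟨i, t, hx0, rfl⟩
  · exact mem_iUnion.2 ⟨i₀, t, hx0, rfl⟩

theorem notMem_restOf (hs : SimpleLoops γ) {t lo hi : ℝ} (h1 : t < lo) (h2 : hi < t + 1) :
    γ i₀ t ∉ restOf γ i₀ lo hi := by
  rintro (hx | ⟨u, hu, he⟩)
  · simp only [mem_iUnion] at hx
    obtain ⟨i, hi, u, -, he⟩ := hx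
    exact hi (hs _ _ _ _ he).1
  · obtain ⟨-, k, hk⟩ := hs _ _ _ _ he
    have l1 : -1 < (k : ℝ) := by linarith [hu.2]
    have l2 : (k : ℝ) < 0 := by linarith [hu.1]
    have l1' : -1 < k := by exact_mod_cast l1
    have l2' : k < 0 := by exact_mod_cast l2
    omega

/-- Every point of the edge has a window, and compactness gives a Lebesgue number `σ`: a part of
length less than `σ / 2` lies in one window. The two ends of the edge belong to the rest of the link
and need the half space alternatives of `exists_window`. -/
theorem exists_windows [Finite ι] (pa : ∀ i, PiecewiseAffine (γ i))
    (per : ∀ i, Function.Periodic (γ i) 1) (tr : ∀ i t, TransRight (γ i) t) (hs : SimpleLoops γ)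
    (hab : a < b) (hb : b < a + 1)
    (hd : ∀ τ ∈ Icc (0 : ℝ) 1, γ i₀ (a + τ * (b - a)) = edgePt (γ i₀ a) d τ)
    (hneg : xyDet (γ i₀ a) d < 0) :
    ∃ n : ℕ, 0 < n ∧ ∀ j < n, ∃ h₀ : ℝ, ∃ ρ > 0, ∀ h ε, |h - h₀| < ρ → 0 < ε → ε < ρ →
      ∀ x ∈ restOf γ i₀ b (a + 1),
        x ∈ tri (edgePt (γ i₀ a) d (j / n)) (edgePt (γ i₀ a) d ((j + 1) / n))
          (apex (edgePt (γ i₀ a) d ((j / n + (j + 1) / n) / 2)) h ε) →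
        (j = 0 ∧ x = γ i₀ a) ∨ (j + 1 = n ∧ x = γ i₀ a + d) := by
  have hba : 0 < b - a := by linarith
  have cγ := fun i => (pa i).continuous
  set P := γ i₀ a with hP
  have hQ : γ i₀ b = P + d := by
    have := hd 1 (by simp)
    rw [one_mul, add_sub_cancel] at this
    rw [this, edgePt, one_smul]
  set v := (b - a)⁻¹ • d with hv
  have onEdge : ∀ u ∈ Icc a b, γ i₀ u = P + (u - a) • v := by
    intro u hu
    have := hd ((u - a) / (b - a)) ⟨div_nonneg (by linarith [hu.1]) hba.le,
      (div_le_one hba).2 (by linarith [hu.2])⟩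
    rw [div_mul_cancel₀ _ hba.ne', add_sub_cancel] at this
    rw [this, edgePt, hv, smul_smul, div_eq_mul_inv]
  have inj_near : ∀ i t δ, δ ≤ 1 / 2 → ∀ u w, |u - t| < δ → |w - t| < δ → γ i u = γ i w → u = w :=
    fun i t δ hδ u w hu hw he => hs.eq_of_near (i := i) (by
      rw [abs_lt] at *; constructor <;> linarith) he
  have wd : ∀ w : Space, 0 < inner ℝ w v → 0 < inner ℝ w d := by
    intro w hw
    rw [hv, real_inner_smul_right] at hw
    exact (pos_iff_pos_of_mul_pos hw).1 (inv_pos.2 hba)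
  have local_window : ∀ τ₀ ∈ Icc (0 : ℝ) 1, ∃ h₀ : ℝ, ∃ ρ > 0, ∀ τ τ' h ε, 0 ≤ τ → τ < τ' → τ' ≤ 1 →
      |τ - τ₀| < ρ → |τ' - τ₀| < ρ → |h - h₀| < ρ → 0 < ε → ε < ρ →
      ∀ x ∈ restOf γ i₀ b (a + 1),
        x ∈ tri (edgePt P d τ) (edgePt P d τ') (apex (edgePt P d ((τ + τ') / 2)) h ε) →
        (τ = 0 ∧ x = P) ∨ (τ' = 1 ∧ x = P + d) := by
    intro τ₀ hτ₀
    have hsq := edgePt_sq_pos hneg τ₀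
    rcases hτ₀.1.eq_or_lt with h0 | h0
    · -- the initial point
      subst h0
      obtain ⟨δ₁, hδ₁, vl, vr, hA⟩ := pa i₀ a
      set δ := min (min δ₁ (b - a)) (1 / 2) with hδ
      have hδp : 0 < δ := by positivity
      have δ1 : δ ≤ δ₁ := (min_le_left _ _).trans (min_le_left _ _)
      have δ2 : δ ≤ b - a := (min_le_left _ _).trans (min_le_right _ _)
      have δ3 : δ ≤ 1 / 2 := min_le_right _ _
      have hA' : AffineNear (γ i₀) a δ vl v := fun u hu =>
        ⟨fun h => onEdge u ⟨h, by have := (abs_lt.1 hu).2; linarith⟩,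
          (hA u (hu.trans_le δ1)).2⟩
      obtain ⟨w₀, hl, hr⟩ := hA'.exists_direction hδp (inj_near i₀ a δ δ3)
      obtain ⟨w, hw2, hl, hr⟩ := exists_tilted_direction hl hr
      -- The compact part omits a short arc that arrives at the initial point. Since the curve does
      -- not turn back there, `w` is strictly smaller on this arc than at the initial point, while
      -- it increases along the edge.
      refine exists_window hneg (isCompact_restOf (i₀ := i₀) cγ b (a + 1 - δ / 2)) ?_
        (countable_restOf tr _ _ hsq) (Or.inr (Or.inl ⟨rfl, w, hw2, wd w hr, ?_⟩))
      · have : edgePt P d 0 = γ i₀ a := by simp [edgePt, hP]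
        rw [this]
        exact notMem_restOf hs hab (by linarith)
      · rintro x (hx | ⟨t, ht, rfl⟩) hxK' hxP
        · exact absurd (Or.inl hx) hxK'
        · have ht' : a + 1 - δ / 2 < t := by
            by_contra hc
            push Not at hc
            exact hxK' (Or.inr ⟨t, ⟨ht.1, hc⟩, rfl⟩)
          have e1 : γ i₀ t = γ i₀ (t - 1) := by
            have := per i₀ (t - 1); rwa [sub_add_cancel] at this
          have e2 := (hA' (t - 1) (by rw [abs_lt]; constructor <;> linarith [ht.2])).2
            (by linarith [ht.2])
          rw [e1, e2, inner_add_right, real_inner_smul_right]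
          have hlt : t - 1 - a < 0 := by
            rcases ht.2.lt_or_eq with h | h
            · linarith
            · exfalso; apply hxP; rw [e1, h]; simp [hP]
          have := mul_neg_of_neg_of_pos hlt hl
          linarith
    rcases hτ₀.2.eq_or_lt with h1 | h1
    · -- the final point
      subst h1
      obtain ⟨δ₁, hδ₁, vl, vr, hA⟩ := pa i₀ b
      set δ := min (min δ₁ (b - a)) (1 / 2) with hδ
      have hδp : 0 < δ := by positivity
      have δ1 : δ ≤ δ₁ := (min_le_left _ _).trans (min_le_left _ _)
      have δ2 : δ ≤ b - a := (min_le_left _ _).trans (min_le_right _ _)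
      have δ3 : δ ≤ 1 / 2 := min_le_right _ _
      have hA' : AffineNear (γ i₀) b δ v vr := fun u hu =>
        ⟨(hA u (hu.trans_le δ1)).1, fun h => by
          rw [onEdge u ⟨by have := (abs_lt.1 hu).1; linarith, h⟩, onEdge b ⟨hab.le, le_rfl⟩]
          module⟩
      obtain ⟨w₀, hl, hr⟩ := hA'.exists_direction hδp (inj_near i₀ b δ δ3)
      obtain ⟨w, hw2, hl, hr⟩ := exists_tilted_direction hl hr
      refine exists_window hneg (isCompact_restOf (i₀ := i₀) cγ (b + δ / 2) (a + 1)) ?_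
        (countable_restOf tr _ _ hsq) (Or.inr (Or.inr ⟨rfl, w, hw2, wd w hl, ?_⟩))
      · have : edgePt P d 1 = γ i₀ b := by simp [edgePt, hQ]
        rw [this]
        exact notMem_restOf hs (by linarith) (by linarith)
      · rintro x (hx | ⟨t, ht, rfl⟩) hxK' hxP
        · exact absurd (Or.inl hx) hxK'
        · have ht' : t < b + δ / 2 := by
            by_contra hc
            push Not at hc
            exact hxK' (Or.inr ⟨t, ⟨hc, ht.2⟩, rfl⟩)
          have e2 := (hA' t (by rw [abs_lt]; constructor <;> linarith [ht.1])).1 ht.1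
          rw [e2, hQ, inner_add_right (y := P + d), real_inner_smul_right]
          have hlt : 0 < t - b := by
            rcases ht.1.lt_or_eq with h | h
            · linarith
            · exfalso; apply hxP; rw [← h, hQ]
          have := mul_pos hlt hr
          linarith
    · refine exists_window hneg (isCompact_restOf (i₀ := i₀) cγ b (a + 1)) ?_
        (countable_restOf tr _ _ hsq) (Or.inl subset_rfl)
      rw [← hd τ₀ hτ₀]
      exact notMem_restOf hs (by nlinarith) (by nlinarith)
  have E : ∀ᶠ σ in 𝓝 (0 : ℝ), ∀ τ₀ ∈ Icc (0 : ℝ) 1, ∃ h₀ : ℝ, ∃ ρ > 0, ∀ τ τ' h ε, 0 ≤ τ → τ < τ' →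
      τ' ≤ 1 → |τ - τ₀| < σ → |τ' - τ₀| < σ → |h - h₀| < ρ → 0 < ε → ε < ρ →
      ∀ x ∈ restOf γ i₀ b (a + 1),
        x ∈ tri (edgePt P d τ) (edgePt P d τ') (apex (edgePt P d ((τ + τ') / 2)) h ε) →
        (τ = 0 ∧ x = P) ∨ (τ' = 1 ∧ x = P + d) := by
    refine IsCompact.eventually_forall_of_forall_eventually isCompact_Icc fun τ₀ hτ₀ => ?_
    obtain ⟨h₀, ρ, hρ, H⟩ := local_window τ₀ hτ₀
    refine Metric.eventually_nhds_iff.2 ⟨ρ / 2, by positivity, ?_⟩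
    rintro ⟨σ, τ₁⟩ hdist
    simp only [Prod.dist_eq, max_lt_iff, Real.dist_eq, sub_zero] at hdist
    refine ⟨h₀, ρ, hρ, fun τ τ' h ε a1 a2 a3 a4 a5 => H τ τ' h ε a1 a2 a3 ?_ ?_⟩
    · have := hdist.1; have := hdist.2; have a4 : |τ - τ₁| < σ := a4
      rw [abs_lt] at *; constructor <;> linarith
    · have := hdist.1; have := hdist.2; have a5 : |τ' - τ₁| < σ := a5
      rw [abs_lt] at *; constructor <;> linarith
  obtain ⟨σ, hσ, hE⟩ := Metric.eventually_nhds_iff.1 E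
  obtain ⟨n, hn⟩ := exists_nat_gt (2 / σ)
  have hn' : (0 : ℝ) < n := lt_trans (by positivity) hn
  refine ⟨n, by exact_mod_cast hn', fun j hj => ?_⟩
  have hj' : ((j : ℝ) + 1) ≤ n := by exact_mod_cast hj
  have s1 : 1 / (n : ℝ) < σ / 2 := by
    rw [div_lt_iff₀ hn']
    rw [div_lt_iff₀ hσ] at hn
    linarith
  have e1 : ((j : ℝ) + 1) / n - j / n = 1 / n := by field_simp; ring
  obtain ⟨h₀, ρ, hρ, H⟩ := hE (y := σ / 2) (by rw [Real.dist_eq, sub_zero, abs_of_pos] <;> linarith)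
    ((j : ℝ) / n) ⟨by positivity, (div_le_one hn').2 (by linarith)⟩
  refine ⟨h₀, ρ, hρ, fun h ε b1 b2 b3 x hx hxt => ?_⟩
  have := H (j / n) ((j + 1) / n) h ε (by positivity) (by gcongr; linarith) ((div_le_one hn').2 hj')
    (by rw [sub_self, abs_zero]; positivity)
    (by rw [e1, abs_of_pos (by positivity)]; exact s1) b1 b2 b3 x hx hxt
  rcases this with ⟨c1, c2⟩ | ⟨c1, c2⟩
  · left
    refine ⟨?_, c2⟩
    rcases div_eq_zero_iff.1 c1 with c | c
    · exact_mod_cast c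
    · exact absurd c hn'.ne'
  · right
    refine ⟨?_, c2⟩
    rw [div_eq_one_iff_eq hn'.ne'] at c1
    exact_mod_cast c1

end Step

/-! ### The sawtooth -/

section Replace

/-- A sawtooth with vertices `0, w 0, 0, w 1, 0, …, w (n - 1), 0` at the integers `0, …, 2 n`. -/
noncomputable def sawVertices (n : ℕ) (w : ℕ → Space) (k : ℤ) : Space :=
  if 0 ≤ k ∧ k < 2 * n ∧ k % 2 = 1 then w (k / 2).toNat else 0

theorem sawVertices_even (n : ℕ) (w : ℕ → Space) (j : ℤ) : sawVertices n w (2 * j) = 0 := by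
  rw [sawVertices, if_neg]
  omega

theorem sawVertices_odd {n : ℕ} (w : ℕ → Space) {j : ℕ} (hj : j < n) :
    sawVertices n w (2 * j + 1) = w j := by
  rw [sawVertices, if_pos (by omega)]
  congr 1
  omega

theorem sawVertices_of_neg (n : ℕ) (w : ℕ → Space) {k : ℤ} (hk : k ≤ 0) : sawVertices n w k = 0 := by
  rw [sawVertices, if_neg]
  omega

theorem sawVertices_of_ge (n : ℕ) (w : ℕ → Space) {k : ℤ} (hk : 2 * n ≤ k) :
    sawVertices n w k = 0 := by
  rw [sawVertices, if_neg]
  omega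

theorem saw_of_nonpos (n : ℕ) (w : ℕ → Space) {x : ℝ} (hx : x ≤ 0) :
    pl (sawVertices n w) x = 0 := by
  rcases hx.lt_or_eq with h | h
  · have : ⌊x⌋ < 0 := Int.floor_lt.2 (by exact_mod_cast h)
    rw [pl, sawVertices_of_neg n w (by omega), sawVertices_of_neg n w (by omega)]
    simp
  · rw [h, pl]
    simp [sawVertices_of_neg]

theorem saw_of_ge (n : ℕ) (w : ℕ → Space) {x : ℝ} (hx : 2 * n ≤ x) :
    pl (sawVertices n w) x = 0 := by
  have : (2 * n : ℤ) ≤ ⌊x⌋ := Int.le_floor.2 (by exact_mod_cast hx)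
  rw [pl, sawVertices_of_ge n w this, sawVertices_of_ge n w (by omega)]
  simp

theorem saw_up {n : ℕ} (w : ℕ → Space) {j : ℕ} (hj : j < n) {x : ℝ} (h1 : 2 * j ≤ x)
    (h2 : x ≤ 2 * j + 1) : pl (sawVertices n w) x = (x - 2 * j) • w j := by
  rw [pl_eq _ (2 * j) (by push_cast; exact h1) (by push_cast; exact h2), sawVertices_even,
    sawVertices_odd w hj]
  push_cast
  module

theorem saw_down {n : ℕ} (w : ℕ → Space) {j : ℕ} (hj : j < n) {x : ℝ} (h1 : 2 * j + 1 ≤ x)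
    (h2 : x ≤ 2 * j + 2) : pl (sawVertices n w) x = (2 * j + 2 - x) • w j := by
  rw [pl_eq _ (2 * j + 1) (by push_cast; exact h1) (by push_cast; linarith),
    show (2 * (j : ℤ) + 1 + 1) = 2 * (j + 1 : ℕ) by push_cast; ring, sawVertices_even,
    sawVertices_odd w hj]
  push_cast
  module

theorem AffineNear.comp_affine {f : ℝ → Space} {t δ : ℝ} {vl vr : Space}
    (h : AffineNear f t δ vl vr) (s : ℝ) : AffineNear (fun u => f (u - s)) (t + s) δ vl vr := by
  intro u hu
  have := h (u - s) (by rwa [show u - s - t = u - (t + s) by ring])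
  refine ⟨fun h1 => ?_, fun h1 => ?_⟩
  · simp only [this.1 (by linarith), add_sub_cancel_right]
    congr 2; ring
  · simp only [this.2 (by linarith), add_sub_cancel_right]
    congr 2; ring

/-- The sawtooth over the interval `[a, b]`, repeated with period one. -/
noncomputable def sawBump (n : ℕ) (w : ℕ → Space) (a b t : ℝ) : Space :=
  pl (sawVertices n w) (2 * n / (b - a) * Int.fract (t - a))

theorem sawBump_periodic (n : ℕ) (w : ℕ → Space) (a b : ℝ) :
    Function.Periodic (sawBump n w a b) 1 := fun t => by
  rw [sawBump, sawBump, add_sub_right_comm, Int.fract_add_one]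

variable {n : ℕ} {w : ℕ → Space} {a b : ℝ}

theorem sawBump_of_ge (hab : a < b) {t : ℝ} (ht : b - a ≤ Int.fract (t - a)) :
    sawBump n w a b t = 0 := by
  have hba : 0 < b - a := by linarith
  refine saw_of_ge n w ?_
  calc (2 * n : ℝ) = 2 * n / (b - a) * (b - a) := by field_simp
    _ ≤ _ := by gcongr

theorem sawBump_of_zero {t : ℝ} (ht : Int.fract (t - a) = 0) : sawBump n w a b t = 0 := by
  rw [sawBump, ht, mul_zero]
  exact saw_of_nonpos n w le_rfl

/-- Just before `a` both the periodic bump and the unperiodic sawtooth vanish. The formula therefore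
holds across the seam, on a neighbourhood of every `t` with `⌊t - a⌋ = k`. -/
theorem sawBump_eq (hab : a < b) {t : ℝ} (k : ℤ) (h1 : b - 1 ≤ t - k) (h2 : t - k < a + 1) :
    sawBump n w a b t = pl (sawVertices n w) (2 * n / (b - a) * (t - a - k)) := by
  have hba : 0 < b - a := by linarith
  rcases le_or_gt a (t - k) with h | h
  · have hk : ⌊t - a⌋ = k := Int.floor_eq_iff.2 ⟨by linarith, by linarith⟩
    rw [sawBump, Int.fract, hk]
  · rw [saw_of_nonpos n w (mul_nonpos_of_nonneg_of_nonpos (by positivity) (by linarith))]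
    rcases lt_or_ge (t - a) (k - 1) with h3 | h3
    · exact absurd h3 (by linarith)
    · have hk : ⌊t - a⌋ = k - 1 := Int.floor_eq_iff.2 ⟨by push_cast; linarith, by push_cast; linarith⟩
      refine sawBump_of_ge hab ?_
      rw [Int.fract, hk]; push_cast; linarith

theorem piecewiseAffine_sawBump (hn : 0 < n) (hab : a < b) (hb : b < a + 1) :
    PiecewiseAffine (sawBump n w a b) := by
  intro t
  have hba : 0 < b - a := by linarith
  have hn' : (0 : ℝ) < n := by exact_mod_cast hn
  have hc : 0 < 2 * n / (b - a) := by positivity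
  set k := ⌊t - a⌋ with hk
  have k1 := Int.floor_le (t - a)
  have k2 := Int.lt_floor_add_one (t - a)
  rw [← hk] at k1 k2
  obtain ⟨δ, hδ, vl, vr, h⟩ := piecewiseAffine_pl (sawVertices n w) hc (t - (a + k))
  have h' := h.comp_affine (a + k)
  rw [sub_add_cancel] at h'
  set δ' := min δ (min (a + 1 - b) (a + 1 + k - t)) with hδ'
  have hδ'p : 0 < δ' := lt_min hδ (lt_min (by linarith) (by linarith))
  refine ⟨δ', hδ'p, vl, vr, fun u hu => ?_⟩
  have e : ∀ u, |u - t| < δ' → sawBump n w a b u =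
      pl (sawVertices n w) (2 * n / (b - a) * (u - (a + k))) := by
    intro u hu
    have b1 : δ' ≤ a + 1 - b := (min_le_right _ _).trans (min_le_left _ _)
    have b2 : δ' ≤ a + 1 + k - t := (min_le_right _ _).trans (min_le_right _ _)
    have := abs_lt.1 hu
    rw [sawBump_eq hab k (by linarith) (by linarith), sub_sub]
  rw [e u hu, e t (by simpa using hδ'p)]
  exact h' u (hu.trans_le (min_le_left _ _))

end Replace

/-! ### Replacing a negative edge by positive ones -/

section Step

variable {ι : Type*} [DecidableEq ι] {γ : ι → ℝ → Space} {i₀ : ι} {a b : ℝ} {d : Space}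

/-- Position of a point over the edge: the index `j` of the part, and the coordinate `y ∈ [0, 2)`
along the part. -/
theorem exists_part {n : ℕ} (hn : 0 < n) {u l : ℝ} (h0 : 0 ≤ u) (h1 : u < l) :
    ∃ j < n, ∃ y : ℝ, 0 ≤ y ∧ y < 2 ∧ 2 * n / l * u = 2 * j + y := by
  have hl : 0 < l := h0.trans_lt h1
  have hn' : (0 : ℝ) < n := by exact_mod_cast hn
  have hx0 : 0 ≤ 2 * n / l * u := by positivity
  have hx1 : 2 * n / l * u < 2 * n := by
    rw [div_mul_eq_mul_div, div_lt_iff₀ hl]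
    exact mul_lt_mul_of_pos_left h1 (by positivity)
  set x := 2 * n / l * u with hx
  have f1 := Nat.floor_le (show 0 ≤ x / 2 by positivity)
  have f2 := Nat.lt_floor_add_one (x / 2)
  refine ⟨⌊x / 2⌋₊, ?_, x - 2 * ⌊x / 2⌋₊, by linarith, by linarith, by ring⟩
  rw [Nat.floor_lt (by positivity)]
  linarith

/-- An edge that winds negatively around the third axis can be replaced by edges that wind
positively, by an isotopy that fixes the rest of the link. -/
theorem exists_replace_edge [Finite ι] (pa : ∀ i, PiecewiseAffine (γ i))
    (per : ∀ i, Function.Periodic (γ i) 1) (tr : ∀ i t, TransRight (γ i) t) (hs : SimpleLoops γ)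
    (hab : a < b) (hb : b < a + 1)
    (hd : ∀ τ ∈ Icc (0 : ℝ) 1, γ i₀ (a + τ * (b - a)) = edgePt (γ i₀ a) d τ)
    (hneg : xyDet (γ i₀ a) d < 0) :
    ∃ γ' : ι → ℝ → Space, (∀ i, PiecewiseAffine (γ' i)) ∧ (∀ i, Function.Periodic (γ' i) 1) ∧
      (∀ s ∈ Icc (0 : ℝ) 1, SimpleLoops fun i t => γ i t + s • (γ' i t - γ i t)) ∧
      (∀ i, i ≠ i₀ → γ' i = γ i) ∧
      (∀ t, b - a ≤ Int.fract (t - a) ∨ Int.fract (t - a) = 0 → γ' i₀ t = γ i₀ t) ∧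
      ∀ t, Int.fract (t - a) < b - a → PosRight (γ' i₀) t := by
  have hba : 0 < b - a := by linarith
  obtain ⟨n, hn, hW⟩ := exists_windows pa per tr hs hab hb hd hneg
  have hn' : (0 : ℝ) < n := by exact_mod_cast hn
  set P := γ i₀ a with hP
  have hQ : γ i₀ b = P + d := by
    have := hd 1 (by simp)
    rw [one_mul, add_sub_cancel] at this
    rw [this, edgePt, one_smul]
  set K := restOf γ i₀ b (a + 1) with hK
  set A : ℕ → Space := fun j => edgePt P d (j / n) with hA
  set A' : ℕ → Space := fun j => edgePt P d ((j + 1) / n) with hA'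
  set m : ℕ → Space := fun j => edgePt P d ((j / n + (j + 1) / n) / 2) with hm
  have hW' : ∀ j : ℕ, ∃ h₀ ρ : ℝ, 0 < ρ ∧ (j < n → ∀ h ε, |h - h₀| < ρ → 0 < ε → ε < ρ →
      ∀ x ∈ K, x ∈ tri (A j) (A' j) (apex (m j) h ε) →
        (j = 0 ∧ x = P) ∨ (j + 1 = n ∧ x = P + d)) := by
    intro j
    by_cases hj : j < n
    · obtain ⟨h₀, ρ, hρ, H⟩ := hW j hj
      exact ⟨h₀, ρ, hρ, fun _ => H⟩
    · exact ⟨0, 1, one_pos, fun h => absurd h hj⟩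
  choose h₀ ρ hρ H using hW'
  obtain ⟨h, hh, hinj⟩ := exists_injOn_near n h₀ ρ hρ
  have ev1 : ∀ᶠ ε in 𝓝[>] (0 : ℝ), ∀ i ∈ Finset.range n, ∀ j ∈ Finset.range n, i < j → ∀ x,
      x ∈ tri (A i) (A' i) (apex (m i) (h i) ε) → x ∈ tri (A j) (A' j) (apex (m j) (h j) ε) →
      j = i + 1 ∧ x = A j := by
    rw [eventually_all_finset]
    intro i hi
    rw [eventually_all_finset]
    intro j hj
    by_cases hij : i < j
    · filter_upwards [eventually_tri_inter hneg hn hij (fun e => hij.ne (hinj i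
        (Finset.mem_range.1 hi) j (Finset.mem_range.1 hj) e))] with ε hε _ using hε
    · exact Eventually.of_forall fun _ h' => absurd h' hij
  have ev2 : ∀ᶠ ε in 𝓝[>] (0 : ℝ), ∀ j ∈ Finset.range n, ε < ρ j := by
    rw [eventually_all_finset]
    intro j _
    exact eventually_nhdsWithin_of_eventually_nhds (gt_mem_nhds (hρ j))
  obtain ⟨ε, ⟨hinter, hερ⟩, hε⟩ := ((ev1.and ev2).and self_mem_nhdsWithin).exists
  have hε : 0 < ε := hε
  set r : ℕ → Space := fun j => apex (m j) (h j) ε with hr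
  have hKtri : ∀ j < n, ∀ x ∈ K, x ∈ tri (A j) (A' j) (r j) →
      (j = 0 ∧ x = P) ∨ (j + 1 = n ∧ x = P + d) := fun j hj =>
    H j hj (h j) ε (hh j) hε (hερ j (Finset.mem_range.2 hj))
  have hTT : ∀ i < n, ∀ j < n, i < j → ∀ x, x ∈ tri (A i) (A' i) (r i) →
      x ∈ tri (A j) (A' j) (r j) → j = i + 1 ∧ x = A j := fun i hi j hj =>
    hinter i (Finset.mem_range.2 hi) j (Finset.mem_range.2 hj)
  set w : ℕ → Space := fun j => r j - m j with hw
  -- a point of the edge with the coordinates `j`, `y`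
  have param : ∀ t, Int.fract (t - a) < b - a → ∃ j < n, ∃ y : ℝ, 0 ≤ y ∧ y < 2 ∧
      2 * n / (b - a) * Int.fract (t - a) = 2 * j + y ∧
      γ i₀ t = edgePt P d ((2 * j + y) / (2 * n)) := by
    intro t ht
    obtain ⟨j, hj, y, hy0, hy2, e⟩ := exists_part hn (Int.fract_nonneg (t - a)) ht
    refine ⟨j, hj, y, hy0, hy2, e, ?_⟩
    have e1 : γ i₀ t = γ i₀ (a + Int.fract (t - a)) := by
      have := (per i₀).sub_int_mul_eq ⌊t - a⌋ (x := t)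
      rw [← this, Int.fract]; congr 1; ring
    rw [e1, ← e]
    have e2 := hd (Int.fract (t - a) / (b - a)) ⟨div_nonneg (Int.fract_nonneg _) hba.le,
      (div_le_one hba).2 ht.le⟩
    rw [div_mul_cancel₀ _ hba.ne'] at e2
    rw [e2]
    congr 1
    field_simp
  have bump : ∀ t, ∀ j < n, ∀ y : ℝ, 0 ≤ y → y < 2 →
      2 * n / (b - a) * Int.fract (t - a) = 2 * j + y → sawBump n w a b t = min y (2 - y) • w j := by
    intro t j hj y hy0 hy2 e
    rw [sawBump, e]
    rcases le_or_gt y 1 with h1 | h1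
    · rw [saw_up w hj (by linarith) (by linarith), min_eq_left (by linarith)]
      congr 1; ring
    · rw [saw_down w hj (by linarith) (by linarith), min_eq_right (by linarith)]
      congr 1; ring
  -- the linear functional `xyDet (m j)` detects the position along the edge
  have gval : ∀ j (y l : ℝ), xyDet (m j) (edgePt P d ((2 * j + y) / (2 * n)) + l • w j) =
      (y - 1) / (2 * n) * xyDet P d := by
    intro j y l
    have e1 : xyDet (m j) (edgePt P d ((2 * j + y) / (2 * n)) + l • w j) =
        xyDet (m j) (edgePt P d ((2 * j + y) / (2 * n))) +
          l * (xyDet (m j) (r j) - xyDet (m j) (m j)) := by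
      simp [xyDet, hw]; ring
    rw [e1, hr]
    simp only
    rw [xyDet_apex, xyDet_self, hm]
    simp only
    rw [xyDet_edgePt]
    field_simp
    ring
  have gA : ∀ j, xyDet (m j) (A j) = -1 / (2 * n) * xyDet P d := by
    intro j
    simp only [hm, hA, xyDet_edgePt]
    field_simp
    ring
  have gA' : ∀ j, xyDet (m j) (A' j) = 1 / (2 * n) * xyDet P d := by
    intro j
    simp only [hm, hA', xyDet_edgePt]
    field_simp
    ring
  have ginj : ∀ y y' : ℝ, (y - 1) / (2 * n) * xyDet P d = (y' - 1) / (2 * n) * xyDet P d →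
      y = y' := by
    intro y y' e
    have := mul_right_cancel₀ hneg.ne e
    rw [div_left_inj' (by positivity)] at this
    linarith
  have hmem : ∀ s ∈ Icc (0 : ℝ) 1, ∀ j (y : ℝ), 0 ≤ y → y < 2 →
      edgePt P d ((2 * j + y) / (2 * n)) + s • (min y (2 - y) • w j) ∈ tri (A j) (A' j) (r j) := by
    intro s hs j y hy0 hy2
    set l := s * min y (2 - y) with hl
    have l0 : 0 ≤ l := mul_nonneg hs.1 (le_min hy0 (by linarith))
    have l1 : l ≤ min y (2 - y) :=
      mul_le_of_le_one_left (le_min hy0 (by linarith)) hs.2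
    have l2 := l1.trans (min_le_left _ _)
    have l3 := l1.trans (min_le_right _ _)
    -- The point is at fraction `y / 2` of the base, moved by `l` times the vector from the midpoint
    -- to the apex. Half of the weight `l` is thus taken from each base vertex, and `l ≤ min y (2 -
    -- y)` keeps the weights nonnegative.
    refine ⟨1 - y / 2 - l / 2, y / 2 - l / 2, l, by linarith, by linarith, l0, by ring, ?_⟩
    rw [smul_smul, ← hl]
    simp only [hw, hA, hA', hm, edgePt]
    match_scalars
    · ring
    · field_simp
      ring
    · ring
  set γ' : ι → ℝ → Space := fun i t => if i = i₀ then γ i t + sawBump n w a b t else γ i t with hγ'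
  have γ'0 : ∀ t, γ' i₀ t = γ i₀ t + sawBump n w a b t := fun t => by simp [hγ']
  have γ'ne : ∀ i, i ≠ i₀ → γ' i = γ i := fun i hi => by funext t; simp [hγ', hi]
  have hline : ∀ (s : ℝ) t, γ i₀ t + s • (γ' i₀ t - γ i₀ t) = γ i₀ t + s • sawBump n w a b t :=
    fun s t => by rw [γ'0, add_sub_cancel_left]
  refine ⟨γ', fun i => ?_, fun i t => ?_, fun s hs' => ?_, γ'ne, fun t ht => ?_, fun t ht => ?_⟩
  · by_cases hi : i = i₀
    · subst hi
      intro t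
      obtain ⟨δ₁, hδ₁, vl, vr, h1⟩ := pa i t
      obtain ⟨δ₂, hδ₂, wl, wr, h2⟩ := piecewiseAffine_sawBump (w := w) hn hab hb t
      refine ⟨min δ₁ δ₂, by positivity, vl + wl, vr + wr, ?_⟩
      have := (h1.mono (min_le_left _ _)).add (h2.mono (min_le_right δ₁ δ₂))
      rwa [show γ' i = fun u => γ i u + sawBump n w a b u from funext γ'0]
    · rw [γ'ne i hi]; exact pa i
  · by_cases hi : i = i₀
    · subst hi
      rw [γ'0, γ'0, per i t, sawBump_periodic]
    · rw [γ'ne i hi]; exact per i t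
  · -- injectivity along the homotopy
    set Γ : ι → ℝ → Space := fun i t => γ i t + s • (γ' i t - γ i t) with hΓ
    have act : ∀ t, Int.fract (t - a) < b - a → ∃ j < n, ∃ y : ℝ, 0 ≤ y ∧ y < 2 ∧
        2 * n / (b - a) * Int.fract (t - a) = 2 * j + y ∧
        Γ i₀ t = edgePt P d ((2 * j + y) / (2 * n)) + s • (min y (2 - y) • w j) := by
      intro t ht
      obtain ⟨j, hj, y, hy0, hy2, e1, e2⟩ := param t ht
      refine ⟨j, hj, y, hy0, hy2, e1, ?_⟩
      simp only [hΓ]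
      rw [hline, e2, bump t j hj y hy0 hy2 e1]
    have inact : ∀ i t, ¬ (i = i₀ ∧ 0 < Int.fract (t - a) ∧ Int.fract (t - a) < b - a) →
        Γ i t = γ i t ∧ γ i t ∈ K := by
      intro i t hit
      by_cases hi : i = i₀
      · subst hi
        have h1 : Int.fract (t - a) = 0 ∨ b - a ≤ Int.fract (t - a) := by
          by_contra hc
          push Not at hc
          exact hit ⟨rfl, lt_of_le_of_ne (Int.fract_nonneg _) hc.1.symm, hc.2⟩
        have e1 : γ i t = γ i (a + Int.fract (t - a)) := by
          have := (per i).sub_int_mul_eq ⌊t - a⌋ (x := t)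
          rw [← this, Int.fract]; congr 1; ring
        have hfl := Int.fract_lt_one (t - a)
        rcases h1 with h1 | h1
        · refine ⟨?_, Or.inr ⟨a + 1, ⟨hb.le, le_rfl⟩, ?_⟩⟩
          · simp only [hΓ]; rw [hline, sawBump_of_zero h1]; simp
          · rw [e1, h1, add_zero, per]
        · refine ⟨?_, Or.inr ⟨a + Int.fract (t - a), ⟨by linarith, by linarith⟩, e1.symm⟩⟩
          simp only [hΓ]; rw [hline, sawBump_of_ge hab h1]; simp
      · refine ⟨?_, Or.inl ?_⟩
        · simp only [hΓ]; rw [γ'ne i hi]; simp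
        · simp only [mem_iUnion]
          exact ⟨i, hi, Int.fract t, ⟨Int.fract_nonneg t, (Int.fract_lt_one t).le⟩,
            (periodic_eq_fract (per i) t).symm⟩
    -- A moving point can meet the fixed part of the link only at an end of the edge. The initial
    -- point has coordinates `j = 0`, `y = 0`, excluded for the interior of the edge; the final
    -- point would need `y = 2`, excluded by `y < 2`.
    have mixed : ∀ i t t', 0 < Int.fract (t - a) → Int.fract (t - a) < b - a →
        ¬ (i = i₀ ∧ 0 < Int.fract (t' - a) ∧ Int.fract (t' - a) < b - a) → Γ i₀ t = Γ i t' → False := by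
      intro i t t' h0 h1 h2 he
      obtain ⟨j, hj, y, hy0, hy2, e1, e2⟩ := act t h1
      obtain ⟨e3, e4⟩ := inact i t' h2
      have hx : Γ i₀ t ∈ K := by rw [he, e3]; exact e4
      have hx' : Γ i₀ t ∈ tri (A j) (A' j) (r j) := by rw [e2]; exact hmem s hs' j y hy0 hy2
      have hg : xyDet (m j) (Γ i₀ t) = (y - 1) / (2 * n) * xyDet P d := by
        rw [e2, smul_smul, gval]
      rcases hKtri j hj _ hx hx' with ⟨hj0, hxP⟩ | ⟨hjn, hxQ⟩
      · have : P = A j := by simp [hA, hj0, edgePt]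
        replace hg := (congrArg (xyDet (m j)) (hxP.trans this)).symm.trans hg
        rw [gA, show (-1 : ℝ) = 0 - 1 by ring] at hg
        have hy := ginj _ _ hg
        rw [← hy, hj0] at e1
        have : 0 < 2 * n / (b - a) * Int.fract (t - a) := by positivity
        rw [e1] at this
        simp at this
      · have : P + d = A' j := by
          have : ((j : ℝ) + 1) = n := by exact_mod_cast hjn
          simp only [hA', this, div_self hn'.ne', edgePt, one_smul]
        rw [hxQ, this, gA', show (1 : ℝ) / (2 * n) = (2 - 1) / (2 * n) by norm_num] at hg
        have hy := ginj _ _ hg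
        linarith
    intro i i' t t' he
    by_cases hi : i = i₀ ∧ 0 < Int.fract (t - a) ∧ Int.fract (t - a) < b - a
    · by_cases hi' : i' = i₀ ∧ 0 < Int.fract (t' - a) ∧ Int.fract (t' - a) < b - a
      · obtain ⟨rfl, h0, h1⟩ := hi
        obtain ⟨rfl, h0', h1'⟩ := hi'
        refine ⟨rfl, ?_⟩
        obtain ⟨j, hj, y, hy0, hy2, e1, e2⟩ := act t h1
        obtain ⟨j', hj', y', hy0', hy2', e1', e2'⟩ := act t' h1'
        have hx : Γ i' t ∈ tri (A j) (A' j) (r j) := by rw [e2]; exact hmem s hs' j y hy0 hy2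
        have hx' : Γ i' t' ∈ tri (A j') (A' j') (r j') := by
          rw [e2']; exact hmem s hs' j' y' hy0' hy2'
        have hg : xyDet (m j) (Γ i' t) = (y - 1) / (2 * n) * xyDet P d := by
          rw [e2, smul_smul, gval]
        have hg' : xyDet (m j') (Γ i' t') = (y' - 1) / (2 * n) * xyDet P d := by
          rw [e2', smul_smul, gval]
        have AA : ∀ j : ℕ, A (j + 1) = A' j := fun j => by simp [hA, hA']
        have he : Γ i' t = Γ i' t' := he
        -- Different triangles share at most the end vertex of the earlier one, which has the
        -- forbidden coordinate `y = 2`. Within one triangle `xyDet (m j)` determines `y`, because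
        -- it does not see the displacement along `w j`.
        rcases lt_trichotomy j j' with hjj | hjj | hjj
        · exfalso
          obtain ⟨hj1, hxA⟩ := hTT j hj j' hj' hjj _ hx (by rw [he]; exact hx')
          rw [hxA, hj1, AA, gA', show (1 : ℝ) / (2 * n) = (2 - 1) / (2 * n) by norm_num] at hg
          linarith [ginj _ _ hg]
        · subst hjj
          rw [he, hg'] at hg
          have hy := ginj _ _ hg
          rw [hy, ← e1] at e1'
          have hc : (2 * n / (b - a) : ℝ) ≠ 0 := by positivity
          have hf := mul_left_cancel₀ hc e1'
          refine ⟨⌊t' - a⌋ - ⌊t - a⌋, ?_⟩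
          simp only [Int.fract] at hf
          push_cast
          linarith
        · exfalso
          obtain ⟨hj1, hxA⟩ := hTT j' hj' j hj hjj _ hx' (by rw [← he]; exact hx)
          rw [hxA, hj1, AA, gA', show (1 : ℝ) / (2 * n) = (2 - 1) / (2 * n) by norm_num] at hg'
          linarith [ginj _ _ hg']
      · exfalso
        obtain ⟨rfl, h0, h1⟩ := hi
        exact mixed i' t t' h0 h1 hi' he
    · by_cases hi' : i' = i₀ ∧ 0 < Int.fract (t' - a) ∧ Int.fract (t' - a) < b - a
      · exfalso
        obtain ⟨rfl, h0', h1'⟩ := hi'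
        exact mixed i t' t h0' h1' hi he.symm
      · have he : Γ i t = Γ i' t' := he
        rw [(inact i t hi).1, (inact i' t' hi').1] at he
        exact hs _ _ _ _ he
  · rw [γ'0]
    rcases ht with ht | ht
    · rw [sawBump_of_ge hab ht, add_zero]
    · rw [sawBump_of_zero ht, add_zero]
  · -- the new edges wind positively
    obtain ⟨j, hj, y, hy0, hy2, e1, e2⟩ := param t ht
    have cpos : 0 < 2 * n / (b - a) := by positivity
    set c := 2 * n / (b - a) with hc
    set k := ⌊t - a⌋ with hk
    have k1 := Int.floor_le (t - a)
    have fr : Int.fract (t - a) = t - a - k := rfl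
    have near : ∀ u, t ≤ u → c * (u - t) < 2 - y → ∃ y' : ℝ, y' = y + c * (u - t) ∧ y' < 2 ∧
        c * Int.fract (u - a) = 2 * j + y' ∧
        γ i₀ u = edgePt P d ((2 * j + y') / (2 * n)) := by
      intro u hu hcu
      have hj1 : (j : ℝ) + 1 ≤ n := by exact_mod_cast hj
      have hlt : u - a - k < b - a := by
        have h1 : c * (u - a - k) < 2 * n := by
          have : c * (u - a - k) = c * (u - t) + c * Int.fract (t - a) := by rw [fr]; ring
          rw [this, e1]
          linarith
        rw [hc, div_mul_eq_mul_div, div_lt_iff₀ hba] at h1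
        exact lt_of_mul_lt_mul_left h1 (by positivity)
      have hfl : ⌊u - a⌋ = k := Int.floor_eq_iff.2 ⟨by linarith, by linarith⟩
      have fru : Int.fract (u - a) = u - a - k := by rw [Int.fract, hfl]
      have e3 : c * Int.fract (u - a) = 2 * j + (y + c * (u - t)) := by
        rw [fru, ← add_assoc, ← e1, fr]; ring
      refine ⟨_, rfl, by linarith, e3, ?_⟩
      obtain ⟨j', hj', y'', h0, h2, e4, e5⟩ := param u (by rw [fru]; exact hlt)
      rw [e5, ← e4, e3]
    have slope : ∀ u, edgePt P d ((2 * j + (y + c * (u - t))) / (2 * n)) =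
        edgePt P d ((2 * j + y) / (2 * n)) + (u - t) • ((c / (2 * n)) • d) := by
      intro u
      simp only [edgePt]
      match_scalars
      · ring
      · field_simp; ring
    -- For `y < 1` the curve runs from `A j` to the apex, afterwards from the apex to `A' j`. The
    -- winding is the determinant of the two end vertices of the side, up to a positive factor, and
    -- `xyDet_apex` or `apex_xyDet` turns the negative sign of the edge into a positive one.
    rcases lt_or_ge y 1 with hy1 | hy1
    · refine ⟨(1 - y) / c, div_pos (by linarith) cpos, (c / (2 * n)) • d + c • w j, ?_, ?_⟩
      · intro u hu hu'
        have hcu : c * (u - t) < 1 - y := by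
          rw [← sub_lt_iff_lt_add', lt_div_iff₀ cpos] at hu'
          linarith
        obtain ⟨y', hy', hy'2, e3, e4⟩ := near u hu (by linarith)
        have hcu0 : 0 ≤ c * (u - t) := mul_nonneg cpos.le (by linarith)
        rw [γ'0, γ'0, e4, e2, bump u j hj y' (by linarith) hy'2 e3, bump t j hj y hy0 hy2 e1,
          min_eq_left (by linarith), min_eq_left (by linarith), hy', slope]
        module
      · rw [γ'0, e2, bump t j hj y hy0 hy2 e1, min_eq_left (by linarith)]
        have v1 : (c / (2 * n)) • d + c • w j = c • (r j - A j) := by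
          simp only [hw, hm, hA, edgePt]
          match_scalars
          · field_simp; ring
          · ring
          · ring
        have v2 : edgePt P d ((2 * j + y) / (2 * n)) + y • w j = A j + y • (r j - A j) := by
          simp only [hw, hm, hA, edgePt]
          match_scalars
          · ring
          · field_simp; ring
          · ring
        rw [v1, v2]
        have : xyDet (A j + y • (r j - A j)) (c • (r j - A j)) = c * xyDet (A j) (r j) := by
          simp [xyDet]; ring
        rw [this]
        refine mul_pos cpos ?_
        simp only [hr]
        rw [xyDet_apex, xyDet_swap, gA]
        have : 0 < ε * (1 / (2 * n)) := by positivity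
        have e : -(ε * -(-1 / (2 * ↑n) * xyDet P d)) = (ε * (1 / (2 * n))) * (-xyDet P d) := by ring
        rw [e]
        exact mul_pos this (by linarith)
    · refine ⟨(2 - y) / c, div_pos (by linarith) cpos, (c / (2 * n)) • d - c • w j, ?_, ?_⟩
      · intro u hu hu'
        have hcu : c * (u - t) < 2 - y := by
          rw [← sub_lt_iff_lt_add', lt_div_iff₀ cpos] at hu'
          linarith
        obtain ⟨y', hy', hy'2, e3, e4⟩ := near u hu hcu
        have hcu0 : 0 ≤ c * (u - t) := mul_nonneg cpos.le (by linarith)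
        rw [γ'0, γ'0, e4, e2, bump u j hj y' (by linarith) hy'2 e3, bump t j hj y hy0 hy2 e1,
          min_eq_right (by linarith), min_eq_right (by linarith), hy', slope]
        module
      · rw [γ'0, e2, bump t j hj y hy0 hy2 e1, min_eq_right (by linarith)]
        have v1 : (c / (2 * n)) • d - c • w j = c • (A' j - r j) := by
          simp only [hw, hm, hA', edgePt]
          match_scalars
          · field_simp; ring
          · ring
          · ring
        have v2 : edgePt P d ((2 * j + y) / (2 * n)) + (2 - y) • w j =
            A' j - (2 - y) • (A' j - r j) := by
          simp only [hw, hm, hA', edgePt]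
          match_scalars
          · ring
          · field_simp; ring
          · ring
        rw [v1, v2]
        have : xyDet (A' j - (2 - y) • (A' j - r j)) (c • (A' j - r j)) = c * xyDet (r j) (A' j) := by
          simp [xyDet]; ring
        rw [this]
        refine mul_pos cpos ?_
        simp only [hr]
        rw [apex_xyDet, gA']
        have : 0 < ε * (1 / (2 * n)) := by positivity
        have e : -(ε * (1 / (2 * ↑n) * xyDet P d)) = (ε * (1 / (2 * n))) * (-xyDet P d) := by ring
        rw [e]
        exact mul_pos this (by linarith)

end Step

/-! ### Elimination of the negative edges -/

section Induction

variable {ι : Type*}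

/-- A polygonal link that winds positively around the third axis except along the edges
`[a, a + h]`, `(i, a) ∈ B`, where it winds negatively. -/
structure PositiveOff (h : ℝ) (γ : ι → ℝ → Space) (B : Finset (ι × ℝ)) : Prop where
  affine : ∀ i, PiecewiseAffine (γ i)
  periodic : ∀ i, Function.Periodic (γ i) 1
  simple : SimpleLoops γ
  pos : ∀ i t, PosRight (γ i) t ∨ ∃ a, (i, a) ∈ B ∧ Int.fract (t - a) < h
  neg : ∀ i a, (i, a) ∈ B → ∃ d, xyDet (γ i a) d < 0 ∧
    ∀ τ ∈ Icc (0 : ℝ) 1, γ i (a + τ * h) = edgePt (γ i a) d τ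
  sep : ∀ i a a', (i, a) ∈ B → (i, a') ∈ B → a ≠ a' → ∀ τ ∈ Icc (0 : ℝ) 1,
    h ≤ Int.fract (a' + τ * h - a) ∨ Int.fract (a' + τ * h - a) = 0

/-- The negative edges, too, are transverse to the half planes bounded by the axis, so the
countability argument applies to the whole link at every stage. -/
theorem transRight_of_edge {f : ℝ → Space} (hf : Function.Periodic f 1) {h a : ℝ} {d : Space}
    (hh : 0 < h) (hneg : xyDet (f a) d < 0)
    (hd : ∀ τ ∈ Icc (0 : ℝ) 1, f (a + τ * h) = edgePt (f a) d τ) {t : ℝ}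
    (ht : Int.fract (t - a) < h) : TransRight f t := by
  have key : ∀ u, t ≤ u → u < t + (h - Int.fract (t - a)) →
      f u = edgePt (f a) d ((u - a - ⌊t - a⌋) / h) := by
    intro u h1 h2
    rw [Int.fract] at h2
    have h3 := Int.floor_le (t - a)
    rw [← hd _ ⟨div_nonneg (by linarith) hh.le, (div_le_one hh).2 (by linarith)⟩,
      div_mul_cancel₀ _ hh.ne', ← hf.sub_int_mul_eq ⌊t - a⌋]
    congr 1; ring
  refine ⟨h - Int.fract (t - a), by linarith, h⁻¹ • d, fun u h1 h2 => ?_, ?_⟩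
  · rw [key u h1 h2, key t le_rfl (by linarith)]
    simp only [edgePt]
    match_scalars
    · ring
    · field_simp; ring
  · rw [key t le_rfl (by linarith)]
    have : xyDet (edgePt (f a) d ((t - a - ⌊t - a⌋) / h)) (h⁻¹ • d) = h⁻¹ * xyDet (f a) d := by
      simp [xyDet, edgePt]; ring
    rw [this]
    exact mul_ne_zero (by positivity) hneg.ne

theorem PosRight.congr {f g : ℝ → Space} {t δ : ℝ} (hf : PosRight f t) (hδ : 0 < δ)
    (h : ∀ u, t ≤ u → u < t + δ → g u = f u) : PosRight g t := by
  obtain ⟨ρ, hρ, v, h1, h2⟩ := hf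
  refine ⟨min ρ δ, lt_min hρ hδ, v, fun u hu hu' => ?_, ?_⟩
  · have a1 := min_le_left ρ δ
    have a2 := min_le_right ρ δ
    rw [h u hu (by linarith), h t le_rfl (by linarith), h1 u hu (by linarith)]
  · rwa [h t le_rfl (by linarith)]

/-- `exists_replace_edge` creates only positive edges over the chosen interval. By `sep` the other
negative edges lie where the curve is unchanged, so they keep their description. -/
theorem PositiveOff.exists_erase [Finite ι] [DecidableEq ι] {h : ℝ} (hh : 0 < h) (hh1 : h < 1)
    {γ : ι → ℝ → Space} {B : Finset (ι × ℝ)} (H : PositiveOff h γ B) {i₀ : ι} {a : ℝ}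
    (hB : (i₀, a) ∈ B) :
    ∃ γ', PositiveOff h γ' (B.erase (i₀, a)) ∧
      ∀ s ∈ Icc (0 : ℝ) 1, SimpleLoops fun i t => γ i t + s • (γ' i t - γ i t) := by
  have tr : ∀ i t, TransRight (γ i) t := by
    intro i t
    rcases H.pos i t with hp | ⟨a', ha', ht⟩
    · exact hp.transRight
    · obtain ⟨d, hneg, hd⟩ := H.neg i a' ha'
      exact transRight_of_edge (H.periodic i) hh hneg hd ht
  obtain ⟨d, hneg, hd⟩ := H.neg i₀ a hB
  obtain ⟨γ', pa', per', hs', hne, heq, hpos⟩ := exists_replace_edge (b := a + h) H.affine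
    H.periodic tr H.simple (by linarith) (by linarith) (by simpa using hd) hneg
  rw [add_sub_cancel_left] at heq hpos
  refine ⟨γ', ⟨pa', per', ?_, fun i t => ?_, fun i a' ha' => ?_, fun i a₁ a₂ h1 h2 => ?_⟩, hs'⟩
  · have := hs' 1 (by simp)
    simpa using this
  · by_cases hi : i = i₀
    · subst hi
      rcases lt_or_ge (Int.fract (t - a)) h with hlt | hge
      · exact Or.inl (hpos t hlt)
      · rcases H.pos i t with hp | ⟨a', ha', ht⟩
        · left
          have h1 := Int.fract_lt_one (t - a)
          refine hp.congr (sub_pos.2 h1) fun u h2 h3 => heq u (Or.inl ?_)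
          have h4 := Int.floor_le (t - a)
          rw [Int.fract] at h3 hge
          have : ⌊u - a⌋ = ⌊t - a⌋ := Int.floor_eq_iff.2 ⟨by linarith, by linarith⟩
          rw [Int.fract, this]
          linarith
        · refine Or.inr ⟨a', Finset.mem_erase.2 ⟨fun e => ?_, ha'⟩, ht⟩
          rw [Prod.mk.injEq] at e
          rw [e.2] at ht
          linarith
    · rw [hne i hi]
      rcases H.pos i t with hp | ⟨a', ha', ht⟩
      · exact Or.inl hp
      · exact Or.inr ⟨a', Finset.mem_erase.2 ⟨fun e => hi (Prod.mk.inj e).1, ha'⟩, ht⟩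
  · obtain ⟨h1, h2⟩ := Finset.mem_erase.1 ha'
    obtain ⟨d', hneg', hd'⟩ := H.neg i a' h2
    by_cases hi : i = i₀
    · subst hi
      have hsame : ∀ τ ∈ Icc (0 : ℝ) 1, γ' i (a' + τ * h) = γ i (a' + τ * h) := fun τ hτ =>
        heq _ (H.sep i a a' hB h2 (fun e => h1 (by rw [e])) τ hτ)
      have h0 := hsame 0 (by simp)
      rw [zero_mul, add_zero] at h0
      rw [h0]
      exact ⟨d', hneg', fun τ hτ => (hsame τ hτ).trans (hd' τ hτ)⟩
    · rw [hne i hi]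
      exact ⟨d', hneg', hd'⟩
  · exact H.sep i a₁ a₂ (Finset.mem_of_mem_erase h1) (Finset.mem_of_mem_erase h2)

/-- The link `L` is isotopic to smoothings of the polygonal link `γ`. -/
def FramedLink.Smooths (L : FramedLink ι) (γ : ι → ℝ → Space) : Prop :=
  ∀ᶠ ε in 𝓝[>] (0 : ℝ), ∃ M : FramedLink ι, (∀ i, M.curve i = mol ε (γ i)) ∧ L.Isotopic M

/-- For small `ε` the mollified line is a line of simple immersed curves from the mollification of
`γ` to that of `γ'`, and the framing is carried along it. Working with all small `ε` allows the
scale to shrink at each step of the induction. -/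
theorem FramedLink.Smooths.of_line [Finite ι] {L : FramedLink ι} {γ γ' : ι → ℝ → Space}
    (hL : L.Smooths γ) (p₀ : ∀ i, Function.Periodic (γ i) 1)
    (p₁ : ∀ i, Function.Periodic (γ' i) 1) (a₀ : ∀ i, PiecewiseAffine (γ i))
    (a₁ : ∀ i, PiecewiseAffine (γ' i))
    (hs : ∀ s ∈ Icc (0 : ℝ) 1, SimpleLoops fun i t => γ i t + s • (γ' i t - γ i t)) :
    L.Smooths γ' := by
  filter_upwards [hL, eventually_simple_mol_line p₀ p₁ a₀ a₁ hs, self_mem_nhdsWithin] with ε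
    ⟨M, hM, hLM⟩ hε (hε0 : 0 < ε)
  obtain ⟨M', hM', hMM'⟩ := M.exists_isotopic_of_line (fun i => mol ε (γ' i))
    (fun i => contDiff_mol (a₁ i).continuous hε0) (fun i => mol_periodic (p₁ i) ε)
    (by simpa only [hM] using fun s hs => (hε s hs).1)
    (by simpa only [hM] using fun s hs => (hε s hs).2)
  exact ⟨M', hM', hLM.trans hMM'⟩

theorem PositiveOff.exists_smooths [Finite ι] {h : ℝ} (hh : 0 < h) (hh1 : h < 1)
    {L : FramedLink ι} {n : ℕ} : ∀ {γ : ι → ℝ → Space} {B : Finset (ι × ℝ)}, B.card = n →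
    PositiveOff h γ B → L.Smooths γ → ∃ γ', PositiveOff h γ' ∅ ∧ L.Smooths γ' := by
  classical
  induction n with
  | zero =>
    intro γ B hB H hL
    rw [Finset.card_eq_zero.1 hB] at H
    exact ⟨γ, H, hL⟩
  | succ n ih =>
    intro γ B hB H hL
    obtain ⟨⟨i₀, a⟩, hp⟩ := Finset.card_pos.1 (by omega : 0 < B.card)
    obtain ⟨γ', H', hs⟩ := H.exists_erase hh hh1 hp
    exact ih (by rw [Finset.card_erase_of_mem hp]; omega) H'
      (hL.of_line H.periodic H'.periodic H.affine H'.affine hs)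

/-- An edge of a polygon, as an affine map of the parameter. -/
theorem pl_edge (q : ℤ → Space) {N : ℕ} (hN : 0 < N) (k : ℤ) {τ : ℝ} (hτ : τ ∈ Icc (0 : ℝ) 1) :
    pl q (N * (k / N + τ * (1 / N))) = edgePt (pl q (N * (k / N))) (q (k + 1) - q k) τ := by
  have hN' : (0 : ℝ) < N := by exact_mod_cast hN
  have e1 : (N : ℝ) * (k / N + τ * (1 / N)) = k + τ := by field_simp
  have e2 : (N : ℝ) * (k / N) = k := by field_simp
  rw [e1, e2, pl_eq q k (by linarith [hτ.1]) (by linarith [hτ.2]), pl_eq q k le_rfl (by linarith),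
    edgePt]
  module

/-- General position gives every edge a definite sign; the negative ones are listed by their initial
vertices in one period, which makes the list finite. -/
theorem exists_positiveOff [Finite ι] {N : ℕ} (hN : 2 ≤ N) {q : ι → ℤ → Space}
    (hq : ∀ i k, q i (k + N) = q i k) (hdet : ∀ i k, xyDet (q i k) (q i (k + 1)) ≠ 0)
    (hs : SimpleLoops fun i t => pl (q i) (N * t)) :
    ∃ B, PositiveOff (1 / N : ℝ) (fun i t => pl (q i) (N * t)) B := by
  classical
  have hN' : (0 : ℝ) < N := by exact_mod_cast (by omega : 0 < N)
  have := Fintype.ofFinite ι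
  set B : Finset (ι × ℝ) := ((Finset.univ ×ˢ Finset.range N).filter fun p : ι × ℕ =>
    xyDet (q p.1 p.2) (q p.1 (p.2 + 1)) < 0).image fun p => (p.1, ((p.2 : ℤ) : ℝ) / N) with hB
  have memB : ∀ i a, (i, a) ∈ B ↔
      ∃ k : ℕ, k < N ∧ xyDet (q i k) (q i (k + 1)) < 0 ∧ ((k : ℤ) : ℝ) / N = a := by
    intro i a
    simp only [hB, Finset.mem_image, Finset.mem_filter, Finset.mem_product, Finset.mem_univ,
      Finset.mem_range, true_and, Prod.exists, Prod.mk.injEq]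
    constructor
    · rintro ⟨_, k, ⟨h1, h2⟩, rfl, h3⟩
      exact ⟨k, h1, h2, h3⟩
    · rintro ⟨k, h1, h2, h3⟩
      exact ⟨i, k, ⟨h1, h2⟩, rfl, h3⟩
  have per := fun i => pl_periodic (hq i)
  have dsub : ∀ p v : Space, xyDet p (v - p) = xyDet p v := fun p v => by simp [xyDet]; ring
  have q0 : ∀ i (k : ℤ), pl (q i) (N * (k / N)) = q i k := fun i k => by
    have e2 : (N : ℝ) * (k / N) = k := by field_simp
    rw [e2, pl_eq (q i) k le_rfl (by linarith)]; simp
  refine ⟨B, ⟨fun i => piecewiseAffine_pl (q i) hN', per, hs, fun i t => ?_, fun i a ha => ?_,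
    fun i a a' ha ha' hne τ hτ => ?_⟩⟩
  · set k := ⌊N * t⌋ with hk
    have k1 := Int.floor_le (N * t)
    have k2 := Int.lt_floor_add_one (N * t)
    rw [← hk] at k1 k2
    have hNz : (0 : ℤ) < N := by exact_mod_cast (by omega : 0 < N)
    rcases (hdet i k).lt_or_gt with hlt | hgt
    · right
      obtain ⟨m, hm⟩ := Int.eq_ofNat_of_zero_le (Int.emod_nonneg k hNz.ne')
      have hmN : (m : ℤ) < N := hm ▸ Int.emod_lt_of_pos k hNz
      have hkm : k = m + k / N * N := by rw [← hm]; have := Int.emod_add_mul_ediv k N; linarith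
      have hqm : ∀ j, q i (j + k / N * N) = q i j := fun j => by
        have : Function.Periodic (q i) (N : ℤ) := hq i
        simpa using this.int_mul (k / N) j
      have e1 : q i k = q i m := by rw [hkm]; exact hqm m
      have e2 : q i (k + 1) = q i (m + 1) := by
        rw [hkm, add_right_comm]; exact hqm (m + 1)
      refine ⟨((m : ℤ) : ℝ) / N, (memB _ _).2 ⟨m, by exact_mod_cast hmN, by rwa [← e1, ← e2], rfl⟩,
        ?_⟩
      have hkr : (k : ℝ) = m + (k / N : ℤ) * N := by exact_mod_cast hkm
      have e3 : t - ((m : ℤ) : ℝ) / N = (N * t - k) / N + (k / N : ℤ) := by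
        rw [hkr]; field_simp; push_cast; ring
      have h0 : 0 ≤ (N * t - k) / N := div_nonneg (by linarith) hN'.le
      have h1 : (N * t - k) / N < 1 / N := by gcongr; linarith
      have h2 : (1 : ℝ) / N ≤ 1 := by
        rw [div_le_one hN']; exact_mod_cast (by omega : 1 ≤ N)
      rw [e3, Int.fract_add_intCast, Int.fract_eq_self.2 ⟨h0, h1.trans_le h2⟩]
      exact h1
    · left
      refine ⟨(k + 1 - N * t) / N, div_pos (by linarith) hN', (N : ℝ) • (q i (k + 1) - q i k),
        fun u h1 h2 => ?_, ?_⟩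
      · refine pl_right (q i) hN' h1 ?_
        rw [← sub_lt_iff_lt_add', lt_div_iff₀ hN'] at h2
        linarith
      · beta_reduce
        rw [pl_eq (q i) k k1 k2.le]
        have : xyDet (q i k + (N * t - k) • (q i (k + 1) - q i k)) ((N : ℝ) • (q i (k + 1) - q i k))
            = N * xyDet (q i k) (q i (k + 1)) := by
          simp [xyDet]; ring
        rw [this]
        positivity
  · obtain ⟨k, -, h2, rfl⟩ := (memB i a).1 ha
    refine ⟨q i (k + 1) - q i k, ?_, fun τ hτ => pl_edge (q i) (by omega) k hτ⟩
    rw [q0, dsub]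
    exact h2
  · obtain ⟨k, hk, -, rfl⟩ := (memB i a).1 ha
    obtain ⟨k', hk', -, rfl⟩ := (memB i a').1 ha'
    have hkk : k ≠ k' := fun e => hne (by rw [e])
    -- Edges `m` steps apart modulo `N`, with `1 ≤ m ≤ N - 1`. The value `m + τ = N` is the initial
    -- vertex of the first edge, reached from behind; this is why `sep` admits the fractional part
    -- zero.
    have key : ∀ m : ℤ, 1 ≤ m → m + 1 ≤ N → 1 / N ≤ Int.fract ((m + τ) / (N : ℝ)) ∨
        Int.fract ((m + τ) / (N : ℝ)) = 0 := by
      intro m h1 h2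
      have h1' : (1 : ℝ) ≤ m := by exact_mod_cast h1
      have h2' : (m : ℝ) + 1 ≤ N := by exact_mod_cast h2
      have h3 : (m + τ) / (N : ℝ) ≤ 1 := (div_le_one hN').2 (by linarith [hτ.2])
      rcases h3.lt_or_eq with h4 | h4
      · left
        rw [Int.fract_eq_self.2 ⟨div_nonneg (by linarith [hτ.1]) hN'.le, h4⟩]
        gcongr
        linarith [hτ.1]
      · right; rw [h4, Int.fract_one]
    rcases lt_or_gt_of_ne hkk with hlt | hgt
    · have := key (k' - k) (by omega) (by omega)
      convert this using 3 <;> (push_cast; field_simp; ring_nf)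
    · have := key (k' - k + N) (by omega) (by omega)
      have e : ((k' : ℤ) : ℝ) / N + τ * (1 / N) - ((k : ℤ) : ℝ) / N =
          (((k' - k + N : ℤ) : ℝ) + τ) / N - 1 := by
        push_cast; field_simp; ring
      rw [e, Int.fract_sub_one]
      exact this

/-- Every framed link is isotopic to one that winds positively around the third axis. -/
theorem FramedLink.exists_winding_pos [Finite ι] (L : FramedLink ι) :
    ∃ M : FramedLink ι, L.Isotopic M ∧ ∀ i t, 0 < xyDet (M.curve i t) (deriv (M.curve i) t) := by
  obtain ⟨N, q, hN, hq, hdet, hs, hL⟩ := L.exists_polygon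
  obtain ⟨B, hB⟩ := exists_positiveOff hN hq hdet hs
  have hN' : (1 : ℝ) < N := by exact_mod_cast (by omega : 1 < N)
  obtain ⟨γ, H, hγ⟩ := hB.exists_smooths (by positivity) ((div_lt_one (by linarith)).2 hN') rfl hL
  have pos : ∀ i t, PosRight (γ i) t := fun i t => (H.pos i t).resolve_right (by simp)
  obtain ⟨ε, ⟨M, hM, hLM⟩, hε⟩ :=
    (hγ.and (eventually_xyDet_mol_pos H.periodic H.affine pos)).exists
  exact ⟨M, hLM, by simpa only [hM] using hε⟩

end Induction

/-! ### Smooth logarithms and cylindrical coordinates -/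

section Lift

/-- A smooth nonvanishing complex function has a smooth logarithm. -/
theorem exists_smooth_log {z : ℝ → ℂ} (hz : ContDiff ℝ ∞ z) (h0 : ∀ t, z t ≠ 0) :
    ∃ g : ℝ → ℂ, ContDiff ℝ ∞ g ∧ ∀ t, Complex.exp (g t) = z t := by
  set w : ℝ → ℂ := fun t => deriv z t / z t with hw
  have cw : ContDiff ℝ ∞ w := by
    simp only [hw, div_eq_mul_inv]
    exact (contDiff_infty_iff_deriv.1 hz).2.mul (hz.inv h0)
  -- A primitive of the logarithmic derivative; the derivative of `z * exp (-g)` vanishes, so this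
  -- product is identically one.
  set g : ℝ → ℂ := fun t => Complex.log (z 0) + ∫ u in (0 : ℝ)..t, w u with hg
  have dg : ∀ t, HasDerivAt g (w t) t := fun t =>
    (cw.continuous.integral_hasStrictDerivAt 0 t).hasDerivAt.const_add _
  refine ⟨g, contDiff_infty_iff_deriv.2 ⟨fun t => (dg t).differentiableAt, ?_⟩, fun t => ?_⟩
  · rwa [show deriv g = w from funext fun t => (dg t).deriv]
  · have key : ∀ t, HasDerivAt (fun t => z t * Complex.exp (-g t)) 0 t := fun t => by
      have hd := ((hz.differentiable (by simp) t).hasDerivAt).mul (dg t).neg.cexp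
      have e : deriv z t * Complex.exp (-g t) + z t * (Complex.exp (-g t) * -w t) = 0 := by
        have : z t * w t = deriv z t := mul_div_cancel₀ _ (h0 t)
        rw [← this]; ring
      exact e ▸ hd
    have := is_const_of_deriv_eq_zero (fun t => (key t).differentiableAt) (fun t => (key t).deriv) t 0
    have e0 : z 0 * Complex.exp (-g 0) = 1 := by
      simp only [hg, intervalIntegral.integral_same, add_zero, Complex.exp_neg,
        Complex.exp_log (h0 0)]
      exact mul_inv_cancel₀ (h0 0)
    rw [e0, Complex.exp_neg, ← div_eq_mul_inv, div_eq_one_iff_eq (Complex.exp_ne_zero _)] at this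
    exact this.symm

/-- The difference `g (t + T) - g t` has exponential one, hence zero derivative, so it is a constant
multiple of `2 π i`. -/
theorem exists_shift_log {g : ℝ → ℂ} (hg : ContDiff ℝ ∞ g) {T : ℝ}
    (hp : Function.Periodic (fun t => Complex.exp (g t)) T) :
    ∃ m : ℤ, ∀ t, g (t + T) = g t + m * (2 * Real.pi * Complex.I) := by
  set h : ℝ → ℂ := fun t => g (t + T) - g t with hh
  have dg : Differentiable ℝ g := hg.differentiable (by simp)
  have dh : Differentiable ℝ h := by
    have : Differentiable ℝ fun t => g (t + T) := dg.comp (by fun_prop)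
    exact this.sub dg
  have e1 : ∀ t, Complex.exp (h t) = 1 := fun t => by
    simp only [hh, Complex.exp_sub]
    rw [div_eq_one_iff_eq (Complex.exp_ne_zero _)]
    exact hp t
  have dz : ∀ t, deriv h t = 0 := fun t => by
    have h1 := (dh t).hasDerivAt.cexp
    rw [e1, one_mul] at h1
    have h2 : HasDerivAt (fun t => Complex.exp (h t)) 0 t := by
      simp only [e1]; exact hasDerivAt_const _ _
    exact h1.unique h2
  obtain ⟨m, hm⟩ := Complex.exp_eq_one_iff.1 (e1 0)
  refine ⟨m, fun t => ?_⟩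
  have := is_const_of_deriv_eq_zero dh dz t 0
  rw [hm] at this
  rw [← this]
  simp [hh]

/-- The logarithm of the horizontal projection has real part `r` and imaginary part `2 π α`. In
these coordinates `xyDet` of position and velocity is `2 π exp (2 r) α'`, so positive winding means
that `α` increases; its shift over one period is therefore a positive integer. -/
theorem exists_cylindrical {f : ℝ → Space} (hf : ContDiff ℝ ∞ f) (pf : Function.Periodic f 1)
    (pos : ∀ t, 0 < xyDet (f t) (deriv f t)) :
    ∃ r α : ℝ → ℝ, ContDiff ℝ ∞ r ∧ ContDiff ℝ ∞ α ∧ Function.Periodic r 1 ∧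
      (∀ t, 0 < deriv α t) ∧ (∃ ℓ : ℕ, 0 < ℓ ∧ ∀ t, α (t + 1) = α t + ℓ) ∧
      (∀ t, f t 0 = Real.exp (r t) * Real.cos (2 * Real.pi * α t)) ∧
      ∀ t, f t 1 = Real.exp (r t) * Real.sin (2 * Real.pi * α t) := by
  have hc := fun i => (contDiff_euclidean.1 hf) i
  have hd := fun t => hasDerivAt_space_iff.1 (hf.differentiable (by simp) t).hasDerivAt
  set z : ℝ → ℂ := fun t => ((f t 0 : ℝ) : ℂ) + ((f t 1 : ℝ) : ℂ) * Complex.I with hz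
  have cz : ContDiff ℝ ∞ z :=
    (Complex.ofRealCLM.contDiff.comp (hc 0)).add
      ((Complex.ofRealCLM.contDiff.comp (hc 1)).mul contDiff_const)
  have zre : ∀ t, (z t).re = f t 0 := fun t => by simp [hz]
  have zim : ∀ t, (z t).im = f t 1 := fun t => by simp [hz]
  have z0 : ∀ t, z t ≠ 0 := fun t h => by
    have h1 := zre t
    have h2 := zim t
    rw [h] at h1 h2
    have := pos t
    rw [xyDet, ← h1, ← h2] at this
    simp at this
  obtain ⟨g, cg, eg⟩ := exists_smooth_log cz z0
  have pz : Function.Periodic (fun t => Complex.exp (g t)) 1 := fun t => by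
    simp only [eg, hz, pf t]
  obtain ⟨m, hm⟩ := exists_shift_log cg pz
  have π2 : (0 : ℝ) < 2 * Real.pi := by positivity
  set r : ℝ → ℝ := fun t => (g t).re with hr
  set α : ℝ → ℝ := fun t => (g t).im / (2 * Real.pi) with hα
  have cr : ContDiff ℝ ∞ r := Complex.reCLM.contDiff.comp cg
  have cα : ContDiff ℝ ∞ α := (Complex.imCLM.contDiff.comp cg).div_const _
  have e2 : ∀ t, 2 * Real.pi * α t = (g t).im := fun t => by simp only [hα]; field_simp
  have f0 : ∀ t, f t 0 = Real.exp (r t) * Real.cos (2 * Real.pi * α t) := fun t => by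
    rw [e2, ← zre, ← eg, Complex.exp_re]
  have f1 : ∀ t, f t 1 = Real.exp (r t) * Real.sin (2 * Real.pi * α t) := fun t => by
    rw [e2, ← zim, ← eg, Complex.exp_im]
  have dα : ∀ t, 0 < deriv α t := fun t => by
    have d1 := (cr.differentiable (by simp) t).hasDerivAt.exp
    have d2 := ((cα.differentiable (by simp) t).hasDerivAt).const_mul (2 * Real.pi)
    have h0 := (hd t 0).unique
      ((d1.mul d2.cos).congr_of_eventuallyEq (Eventually.of_forall fun u => f0 u))
    have h1 := (hd t 1).unique
      ((d1.mul d2.sin).congr_of_eventuallyEq (Eventually.of_forall fun u => f1 u))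
    have hp := pos t
    rw [xyDet, f0, f1, h0, h1] at hp
    have hE := Real.exp_pos (r t)
    have hcs := Real.sin_sq_add_cos_sq (2 * Real.pi * α t)
    set C := Real.cos (2 * Real.pi * α t)
    set S := Real.sin (2 * Real.pi * α t)
    have : 0 < Real.exp (r t) ^ 2 * (2 * Real.pi) * deriv α t := by
      refine hp.trans_eq ?_
      linear_combination Real.exp (r t) ^ 2 * (2 * Real.pi) * deriv α t * hcs
    exact pos_of_mul_pos_right this (by positivity)
  have sh : ∀ t, α (t + 1) = α t + m := fun t => by
    simp only [hα, hm t]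
    simp
    field_simp
  have mpos : 0 < m := by
    have := strictMono_of_deriv_pos dα (show (0 : ℝ) < 0 + 1 by norm_num)
    rw [sh] at this
    have : (0 : ℝ) < m := by linarith
    exact_mod_cast this
  refine ⟨r, α, cr, cα, fun t => ?_, dα, ⟨m.toNat, by omega, fun t => ?_⟩, f0, f1⟩
  · simp [hr, hm t]
  · rw [sh]
    congr 1
    exact_mod_cast (Int.toNat_of_nonneg mpos.le).symm

/-- The shift relation makes `α` unbounded in both directions, so it is an increasing bijection with
nonvanishing derivative. Its inverse reparametrizes a component by the angle. -/
theorem exists_smooth_inverse {α : ℝ → ℝ} (hα : ContDiff ℝ ∞ α) (dα : ∀ t, 0 < deriv α t) {ℓ : ℕ}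
    (hℓ : 0 < ℓ) (sh : ∀ t, α (t + 1) = α t + ℓ) :
    ∃ β : ℝ → ℝ, ContDiff ℝ ∞ β ∧ (∀ θ, α (β θ) = θ) ∧ (∀ θ, β (θ + ℓ) = β θ + 1) ∧
      ∀ θ, 0 < deriv β θ := by
  have mono := strictMono_of_deriv_pos dα
  have hℓ' : (0 : ℝ) < ℓ := by exact_mod_cast hℓ
  have shn : ∀ n : ℕ, α n = α 0 + n * ℓ ∧ α (-n) = α 0 - n * ℓ := by
    intro n
    induction n with
    | zero => simp
    | succ n ih =>
      constructor
      · push_cast; rw [sh, ih.1]; ring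
      · have := sh (-(n + 1))
        rw [show (-((n : ℝ) + 1) + 1) = -n by ring, ih.2] at this
        push_cast
        linarith
  have surj : Function.Surjective α := by
    intro y
    obtain ⟨n, hn⟩ := exists_nat_ge (|y - α 0|)
    have h1 : (n : ℝ) ≤ n * ℓ := le_mul_of_one_le_right (by positivity) (by exact_mod_cast hℓ)
    have h2 := abs_le.1 hn
    have : y ∈ Icc (α (-n)) (α n) := by
      rw [(shn n).1, (shn n).2]; exact ⟨by linarith, by linarith⟩
    obtain ⟨x, -, hx⟩ := intermediate_value_Icc (by linarith [(n.cast_nonneg : (0 : ℝ) ≤ n)])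
      hα.continuous.continuousOn this
    exact ⟨x, hx⟩
  set e := (mono.orderIsoOfSurjective α surj).toHomeomorph with he
  have ea : ∀ t, e t = α t := fun t => rfl
  have cβ : ContDiff ℝ ∞ e.symm := e.contDiff_symm_deriv (f' := deriv α) (fun t => (dα t).ne')
    (fun t => (hα.differentiable (by simp) t).hasDerivAt) hα
  have inv : ∀ θ, α (e.symm θ) = θ := fun θ => e.apply_symm_apply θ
  refine ⟨e.symm, cβ, inv, fun θ => mono.injective ?_, fun θ => ?_⟩
  · rw [inv, sh, inv]
  · have h1 := (hα.differentiable (by simp) (e.symm θ)).hasDerivAt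
    have h2 := (cβ.differentiable (by simp) θ).hasDerivAt
    have h3 := h1.comp θ h2
    have h4 : HasDerivAt (α ∘ e.symm) 1 θ := by
      rw [show α ∘ e.symm = id from funext inv]; exact hasDerivAt_id θ
    have h5 := h3.unique h4
    have := dα (e.symm θ)
    exact pos_of_mul_pos_right (h5.symm ▸ one_pos) this.le

end Lift

/-! ### Closed braids and their isotopies -/

section ClosedBraid

variable {ι : Type*} {ℓ : ι → ℕ} {q f : ι → ℝ → ℝ × ℝ}

/-- A closed framed braid around the third axis, in the coordinates of `bend`: the `i`-th component
winds `ℓ i` times around the axis and is at the position `q i θ` at the angle `2 π θ`, with the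
horizontal framing `f i θ`. -/
structure ClosedBraid (ℓ : ι → ℕ) (q f : ι → ℝ → ℝ × ℝ) : Prop where
  pos : ∀ i, 0 < ℓ i
  contDiff_core : ∀ i, ContDiff ℝ ∞ (q i)
  contDiff_field : ∀ i, ContDiff ℝ ∞ (f i)
  periodic_core : ∀ i, Function.Periodic (q i) (ℓ i)
  periodic_field : ∀ i, Function.Periodic (f i) (ℓ i)
  ne_zero : ∀ i t, f i t ≠ 0
  inj : ∀ i j t (m : ℤ), q i t = q j (t + m) → i = j ∧ (ℓ i : ℤ) ∣ m

/-- The framed link `M` is the bent closed framed braid given by `ℓ`, `q` and `f`. -/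
def FramedLink.IsBent (M : FramedLink ι) (ℓ : ι → ℕ) (q f : ι → ℝ → ℝ × ℝ) : Prop :=
  ∀ i t, M.curve i t = bend (q i (ℓ i * t)) (ℓ i * t) ∧
    M.frame i t = bendVec (q i (ℓ i * t)) (f i (ℓ i * t)) (ℓ i * t)

/-- The framed link `L` is isotopic to the closed framed braid given by `ℓ`, `q` and `f`. -/
def FramedLink.IsotopicBent (L : FramedLink ι) (ℓ : ι → ℕ) (q f : ι → ℝ → ℝ × ℝ) : Prop :=
  ClosedBraid ℓ q f ∧ ∃ M : FramedLink ι, L.Isotopic M ∧ M.IsBent ℓ q f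

theorem ClosedBraid.simpleLoops (H : ClosedBraid ℓ q f) :
    SimpleLoops fun i t => bend (q i (ℓ i * t)) (ℓ i * t) := by
  intro i j s t h
  obtain ⟨hp, m, hm⟩ := bend_inj h
  rw [hm] at hp
  obtain ⟨rfl, k, rfl⟩ := H.inj i j _ m hp
  refine ⟨rfl, k, ?_⟩
  have : (ℓ i : ℝ) ≠ 0 := Nat.cast_ne_zero.2 (H.pos i).ne'
  apply mul_left_cancel₀ this
  rw [hm]; push_cast; ring

/-- A closed braid with nonzero horizontal field automatically bends to an embedded framed link, by
`ClosedBraid.simpleLoops` and `linearIndependent_bend`. From here on isotopies can be built in the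
plane without checking immersedness. -/
theorem FramedLink.IsotopicBent.of_family {L : FramedLink ι} {q f : ι → ℝ → ℝ → ℝ × ℝ}
    (h : L.IsotopicBent ℓ (fun i => q i 0) fun i => f i 0)
    (hq : ∀ i, ContDiff ℝ ∞ fun p : ℝ × ℝ => q i p.1 p.2)
    (hf : ∀ i, ContDiff ℝ ∞ fun p : ℝ × ℝ => f i p.1 p.2)
    (H : ∀ s ∈ Icc (0 : ℝ) 1, ClosedBraid ℓ (fun i => q i s) fun i => f i s) :
    L.IsotopicBent ℓ (fun i => q i 1) fun i => f i 1 := by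
  obtain ⟨-, M, hLM, hM⟩ := h
  have hq' : ∀ i, ContDiff ℝ ∞ fun p : ℝ × ℝ => q i p.1 (ℓ i * p.2) := fun i =>
    (hq i).comp (contDiff_fst.prodMk (contDiff_const.mul contDiff_snd))
  have hf' : ∀ i, ContDiff ℝ ∞ fun p : ℝ × ℝ => f i p.1 (ℓ i * p.2) := fun i =>
    (hf i).comp (contDiff_fst.prodMk (contDiff_const.mul contDiff_snd))
  obtain ⟨M', h1, h2, h3⟩ := M.exists_isotopic_of_family
    (fun i s t => bend (q i s (ℓ i * t)) (ℓ i * t))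
    (fun i s t => bendVec (q i s (ℓ i * t)) (f i s (ℓ i * t)) (ℓ i * t))
    (fun i => ContDiff.contDiffOn (by
      have := hq' i
      rw [contDiff_euclidean]
      intro j
      fin_cases j <;> simp only [bend] <;> simp <;> fun_prop))
    (fun i => ContDiff.contDiffOn (by
      have := hq' i
      have := hf' i
      rw [contDiff_euclidean]
      intro j
      fin_cases j <;> simp only [bendVec] <;> simp <;> fun_prop))
    (fun i s hs t => by
      have hp := (H s hs).periodic_core i (ℓ i * t)
      have := bend_add_int (q i s (ℓ i * t)) (ℓ i * t) (ℓ i)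
      simp only [mul_add, mul_one] at hp ⊢
      rw [hp]
      simpa using this)
    (fun i s hs t => by
      have hp := (H s hs).periodic_core i (ℓ i * t)
      have hp' := (H s hs).periodic_field i (ℓ i * t)
      have := bendVec_add_int (q i s (ℓ i * t)) (f i s (ℓ i * t)) (ℓ i * t) (ℓ i)
      simp only [mul_add, mul_one] at hp hp' ⊢
      rw [hp, hp']
      simpa using this)
    (fun s hs => (H s hs).simpleLoops)
    (fun s hs i t => linearIndependent_bend (Nat.cast_ne_zero.2 ((H s hs).pos i).ne')
      (((H s hs).contDiff_core i).comp (contDiff_const.mul contDiff_id))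
      ((H s hs).ne_zero i _) t)
    (fun i => funext fun t => (hM i t).1.symm) (fun i => funext fun t => (hM i t).2.symm)
  exact ⟨H 1 (by simp), M', hLM.trans h3, fun i t => ⟨congrFun (h1 i) t, congrFun (h2 i) t⟩⟩

theorem deriv_periodic_space {g : ℝ → Space} (hg : Function.Periodic g 1) :
    Function.Periodic (deriv g) 1 := fun t => by
  rw [← deriv_comp_add_const]
  congr 1
  exact funext hg

/-- A framing of a link that winds positively around the third axis can be made horizontal. -/
theorem FramedLink.exists_horizontal (L : FramedLink ι)
    (pos : ∀ i t, 0 < xyDet (L.curve i t) (deriv (L.curve i) t)) :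
    ∃ M : FramedLink ι, L.Isotopic M ∧ (∀ i, M.curve i = L.curve i) ∧
      ∀ i t, xyDet (M.curve i t) (M.frame i t) = 0 := by
  have cd := fun i => (contDiff_infty_iff_deriv.1 (L.contDiff_curve i)).2
  have cxy : ∀ {g h : ℝ → Space}, ContDiff ℝ ∞ g → ContDiff ℝ ∞ h →
      ContDiff ℝ ∞ fun t => xyDet (g t) (h t) := fun {g h} hg hh => by
    have g' := contDiff_euclidean.1 hg
    have h' := contDiff_euclidean.1 hh
    exact ((g' 0).mul (h' 1)).sub ((g' 1).mul (h' 0))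
  -- The multiple of the tangent that carries the angular component of the frame. Subtracting any
  -- multiple of the tangent preserves independence from the tangent.
  set κ : ι → ℝ → ℝ := fun i t =>
    xyDet (L.curve i t) (L.frame i t) / xyDet (L.curve i t) (deriv (L.curve i) t) with hκ
  have cκ : ∀ i, ContDiff ℝ ∞ (κ i) := fun i =>
    (cxy (L.contDiff_curve i) (L.contDiff_frame i)).div (cxy (L.contDiff_curve i) (cd i))
      fun t => (pos i t).ne'
  obtain ⟨M, h1, h2, h3⟩ := L.exists_isotopic_of_family (fun i _ => L.curve i)
    (fun i s t => L.frame i t - (s * κ i t) • deriv (L.curve i) t)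
    (fun i => ((L.contDiff_curve i).comp contDiff_snd).contDiffOn)
    (fun i => ContDiff.contDiffOn (by
      have a1 := (L.contDiff_frame i).comp (contDiff_snd (E := ℝ) (F := ℝ))
      have a2 := (cκ i).comp (contDiff_snd (E := ℝ) (F := ℝ))
      have a3 := (cd i).comp (contDiff_snd (E := ℝ) (F := ℝ))
      exact a1.sub ((contDiff_fst.mul a2).smul a3)))
    (fun i _ _ => L.periodic_curve i)
    (fun i s _ t => by
      simp only [hκ, L.periodic_curve i t, L.periodic_frame i t,
        deriv_periodic_space (L.periodic_curve i) t])
    (fun _ _ => L.simpleLoops)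
    (fun s _ i t => by
      have := L.nowhere_tangent i t
      rw [LinearIndependent.pair_iff] at this ⊢
      intro a b hab
      have e : (a - b * (s * κ i t)) • deriv (L.curve i) t + b • L.frame i t = 0 := by
        rw [← hab]; module
      obtain ⟨h1, h2⟩ := this _ _ e
      subst h2
      exact ⟨by simpa using h1, rfl⟩)
    (fun _ => rfl) (fun i => by simp)
  refine ⟨M, h3, h1, fun i t => ?_⟩
  rw [h1, h2]
  have e : xyDet (L.curve i t) (L.frame i t - (1 * κ i t) • deriv (L.curve i) t) =
      xyDet (L.curve i t) (L.frame i t) - κ i t * xyDet (L.curve i t) (deriv (L.curve i) t) := by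
    simp [xyDet]; ring
  rw [e, hκ]
  simp only
  rw [div_mul_cancel₀ _ (pos i t).ne', sub_self]

/-- A positive link with horizontal framing, parametrized by the inverse of its angle function, is a
bent closed braid whose numbers of turns are the angular shifts over one period. -/
theorem FramedLink.exists_isotopicBent [Finite ι] (L : FramedLink ι) :
    ∃ (ℓ : ι → ℕ) (q f : ι → ℝ → ℝ × ℝ), L.IsotopicBent ℓ q f := by
  obtain ⟨L₁, hL₁, pos₁⟩ := L.exists_winding_pos
  obtain ⟨M, hM, hc, hor⟩ := L₁.exists_horizontal pos₁
  have pos : ∀ i t, 0 < xyDet (M.curve i t) (deriv (M.curve i) t) := by simpa only [hc] using pos₁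
  choose r α cr cα pr dα hℓ e0 e1 using fun i =>
    exists_cylindrical (M.contDiff_curve i) (M.periodic_curve i) (pos i)
  choose ℓ hℓ sh using hℓ
  choose β cβ inv shβ dβ using fun i => exists_smooth_inverse (cα i) (dα i) (hℓ i) (sh i)
  have hℓ' : ∀ i, (0 : ℝ) < ℓ i := fun i => by exact_mod_cast hℓ i
  obtain ⟨M', hc', hf', hMM'⟩ := M.exists_isotopic_reparam (fun i t => β i (ℓ i * t))
    (fun i => (cβ i).comp (contDiff_const.mul contDiff_id))
    (fun i t => by rw [mul_add, mul_one, shβ])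
    (fun i t => by
      have h1 := ((cβ i).differentiable (by simp) (ℓ i * t)).hasDerivAt
      have h2 : HasDerivAt (fun t : ℝ => ℓ i * t) (ℓ i) t := by
        simpa using (hasDerivAt_id t).const_mul (ℓ i : ℝ)
      have h3 : HasDerivAt (fun t => β i (ℓ i * t)) _ t := h1.comp t h2
      rw [h3.deriv]
      exact mul_pos (dβ i _) (hℓ' i))
  have cc := fun i => contDiff_euclidean.1 (M.contDiff_curve i)
  have cf := fun i => contDiff_euclidean.1 (M.contDiff_frame i)
  -- the curve and its framing in cylindrical coordinates
  set Q : ι → ℝ → ℝ × ℝ := fun i t => (r i t, -M.curve i t 2) with hQ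
  -- The horizontal part of the frame is parallel to that of the position, which has length `exp r`.
  -- Their inner product is `exp (2 r)` times the first coordinate sought.
  set F : ι → ℝ → ℝ × ℝ := fun i t =>
    ((M.frame i t 0 * M.curve i t 0 + M.frame i t 1 * M.curve i t 1) * Real.exp (-(2 * r i t)),
      -M.frame i t 2) with hF
  have cQ : ∀ i, ContDiff ℝ ∞ (Q i) := fun i => (cr i).prodMk (cc i 2).neg
  have cF : ∀ i, ContDiff ℝ ∞ (F i) := fun i =>
    ((((cf i 0).mul (cc i 0)).add ((cf i 1).mul (cc i 1))).mul
      (contDiff_const.mul (cr i)).neg.exp).prodMk (cf i 2).neg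
  have bQ : ∀ i t, M.curve i t = bend (Q i t) (α i t) := fun i t => by
    ext j
    fin_cases j
    · simpa [bend, hQ] using e0 i t
    · simpa [bend, hQ] using e1 i t
    · simp [bend, hQ]
  have bF : ∀ i t, M.frame i t = bendVec (Q i t) (F i t) (α i t) := fun i t => by
    have h0 := e0 i t
    have h1 := e1 i t
    have hd := hor i t
    have hE := Real.exp_pos (r i t)
    have hE2 : Real.exp (r i t) ^ 2 * Real.exp (-(2 * r i t)) = 1 := by
      rw [← Real.exp_nat_mul, ← Real.exp_add]; simp
    have hcs := Real.sin_sq_add_cos_sq (2 * Real.pi * α i t)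
    rw [xyDet] at hd
    ext j
    fin_cases j
    · simp only [bendVec, hQ, hF]
      simp only [Fin.zero_eta, Matrix.cons_val_zero]
      rw [h0, h1] at hd ⊢
      set C := Real.cos (2 * Real.pi * α i t)
      set S := Real.sin (2 * Real.pi * α i t)
      set E := Real.exp (r i t)
      set E' := Real.exp (-(2 * r i t))
      linear_combination (-(M.frame i t 0) * hE2) - (E ^ 2 * E' * M.frame i t 0) * hcs
        - (E * E' * S) * hd
    · simp only [bendVec, hQ, hF]
      simp only [Fin.mk_one, Matrix.cons_val_one, Matrix.cons_val_zero]
      rw [h0, h1] at hd ⊢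
      set C := Real.cos (2 * Real.pi * α i t)
      set S := Real.sin (2 * Real.pi * α i t)
      set E := Real.exp (r i t)
      set E' := Real.exp (-(2 * r i t))
      linear_combination (-(M.frame i t 1) * hE2) - (E ^ 2 * E' * M.frame i t 1) * hcs
        + (E * E' * C) * hd
    · simp [bendVec, hF]
  refine ⟨ℓ, fun i θ => Q i (β i θ), fun i θ => F i (β i θ), ⟨hℓ, fun i => (cQ i).comp (cβ i),
    fun i => (cF i).comp (cβ i), fun i θ => ?_, fun i θ => ?_, fun i θ h0 => ?_,
    fun i j θ m h => ?_⟩, M', (hL₁.trans hM).trans hMM', fun i t => ⟨?_, ?_⟩⟩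
  · simp only [shβ, hQ, pr i _, M.periodic_curve i _]
  · simp only [shβ, hF, pr i _, M.periodic_curve i _, M.periodic_frame i _]
  · have := (M.nowhere_tangent i (β i θ)).ne_zero 1
    apply this
    have e := bF i (β i θ)
    rw [h0] at e
    simp only [Matrix.cons_val_one, Matrix.cons_val_zero]
    rw [e]
    ext j
    fin_cases j <;> simp [bendVec]
  -- Equal positions at angles differing by whole turns are equal points in space. Embeddedness
  -- gives parameters differing by an integer `k`, and applying the angle function gives `m = ℓ k`.
  · have e : M.curve i (β i θ) = M.curve j (β j (θ + m)) := by
      rw [bQ, bQ, inv, inv, h, bend_add_int]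
    obtain ⟨rfl, k, hk⟩ := M.embedded _ _ _ _ e
    refine ⟨rfl, k, ?_⟩
    have hsh : ∀ (k : ℤ) t, α i (t + k) = α i t + k * ℓ i := fun k t => by
      have : Function.Periodic (fun t => α i t - t * ℓ i) 1 := fun t => by
        simp only [sh]; ring
      have := this.int_mul k t
      simp only [mul_one] at this
      linarith
    have e2 := congrArg (α i) hk
    rw [inv, hsh, inv] at e2
    have : (m : ℝ) = ℓ i * k := by linarith
    exact_mod_cast this
  · rw [hc']; beta_reduce; rw [bQ, inv]
  · rw [hf']; beta_reduce; rw [bF, inv]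

end ClosedBraid

/-! ### Normalizing a closed braid over the integers -/

section Normalize

/-- A smooth staircase that rises by one on `[ℓ k, ℓ k + 1 / 2]` and is constant on
`[ℓ k + 1 / 2, ℓ (k + 1)]`. -/
noncomputable def stair (ℓ : ℕ) (θ : ℝ) : ℝ :=
  ⌊θ / ℓ⌋ + Real.smoothTransition (2 * (θ - ℓ * ⌊θ / ℓ⌋))

theorem stair_add {ℓ : ℕ} (hℓ : 0 < ℓ) (θ : ℝ) : stair ℓ (θ + ℓ) = stair ℓ θ + 1 := by
  have h : (θ + ℓ) / ℓ = θ / ℓ + 1 := by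
    have : (ℓ : ℝ) ≠ 0 := Nat.cast_ne_zero.2 hℓ.ne'
    field_simp
  rw [stair, stair, h, Int.floor_add_one]
  push_cast
  rw [show θ + ℓ - ℓ * ((⌊θ / ℓ⌋ : ℝ) + 1) = θ - ℓ * ⌊θ / ℓ⌋ by ring]
  ring

theorem stair_eq {ℓ : ℕ} (hℓ : 0 < ℓ) (k : ℤ) {θ : ℝ} (h1 : ℓ * k - 1 / 2 < θ)
    (h2 : θ < ℓ * (k + 1)) : stair ℓ θ = k + Real.smoothTransition (2 * (θ - ℓ * k)) := by
  have hℓ' : (1 : ℝ) ≤ ℓ := by exact_mod_cast hℓ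
  have hpos : (0 : ℝ) < ℓ := by linarith
  rcases le_or_gt (ℓ * (k : ℝ)) θ with h | h
  · have : ⌊θ / ℓ⌋ = k := Int.floor_eq_iff.2
      ⟨(le_div_iff₀ hpos).2 (by linarith), (div_lt_iff₀ hpos).2 (by linarith)⟩
    rw [stair, this]
  · have : ⌊θ / ℓ⌋ = k - 1 := Int.floor_eq_iff.2
      ⟨(le_div_iff₀ hpos).2 (by push_cast; linarith), (div_lt_iff₀ hpos).2 (by push_cast; linarith)⟩
    rw [stair, this, Real.smoothTransition.one_of_one_le (by push_cast; linarith),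
      Real.smoothTransition.zero_of_nonpos (by linarith)]
    push_cast; ring

theorem contDiff_stair {ℓ : ℕ} (hℓ : 0 < ℓ) : ContDiff ℝ ∞ (stair ℓ) := by
  have hpos : (0 : ℝ) < ℓ := by exact_mod_cast hℓ
  refine contDiff_iff_contDiffAt.2 fun θ => ?_
  have h1 : ContDiff ℝ ∞ fun u : ℝ =>
      (⌊θ / ℓ⌋ : ℝ) + Real.smoothTransition (2 * (u - ℓ * ⌊θ / ℓ⌋)) :=
    contDiff_const.add (Real.smoothTransition.contDiff.comp (by fun_prop))
  refine h1.contDiffAt.congr_of_eventuallyEq ?_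
  have h2 := (le_div_iff₀ hpos).1 (Int.floor_le (θ / ℓ))
  have h3 := (div_lt_iff₀ hpos).1 (Int.lt_floor_add_one (θ / ℓ))
  filter_upwards [Ioo_mem_nhds (show ℓ * (⌊θ / ℓ⌋ : ℝ) - 1 / 2 < θ by linarith)
    (show θ < ℓ * ((⌊θ / ℓ⌋ : ℝ) + 1) by linarith)] with u hu
  exact stair_eq hℓ _ hu.1 hu.2

/-- Each rise takes half a unit and starts at an integer, so no integer lies strictly inside it. At
integers a multiple of `2 π i` times the staircase then has exponential one. -/
theorem stair_int {ℓ : ℕ} (hℓ : 0 < ℓ) (k : ℤ) : ∃ m : ℤ, stair ℓ k = m := by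
  have hpos : (0 : ℝ) < ℓ := by exact_mod_cast hℓ
  set j := ⌊(k : ℝ) / ℓ⌋ with hj
  have h2 := (le_div_iff₀ hpos).1 (Int.floor_le ((k : ℝ) / ℓ))
  rw [stair, ← hj]
  rw [← hj] at h2
  have h3 : j * ℓ ≤ k := by exact_mod_cast h2
  rcases h3.eq_or_lt with h | h
  · refine ⟨j, ?_⟩
    rw [Real.smoothTransition.zero_of_nonpos, add_zero]
    rw [← h]; push_cast; linarith
  · refine ⟨j + 1, ?_⟩
    rw [Real.smoothTransition.one_of_one_le]
    · push_cast; ring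
    · have : (j : ℝ) * ℓ + 1 ≤ k := by exact_mod_cast h
      linarith

variable {ι : Type*} {ℓ : ι → ℕ} {q f : ι → ℝ → ℝ × ℝ} {L : FramedLink ι}

theorem contDiff_eval (p : Polynomial ℝ) : ContDiff ℝ ∞ fun x : ℝ => p.eval x := by
  simpa [Polynomial.coe_aeval_eq_eval] using p.contDiff_aeval (𝕜 := ℝ) ∞

/-- A closed braid can be moved by an isotopy of the plane. -/
theorem FramedLink.IsotopicBent.plane (h : L.IsotopicBent ℓ q f) {Φ : ℝ → ℝ × ℝ → ℝ × ℝ}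
    (cΦ : ContDiff ℝ ∞ fun p : ℝ × (ℝ × ℝ) => Φ p.1 p.2) (h0 : ∀ x, Φ 0 x = x)
    (inj : ∀ s, Function.Injective (Φ s)) :
    L.IsotopicBent ℓ (fun i t => Φ 1 (q i t)) f := by
  have H := h.1
  have cq : ∀ i, ContDiff ℝ ∞ fun p : ℝ × ℝ => Φ p.1 (q i p.2) := fun i =>
    cΦ.comp (contDiff_fst.prodMk ((H.contDiff_core i).comp contDiff_snd))
  -- The field is left unchanged in the plane coordinates: any nonzero horizontal field is
  -- admissible along any core, so it need not be pushed forward by `Φ`.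
  refine FramedLink.IsotopicBent.of_family (q := fun i s t => Φ s (q i t)) (f := fun i _ => f i)
    (by simpa only [h0] using h) cq (fun i => (H.contDiff_field i).comp contDiff_snd)
    fun s _ => ⟨H.pos, fun i => (cq i).comp (contDiff_const.prodMk contDiff_id), H.contDiff_field,
      fun i t => ?_, H.periodic_field, H.ne_zero, fun i j t m e => H.inj i j t m (inj s e)⟩
  simp only [H.periodic_core i t]

theorem FramedLink.IsotopicBent.shear_fst (h : L.IsotopicBent ℓ q f) (p : Polynomial ℝ) :
    L.IsotopicBent ℓ (fun i t => ((q i t).1 + p.eval (q i t).2, (q i t).2)) f := by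
  have := h.plane (Φ := fun s x => (x.1 + s * p.eval x.2, x.2)) (by
    have hp : ContDiff ℝ ∞ fun x : ℝ × (ℝ × ℝ) => p.eval x.2.2 :=
      (contDiff_eval p).comp (contDiff_snd.comp contDiff_snd)
    fun_prop) (fun x => by simp) (fun s x y e => by
      simp only [Prod.mk.injEq] at e
      obtain ⟨e1, e2⟩ := e
      rw [e2] at e1
      exact Prod.ext (by linarith) e2)
  simpa using this

theorem FramedLink.IsotopicBent.shear_snd (h : L.IsotopicBent ℓ q f) (p : Polynomial ℝ) :
    L.IsotopicBent ℓ (fun i t => ((q i t).1, (q i t).2 + p.eval (q i t).1)) f := by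
  have := h.plane (Φ := fun s x => (x.1, x.2 + s * p.eval x.1)) (by
    have hp : ContDiff ℝ ∞ fun x : ℝ × (ℝ × ℝ) => p.eval x.2.1 :=
      (contDiff_eval p).comp (contDiff_fst.comp contDiff_snd)
    fun_prop) (fun x => by simp) (fun s x y e => by
      simp only [Prod.mk.injEq] at e
      obtain ⟨e1, e2⟩ := e
      rw [e1] at e2
      exact Prod.ext e1 (by linarith))
  simpa using this

/-- Each pair of points excludes at most one slope, so a generic shear gives distinct first
coordinates, as polynomial interpolation requires. -/
theorem exists_injective_fst_add_mul {I : Type*} [Finite I] {P : I → ℝ × ℝ}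
    (hP : Function.Injective P) : ∃ a : ℝ, Function.Injective fun e => (P e).1 + a * (P e).2 := by
  obtain ⟨a, ha⟩ := (Set.finite_range fun e : I × I =>
    -(((P e.1).1 - (P e.2).1) / ((P e.1).2 - (P e.2).2))).exists_notMem
  refine ⟨a, fun e e' h => hP ?_⟩
  simp only at h
  by_cases h2 : (P e).2 = (P e').2
  · rw [h2] at h
    exact Prod.ext (by linarith) h2
  · refine absurd ⟨(e, e'), ?_⟩ ha
    simp only
    have : (P e).2 - (P e').2 ≠ 0 := sub_ne_zero.2 h2
    field_simp
    linarith

theorem exists_polynomial_eval {I : Type*} [Finite I] {x : I → ℝ} (hx : Function.Injective x)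
    (y : I → ℝ) : ∃ p : Polynomial ℝ, ∀ e, p.eval (x e) = y e := by
  classical
  have := Fintype.ofFinite I
  exact ⟨Lagrange.interpolate Finset.univ x y, fun e =>
    Lagrange.eval_interpolate_at_node y hx.injOn (Finset.mem_univ e)⟩

/-- Finitely many points of a closed braid can be moved to given points of the first coordinate
axis of the plane. -/
theorem FramedLink.IsotopicBent.exists_marked (h : L.IsotopicBent ℓ q f) {I : Type*} [Finite I]
    (a : I → ι) (τ : I → ℝ) (hP : Function.Injective fun e => q (a e) (τ e)) {u : I → ℝ}
    (hu : Function.Injective u) :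
    ∃ q', L.IsotopicBent ℓ q' f ∧ ∀ e, q' (a e) (τ e) = (u e, 0) := by
  obtain ⟨c, hc⟩ := exists_injective_fst_add_mul hP
  obtain ⟨p₁, hp₁⟩ := exists_polynomial_eval hc fun e => u e - (q (a e) (τ e)).2
  obtain ⟨p₂, hp₂⟩ := exists_polynomial_eval hu fun e =>
    u e - ((q (a e) (τ e)).1 + c * (q (a e) (τ e)).2)
  -- The four shears move a marked point `(x, y)` through `(x + c y, y)`, `(x + c y, u)` and `(u,
  -- u)` to `(u, 0)`.
  refine ⟨_, ((((h.shear_fst (Polynomial.C c * Polynomial.X)).shear_snd p₁).shear_fst p₂).shear_snd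
    (-Polynomial.X)), fun e => ?_⟩
  simp [hp₁, hp₂]

/-- The angular parameter of a closed braid can be changed in the core and in the framing. -/
theorem FramedLink.IsotopicBent.time (h : L.IsotopicBent ℓ q f) {χ : ℝ → ℝ}
    (cχ : ContDiff ℝ ∞ χ) (sh : ∀ t, χ (t + 1) = χ t + 1) :
    L.IsotopicBent ℓ (fun i t => q i (χ t)) fun i t => f i (χ t) := by
  have H := h.1
  -- No monotonicity is needed: all strands over an angle are read off at the same new time, so they
  -- stay distinct. It suffices that `R s` commutes with integer translations.
  set R : ℝ → ℝ → ℝ := fun s t => t + s * (χ t - t) with hR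
  have cR : ContDiff ℝ ∞ fun p : ℝ × ℝ => R p.1 p.2 := by
    have : ContDiff ℝ ∞ fun p : ℝ × ℝ => χ p.2 := cχ.comp contDiff_snd
    fun_prop
  have per : Function.Periodic (fun t => χ t - t) 1 := fun t => by simp only [sh]; ring
  have shR : ∀ s t (m : ℤ), R s (t + m) = R s t + m := fun s t m => by
    have := per.int_mul m t
    simp only [mul_one] at this
    simp only [hR, this]; ring
  have cRs : ∀ s, ContDiff ℝ ∞ (R s) := fun s => cR.comp (contDiff_const.prodMk contDiff_id)
  have R0 : ∀ t, R 0 t = t := fun t => by simp [hR]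
  have R1 : ∀ t, R 1 t = χ t := fun t => by simp [hR]
  have := FramedLink.IsotopicBent.of_family (L := L) (ℓ := ℓ) (q := fun i s t => q i (R s t))
    (f := fun i s t => f i (R s t)) (by simpa only [R0] using h)
    (fun i => (H.contDiff_core i).comp cR) (fun i => (H.contDiff_field i).comp cR)
    fun s _ => ⟨H.pos, fun i => (H.contDiff_core i).comp (cRs s),
      fun i => (H.contDiff_field i).comp (cRs s), fun i t => ?_, fun i t => ?_,
      fun i t => H.ne_zero i _, fun i j t m e => H.inj i j (R s t) m (by rw [e, shR])⟩
  · simpa only [R1] using this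
  · have := shR s t (ℓ i)
    simp only [Int.cast_natCast] at this
    rw [this, H.periodic_core i]
  · have := shR s t (ℓ i)
    simp only [Int.cast_natCast] at this
    rw [this, H.periodic_field i]

/-- The framing of a closed braid can be made standard at the integers. -/
theorem FramedLink.IsotopicBent.exists_field (h : L.IsotopicBent ℓ q f) :
    ∃ f', L.IsotopicBent ℓ q f' ∧ ∀ i (k : ℤ), f' i k = (1, 0) := by
  have H := h.1
  set A := Complex.equivRealProdCLM with hA
  have key : ∀ i, ∃ (g : ℝ → ℂ) (m : ℤ), ContDiff ℝ ∞ g ∧ (∀ t, A (Complex.exp (g t)) = f i t) ∧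
      ∀ t, g (t + ℓ i) = g t + m * (2 * Real.pi * Complex.I) := fun i => by
    obtain ⟨g, cg, eg⟩ := exists_smooth_log (A.symm.contDiff.comp (H.contDiff_field i))
      (fun t e => H.ne_zero i t (by simpa using e))
    obtain ⟨m, hm⟩ := exists_shift_log cg (T := ℓ i) (fun t => by
      simp only [eg, Function.comp_apply, H.periodic_field i t])
    exact ⟨g, m, cg, fun t => by rw [eg]; simp, hm⟩
  choose g m cg eg hm using key
  -- The straight line between two logarithms that increase by the same `2 π i m` over a period, so
  -- its exponential stays periodic. At the end the `m` full twists are concentrated in the first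
  -- half unit of the period.
  set v : ι → ℝ → ℝ → ℂ := fun i s t =>
    g i t + s * (m i * (2 * Real.pi * Complex.I) * stair (ℓ i) t - g i t) with hv
  have cv : ∀ i, ContDiff ℝ ∞ fun p : ℝ × ℝ => v i p.1 p.2 := fun i => by
    have h1 : ContDiff ℝ ∞ fun p : ℝ × ℝ => g i p.2 := (cg i).comp contDiff_snd
    have h2 : ContDiff ℝ ∞ fun p : ℝ × ℝ => ((stair (ℓ i) p.2 : ℝ) : ℂ) :=
      Complex.ofRealCLM.contDiff.comp ((contDiff_stair (H.pos i)).comp contDiff_snd)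
    have h3 : ContDiff ℝ ∞ fun p : ℝ × ℝ => ((p.1 : ℝ) : ℂ) :=
      Complex.ofRealCLM.contDiff.comp contDiff_fst
    exact h1.add (h3.mul ((contDiff_const.mul h2).sub h1))
  have cf : ∀ i, ContDiff ℝ ∞ fun p : ℝ × ℝ => A (Complex.exp (v i p.1 p.2)) := fun i =>
    A.contDiff.comp (cv i).cexp
  have v0 : ∀ i t, v i 0 t = g i t := fun i t => by simp [hv]
  refine ⟨_, FramedLink.IsotopicBent.of_family (q := fun i _ => q i)
    (f := fun i s t => A (Complex.exp (v i s t))) (by simpa only [v0, eg] using h)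
    (fun i => (H.contDiff_core i).comp contDiff_snd) cf
    fun s _ => ⟨H.pos, H.contDiff_core, fun i => (cf i).comp (contDiff_const.prodMk contDiff_id),
      H.periodic_core, fun i t => ?_, fun i t e => ?_, H.inj⟩, fun i k => ?_⟩
  · have : v i s (t + ℓ i) = v i s t + m i * (2 * Real.pi * Complex.I) := by
      simp only [hv, hm, stair_add (H.pos i)]
      push_cast; ring
    simp only [this, Complex.exp_add, Complex.exp_int_mul_two_pi_mul_I, mul_one]
  · exact Complex.exp_ne_zero _ (A.map_eq_zero_iff.1 e)
  · obtain ⟨j, hj⟩ := stair_int (H.pos i) k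
    have : v i 1 k = (m i * j : ℤ) * (2 * Real.pi * Complex.I) := by
      simp only [hv, hj]
      push_cast; ring
    simp only [this, Complex.exp_int_mul_two_pi_mul_I, hA]
    exact Prod.ext Complex.one_re Complex.one_im

end Normalize

/-! ### Cutting a closed braid open -/

section ToBraid

theorem Function.Periodic.zmod_val {X : Type*} {g : ℝ → X} {l : ℕ} [NeZero l]
    (hg : Function.Periodic g l) (m : ℤ) (t : ℝ) : g (((m : ZMod l).val : ℝ) + t) = g (m + t) := by
  have h : ((m : ZMod l).val : ℤ) = m - m / l * l := by
    rw [ZMod.val_intCast]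
    have := Int.emod_add_mul_ediv m l
    linarith
  have h' : ((m : ZMod l).val : ℝ) = m - (m / l : ℤ) * l := by exact_mod_cast h
  rw [h', ← hg.sub_int_mul_eq (m / l) (x := m + t)]
  congr 1; ring

variable {ι : Type*} {ℓ : ι → ℕ} {q f : ι → ℝ → ℝ × ℝ} {n : ℕ}

/-- The permutation of the strands of a closed braid, labelled by `e`. -/
def turnPerm (e : (Σ i, ZMod (ℓ i)) ≃ Fin n) : Equiv.Perm (Fin n) :=
  e.permCongrHom (Equiv.Perm.sigmaCongrRightHom (fun i => ZMod (ℓ i)) fun _ => Equiv.addRight 1)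

theorem turnPerm_zpow (e : (Σ i, ZMod (ℓ i)) ≃ Fin n) (m : ℤ) (i : ι) (k : ZMod (ℓ i)) :
    (turnPerm e ^ m) (e ⟨i, k⟩) = e ⟨i, k + m⟩ := by
  rw [turnPerm, ← map_zpow, ← map_zpow]
  simp [Equiv.permCongrHom, Equiv.permCongr, Equiv.Perm.sigmaCongrRightHom]

variable [∀ i, NeZero (ℓ i)]

/-- The pairs `(i, k)` enumerate the strands over one angle. Two that coincide belong to one
component and differ by a multiple of its number of turns, hence have the same residue. This yields
disjointness of the strands of the braid. -/
theorem ClosedBraid.sigma_inj (H : ClosedBraid ℓ q f) {x y : Σ i, ZMod (ℓ i)} {s : ℝ}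
    (h : q x.1 (x.2.val + s) = q y.1 (y.2.val + s)) : x = y := by
  obtain ⟨i, k⟩ := x
  obtain ⟨j, k'⟩ := y
  have e : (k'.val + s : ℝ) = k.val + s + ((k'.val - k.val : ℤ) : ℝ) := by push_cast; ring
  simp only at h
  rw [e] at h
  obtain ⟨rfl, hm⟩ := H.inj i j _ _ h
  have := (ZMod.intCast_zmod_eq_zero_iff_dvd _ _).2 hm
  simp only [Int.cast_sub, Int.cast_natCast, ZMod.natCast_zmod_val, sub_eq_zero] at this
  rw [this]

/-- The braid obtained by cutting a closed braid whose strands are in standard position at the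
integers. -/
noncomputable def ClosedBraid.toBraid (H : ClosedBraid ℓ q f) (e : (Σ i, ZMod (ℓ i)) ≃ Fin n)
    (hq : ∀ x : Σ i, ZMod (ℓ i), q x.1 x.2.val = braidEndpoint (e x))
    (hf : ∀ i (k : ℤ), f i k = (1, 0)) : FramedBraid n where
  perm := turnPerm e
  -- The strand labelled `(i, k)` is the stretch of the component `i` over the angles from `k` to `k
  -- + 1`; the transition function makes it constant outside `[0, 1]`.
  strand a t := q (e.symm a).1 ((e.symm a).2.val + Real.smoothTransition t)
  frame a t := f (e.symm a).1 ((e.symm a).2.val + Real.smoothTransition t)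
  contDiff_strand a :=
    (H.contDiff_core _).comp (contDiff_const.add Real.smoothTransition.contDiff)
  contDiff_frame a :=
    (H.contDiff_field _).comp (contDiff_const.add Real.smoothTransition.contDiff)
  strand_of_nonpos a t ht := by
    rw [Real.smoothTransition.zero_of_nonpos ht, add_zero, hq, Equiv.apply_symm_apply]
  strand_of_one_le a t ht := by
    obtain ⟨⟨i, k⟩, rfl⟩ := e.surjective a
    have h1 := turnPerm_zpow e 1 i k
    rw [zpow_one] at h1
    rw [h1, ← hq, Real.smoothTransition.one_of_one_le ht, Equiv.symm_apply_apply]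
    have h2 := (H.periodic_core i).zmod_val (k.val + 1) 0
    simpa using h2.symm
  frame_of_nonpos a t ht := by
    rw [Real.smoothTransition.zero_of_nonpos ht, add_zero]
    exact_mod_cast hf _ ((e.symm a).2.val : ℤ)
  frame_of_one_le a t ht := by
    rw [Real.smoothTransition.one_of_one_le ht]
    exact_mod_cast hf _ ((e.symm a).2.val + 1 : ℤ)
  disjoint a b t h := by
    exact e.symm.injective (H.sigma_inj h)
  frame_ne_zero a t := H.ne_zero _ _

variable (H : ClosedBraid ℓ q f) (e : (Σ i, ZMod (ℓ i)) ≃ Fin n)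
  (hq : ∀ x : Σ i, ZMod (ℓ i), q x.1 x.2.val = braidEndpoint (e x))
  (hf : ∀ i (k : ℤ), f i k = (1, 0))

/-- The closure runs through a strand during the first half of each turn and waits during the second
half, which is exactly the time change `stair 1` applied to the closed braid. -/
theorem ClosedBraid.toBraid_closed (i : ι) (k : ZMod (ℓ i)) (s : ℝ) :
    (H.toBraid e hq hf).closedStrand (e ⟨i, k⟩) s = q i (stair 1 (s + k.val)) ∧
    (H.toBraid e hq hf).closedFrame (e ⟨i, k⟩) s = f i (stair 1 (s + k.val)) := by
  have h : stair 1 (s + k.val) =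
      ((k.val + ⌊s⌋ : ℤ) : ℝ) + Real.smoothTransition (2 * Int.fract s) := by
    rw [stair, Int.fract]
    simp only [Nat.cast_one, div_one, Int.floor_add_natCast, one_mul]
    push_cast
    rw [show s + (k.val : ℝ) - (⌊s⌋ + k.val) = s - ⌊s⌋ by ring]
    ring
  have hk : k + (⌊s⌋ : ZMod (ℓ i)) = ((k.val + ⌊s⌋ : ℤ) : ZMod (ℓ i)) := by simp
  have hp := turnPerm_zpow e ⌊s⌋ i k
  constructor
  · change (fun x : Σ i, ZMod (ℓ i) => q x.1 (x.2.val + Real.smoothTransition (2 * Int.fract s)))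
      (e.symm ((turnPerm e ^ ⌊s⌋) (e ⟨i, k⟩))) = _
    rw [hp, Equiv.symm_apply_apply, h, ← (H.periodic_core i).zmod_val, ← hk]
  · change (fun x : Σ i, ZMod (ℓ i) => f x.1 (x.2.val + Real.smoothTransition (2 * Int.fract s)))
      (e.symm ((turnPerm e ^ ⌊s⌋) (e ⟨i, k⟩))) = _
    rw [hp, Equiv.symm_apply_apply, h, ← (H.periodic_field i).zmod_val, ← hk]

theorem ClosedBraid.sameCycle_iff (i j : ι) (k : ZMod (ℓ i)) (k' : ZMod (ℓ j)) :
    (turnPerm e).SameCycle (e ⟨i, k⟩) (e ⟨j, k'⟩) ↔ i = j := by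
  constructor
  · rintro ⟨m, hm⟩
    rw [turnPerm_zpow] at hm
    exact congrArg Sigma.fst (e.injective hm)
  · rintro rfl
    refine ⟨k'.val - k.val, ?_⟩
    rw [turnPerm_zpow]
    simp

/-- The components of the closure of the braid are those of the closed braid. -/
noncomputable def ClosedBraid.componentEquiv : ι ≃ (H.toBraid e hq hf).Component :=
  Equiv.ofBijective (fun i => Quotient.mk _ (e ⟨i, 0⟩)) (by
    constructor
    · intro i j h
      exact (ClosedBraid.sameCycle_iff e i j 0 0).1 (Quotient.exact h)
    · intro c
      obtain ⟨a, rfl⟩ := Quotient.exists_rep c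
      obtain ⟨⟨i, k⟩, rfl⟩ := e.surjective a
      exact ⟨i, Quotient.sound ((ClosedBraid.sameCycle_iff e i i 0 k).2 rfl)⟩)

/-- `FramedBraid.closure` starts each component at a chosen representative, which may be any of its
turns `k`; a rotation of the parameter later absorbs this ambiguity. -/
theorem ClosedBraid.exists_out (i : ι) :
    ∃ k : ZMod (ℓ i), (H.componentEquiv e hq hf i).out = e ⟨i, k⟩ := by
  obtain ⟨⟨j, k⟩, hk⟩ := e.surjective (H.componentEquiv e hq hf i).out
  have h : Quotient.mk _ (e ⟨j, k⟩) = H.componentEquiv e hq hf i := by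
    rw [hk]; exact Quotient.out_eq _
  obtain rfl := (ClosedBraid.sameCycle_iff e j i k 0).1 (Quotient.exact h)
  exact ⟨k, hk.symm⟩

theorem ClosedBraid.turns_componentEquiv (i : ι) :
    (H.toBraid e hq hf).turns (H.componentEquiv e hq hf i) = ℓ i := by
  obtain ⟨k, hk⟩ := H.exists_out e hq hf i
  have key : ∀ m : ℤ, ((H.toBraid e hq hf).turns (H.componentEquiv e hq hf i) : ℤ) ∣ m ↔
      (ℓ i : ℤ) ∣ m := by
    intro m
    rw [← FramedBraid.perm_zpow_eq_iff, hk, ← ZMod.intCast_zmod_eq_zero_iff_dvd]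
    change (turnPerm e ^ m) _ = _ ↔ _
    rw [turnPerm_zpow]
    simp
  exact Nat.dvd_antisymm (Int.natCast_dvd_natCast.1 ((key _).2 dvd_rfl))
    (Int.natCast_dvd_natCast.1 ((key _).1 dvd_rfl))

end ToBraid

/-- The number of ribbons is the sum of the numbers of turns, with the points over the integers as
endpoints. After normalization and the time change by `stair 1`, the closed braid agrees with the
closure of the cut braid up to the starting point of each component. -/
theorem FramedLink.IsotopicBent.exists_closure {ι : Type*} [Finite ι] {ℓ : ι → ℕ}
    {q f : ι → ℝ → ℝ × ℝ} {L : FramedLink ι} (h : L.IsotopicBent ℓ q f) :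
    ∃ (n : ℕ) (b : FramedBraid n), L.Isotopic b.closure := by
  have : ∀ i, NeZero (ℓ i) := fun i => ⟨(h.1.pos i).ne'⟩
  set e := Finite.equivFin (Σ i, ZMod (ℓ i)) with he
  obtain ⟨q', h', hq₀⟩ := h.exists_marked (I := Σ i, ZMod (ℓ i)) (fun x => x.1)
    (fun x => x.2.val) (fun x y hx => h.1.sigma_inj (s := 0) (by simpa using hx))
    (u := fun x => ((e x : ℕ) : ℝ) + 1 + 1 / 4) (fun x y hxy => by
      simp only [add_left_inj, Nat.cast_inj] at hxy
      exact e.injective (Fin.ext hxy))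
  have hq' : ∀ x : Σ i, ZMod (ℓ i), q' x.1 x.2.val = braidEndpoint (e x) := hq₀
  obtain ⟨f', h'', hf'⟩ := h'.exists_field
  have H := h''.1
  obtain ⟨-, M, hLM, hM⟩ := h''.time (contDiff_stair one_pos) (fun t => by
    simpa using stair_add one_pos t)
  choose k hk using H.exists_out e hq' hf'
  have hℓ : ∀ i, (ℓ i : ℝ) ≠ 0 := fun i => Nat.cast_ne_zero.2 (H.pos i).ne'
  -- Shifting the parameter by `k / ℓ` advances the component by `k` turns, so that it starts at the
  -- representative used in `FramedBraid.closure`.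
  obtain ⟨M', hc, hf, hMM'⟩ := M.exists_isotopic_reparam (fun i t => t + (k i).val / ℓ i)
    (fun i => by fun_prop) (fun i t => by ring) (fun i t => by simp)
  have harg : ∀ i t, (ℓ i : ℝ) * (t + (k i).val / ℓ i) = ℓ i * t + (k i).val := fun i t => by
    have := hℓ i
    field_simp
  refine ⟨_, H.toBraid e hq' hf', (hLM.trans hMM').congr_right (H.componentEquiv e hq' hf')
    (fun i => ?_) fun i => ?_⟩
  · rw [hc]
    funext t
    have := bend_add_int (q' i (stair 1 (ℓ i * t + (k i).val))) (ℓ i * t) (k i).val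
    simp only [Int.cast_natCast] at this
    simp only [FramedBraid.closure]
    rw [(hM i _).1, harg, this, H.turns_componentEquiv, hk, (H.toBraid_closed e hq' hf' i _ _).1]
  · rw [hf]
    funext t
    have := bendVec_add_int (q' i (stair 1 (ℓ i * t + (k i).val)))
      (f' i (stair 1 (ℓ i * t + (k i).val))) (ℓ i * t) (k i).val
    simp only [Int.cast_natCast] at this
    simp only [FramedBraid.closure]
    rw [(hM i _).2, harg, this, H.turns_componentEquiv, hk, (H.toBraid_closed e hq' hf' i _ _).1,
      (H.toBraid_closed e hq' hf' i _ _).2]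

/-- Every oriented framed link in `ℝ³` is isotopic to the standard closure of a framed braid. -/
theorem mainTheorem9 (c : ℕ) (L : FramedLink (Fin c)) :
    ∃ (n : ℕ) (b : FramedBraid n), L.Isotopic b.closure := by
  obtain ⟨ℓ, q, f, h⟩ := L.exists_isotopicBent
  exact h.exists_closure
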